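/- Let $p\in(1,\infty)$. There is a constant $C=C(p)>0$, depending only on $p$, such that the following holds. Let $N\ge 1$, let $\Omega\subset\mathbb{R}^N$ be a bounded domain, and let $\mu$ be a finite nonnegative Borel measure on $[0,1]$ with $\mu(\{0\})=0$, $\mu((0,1))>0$ and $\alpha:=\mu(\{1\})>0$. Put $$C_{N,s,p}:=\frac{\frac{sp}{2}(1-s)2^{2s-1}}{\pi^{\frac{N-1}{2}}}\,\frac{\Gamma(\frac{N+ps}{2})}{\Gamma(\frac{p+1}{2})\,\Gamma(2-s)},\qquad s\in(0,1).$$ Let $A_{\mu,p}u=\int_{(0,1)}(-\Delta)^s_p u\,d\mu(s)-\alpha\Delta_p u$. A weak subsolution (supersolution) of $A_{\mu,p}u=0$ in $\Omega$ is a function $u\in W^{1,p}_{loc}(\Omega)\cap L^{p-1}_{loc}(\mathbb{R}^N)$ with $$\int_{(0,1)}C_{N,s,p}\,\rho^{sp}\int_{\mathbb{R}^N\setminus B_\rho(x)}\frac{|u(y)|^{p-1}}{|y-x|^{N+sp}}\,dy\,d\mu(s)<\infty\quad\text{for all }x\in\mathbb{R}^N,\ \rho>0,$$ such that for every open $\Omega'\Subset\Omega$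 and every nonnegative $v\in W^{1,p}_0(\Omega')$, extended by zero to $\mathbb{R}^N$, the quantity $$\int_{(0,1)}C_{N,s,p}\iint_{\mathbb{R}^{2N}}\frac{|u(x)-u(y)|^{p-2}(u(x)-u(y))(v(x)-v(y))}{|x-y|^{N+sp}}\,dx\,dy\,d\mu(s)+\alpha\int_\Omega|\nabla u|^{p-2}\nabla u\cdot\nabla v\,dx$$ is $\le 0$ (respectively $\ge 0$). Let $k\in\mathbb{R}$, and let either $u$ be a weak subsolution and $\phi=(u-k)_+=\max\{u-k,0\}$, or $u$ be a weak supersolution and $\phi=(u-k)_-=\max\{-(u-k),0\}$. Then $\phi\in W^{1,p}_{loc}(\Omega)$, and for every ball $B_r=B_r(x_0)\subset\Omega$, $r>0$, and every nonnegative $w\in C_c^\infty(B_r)$, $$\begin{aligned} &\alpha\int_{B_r}w^p|\nabla\phi|^p\,dx+\int_{(0,1)}C_{N,s,p}\iint_{B_r\times B_r}\frac{|\phi(x)w(x)-\phi(y)w(y)|^p}{|x-y|^{N+sp}}\,dx\,dy\,d\mu(s)\\ &\le C\Bigg[\int_{(0,1)}C_{N,s,p}\iint_{B_r\times B_r}\frac{\max\{\phi(x),\phi(y)\}^p|w(x)-w(y)|^p}{|x-y|^{N+sp}}\,dx\,dy\,d\mu(s)\\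 &\quad+\int_{(0,1)}C_{N,s,p}\left(\operatorname*{ess\,sup}_{x\in\operatorname{supp}w}\int_{\mathbb{R}^N\setminus B_r}\frac{\phi(y)^{p-1}}{|x-y|^{N+sp}}\,dy\cdot\int_{B_r}\phi\,w^p\,dx\right)d\mu(s)+\alpha\int_{B_r}\phi^p|\nabla w|^p\,dx\Bigg], \end{aligned}$$ where both sides are read in $[0,\infty]$. -/

import Mathlib

open MeasureTheory Set Metric
open scoped ENNReal ContDiff

noncomputable section

/-- `η ∈ C_c^∞(Ω)`: smooth on the whole space, with compact support contained in `Ω`. -/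
def IsTestFunction {N : ℕ} (Ω : Set (EuclideanSpace ℝ (Fin N)))
    (η : EuclideanSpace ℝ (Fin N) → ℝ) : Prop :=
  ContDiff ℝ ∞ η ∧ HasCompactSupport η ∧ tsupport η ⊆ Ω

/-- `G` is the weak (distributional) gradient of `u` in the open set `Ω`. -/
def HasWeakGradient {N : ℕ} (Ω : Set (EuclideanSpace ℝ (Fin N)))
    (u : EuclideanSpace ℝ (Fin N) → ℝ)
    (G : EuclideanSpace ℝ (Fin N) → EuclideanSpace ℝ (Fin N)) : Prop :=
  LocallyIntegrableOn u Ω ∧ LocallyIntegrableOn G Ω ∧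
    ∀ η, IsTestFunction Ω η →
      ∫ x in Ω, u x • gradient η x = - ∫ x in Ω, η x • G x

/-- `u ∈ W^{1,p}_loc(Ω)` with weak gradient `G` (which is unique up to null sets). -/
def MemW1pLoc {N : ℕ} (p : ℝ) (Ω : Set (EuclideanSpace ℝ (Fin N)))
    (u : EuclideanSpace ℝ (Fin N) → ℝ)
    (G : EuclideanSpace ℝ (Fin N) → EuclideanSpace ℝ (Fin N)) : Prop :=
  HasWeakGradient Ω u G ∧
    ∀ K ⊆ Ω, IsCompact K →
      MemLp u (ENNReal.ofReal p) (volume.restrict K) ∧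
      MemLp G (ENNReal.ofReal p) (volume.restrict K)

/-- `v ∈ W_0^{1,p}(Ω')`, as a function on the whole space: `v` is in `W^{1,p}(ℝ^N)`, with weak
gradient `V`, and it vanishes outside `Ω'`. -/
def MemW1pZero {N : ℕ} (p : ℝ) (Ω' : Set (EuclideanSpace ℝ (Fin N)))
    (v : EuclideanSpace ℝ (Fin N) → ℝ)
    (V : EuclideanSpace ℝ (Fin N) → EuclideanSpace ℝ (Fin N)) : Prop :=
  HasWeakGradient univ v V ∧
    MemLp v (ENNReal.ofReal p) volume ∧ MemLp V (ENNReal.ofReal p) volume ∧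
    ∀ x, x ∉ Ω' → v x = 0

/-- The normalizing constant `C_{N,p,s}` of the fractional `p`-Laplacian. -/
def normConst (N : ℕ) (p s : ℝ) : ℝ :=
  (s * p / 2 * (1 - s) * 2 ^ (2 * s - 1)) / Real.pi ^ (((N : ℝ) - 1) / 2) *
    (Real.Gamma ((N + p * s) / 2) / (Real.Gamma ((p + 1) / 2) * Real.Gamma (2 - s)))

/-- The nonlocal superposition tail `Tail(u; x₀, r)`, with values in `[0, ∞]`. -/
def superTail {N : ℕ} (μ : Measure ℝ) (p : ℝ) (u : EuclideanSpace ℝ (Fin N) → ℝ)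
    (x₀ : EuclideanSpace ℝ (Fin N)) (r : ℝ) : ℝ≥0∞ :=
  (∫⁻ s in Ioo (0 : ℝ) 1, ENNReal.ofReal (normConst N p s * r ^ (s * p)) *
      (∫⁻ y in (ball x₀ r)ᶜ, ENNReal.ofReal (|u y| ^ (p - 1) / ‖y - x₀‖ ^ (N + s * p))) ∂μ)
    ^ (1 / (p - 1))

/-- The tail space: `u ∈ L^{p-1}_loc(ℝ^N)` with `Tail(u; x, r) < ∞` for all `x` and `r > 0`. -/
def MemTailSpace {N : ℕ} (μ : Measure ℝ) (p : ℝ) (u : EuclideanSpace ℝ (Fin N) → ℝ) : Prop :=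
  (∀ K, IsCompact K → MemLp u (ENNReal.ofReal (p - 1)) (volume.restrict K)) ∧
    ∀ x : EuclideanSpace ℝ (Fin N), ∀ r : ℝ, 0 < r → superTail μ p u x r < ⊤

/-- The weak form of `A_{μ,p} u` tested with `v`, where `U` and `V` are the weak gradients of `u`
and `v`. For `u` in `W^{1,p}_loc(Ω)` and in the tail space, and `v` in `W_0^{1,p}(Ω')` with `Ω'`
compactly contained in `Ω`, all the integrals converge absolutely. -/
def weakForm {N : ℕ} (μ : Measure ℝ) (p : ℝ) (Ω : Set (EuclideanSpace ℝ (Fin N)))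
    (u : EuclideanSpace ℝ (Fin N) → ℝ)
    (U : EuclideanSpace ℝ (Fin N) → EuclideanSpace ℝ (Fin N))
    (v : EuclideanSpace ℝ (Fin N) → ℝ)
    (V : EuclideanSpace ℝ (Fin N) → EuclideanSpace ℝ (Fin N)) : ℝ :=
  (∫ s in Ioo (0 : ℝ) 1, normConst N p s *
      (∫ z : EuclideanSpace ℝ (Fin N) × EuclideanSpace ℝ (Fin N),
        |u z.1 - u z.2| ^ (p - 2) * (u z.1 - u z.2) * (v z.1 - v z.2)
          / ‖z.1 - z.2‖ ^ (N + s * p)) ∂μ)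
    + μ.real {1} * ∫ x in Ω, ‖U x‖ ^ (p - 2) * inner ℝ (U x) (V x)

/-- `u` is a weak subsolution of `A_{μ,p} u = 0` in `Ω`. -/
def IsWeakSubsolution {N : ℕ} (μ : Measure ℝ) (p : ℝ) (Ω : Set (EuclideanSpace ℝ (Fin N)))
    (u : EuclideanSpace ℝ (Fin N) → ℝ) : Prop :=
  MemTailSpace μ p u ∧ ∃ U, MemW1pLoc p Ω u U ∧
    ∀ Ω', IsOpen Ω' → IsCompact (closure Ω') → closure Ω' ⊆ Ω →
      ∀ v V, MemW1pZero p Ω' v V → (∀ x, 0 ≤ v x) → weakForm μ p Ω u U v V ≤ 0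

/-- `u` is a weak supersolution of `A_{μ,p} u = 0` in `Ω`. -/
def IsWeakSupersolution {N : ℕ} (μ : Measure ℝ) (p : ℝ) (Ω : Set (EuclideanSpace ℝ (Fin N)))
    (u : EuclideanSpace ℝ (Fin N) → ℝ) : Prop :=
  MemTailSpace μ p u ∧ ∃ U, MemW1pLoc p Ω u U ∧
    ∀ Ω', IsOpen Ω' → IsCompact (closure Ω') → closure Ω' ⊆ Ω →
      ∀ v V, MemW1pZero p Ω' v V → (∀ x, 0 ≤ v x) → 0 ≤ weakForm μ p Ω u U v V

end

/-! The inequality results from testing the equation with `v = φ w^p`, where `φ = (u - k)_+`.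
Everything else is pointwise algebra, together with the proof that this test function is admissible
and that the weak form converges absolutely.

Pointwise, `2 ^ p` times the integrand of the nonlocal form dominates `|φ(x)w(x) - φ(y)w(y)|^p` up
to an error `max(φ(x), φ(y))^p |w(x) - w(y)|^p` (`abs_truncation_mul_sub_rpow_le`). When only `x`
lies in the ball, the integrand is at least `-φ(y)^(p-1) φ(x) w(x)^p` over the kernel, which
produces the tail term (`neg_truncation_rpow_mul_le`). `rpow_mul_norm_rpow_le` is the analogue for
gradients. All three carry the same factor `2 ^ p`, as they must: only the sum of the nonlocal and
local forms has a sign. The constants come from algebra in `p` alone, hence do not depend on `N`,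
`s`, `μ` or the domain.

Admissibility rests on the chain rule for `(u - k)_+`. A Sobolev function is the integral of its
gradient along almost every translation segment, so its difference quotients converge to the
directional derivative in `L¹_loc`. The positive part is Lipschitz, so the quotients of `(u - k)_+`
converge to a one-sided derivative. Comparing the directions `e` and `-e` shows that the gradient
vanishes almost everywhere on `{u = k}`, so this derivative is linear in the direction
(`HasWeakGradient.ae_posPartDeriv_eq_inner`).

For absolute convergence, the part of the double integral near the diagonal costs `1 / (1 - s)`, by
the `L^p` modulus of continuity of `u` and `v`, and the far part costs `1 / s`. Both are cancelled
by the factor `s (1 - s)` of the normalizing constant. What remains is the superposition tail,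
finite by assumption. The positive and negative parts of the tested form are then finite, so they
can be cancelled in `[0, ∞]` without knowing beforehand that the energies are finite. Supersolutions
reduce to subsolutions through `u ↦ -u`, `k ↦ -k`. -/

/-! ### Pointwise inequalities -/

/-- Young's inequality with a small first term. -/
theorem mul_rpow_sub_one_mul_le {p : ℝ} (hp : 1 < p) {X Y : ℝ} (hX : 0 ≤ X) (hY : 0 ≤ Y) :
    p * X ^ (p - 1) * Y ≤ X ^ p / 2 + p * (2 * p) ^ (p - 1) * Y ^ p := by
  have hp0 : 0 < p := by linarith
  have e : ∀ Z : ℝ, 0 ≤ Z → Z ^ p = Z ^ (p - 1) * Z := fun Z hZ => by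
    conv_lhs => rw [show p = (p - 1) + 1 by ring]
    rw [Real.rpow_add_one' hZ (by linarith)]
  -- The threshold `X = 2pY` is where `p X^(p-1) Y` equals `X^p / 2`: above it the first term
  -- suffices, below it `X` is replaced by `2pY`.
  rcases le_total (2 * p * Y) X with h | h
  · have h1 : p * X ^ (p - 1) * Y ≤ X ^ p / 2 := by
      rw [e X hX]
      have := mul_le_mul_of_nonneg_left h (Real.rpow_nonneg hX (p - 1))
      nlinarith
    have : 0 ≤ p * (2 * p) ^ (p - 1) * Y ^ p := by positivity
    linarith
  · have h1 : X ^ (p - 1) ≤ (2 * p * Y) ^ (p - 1) :=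
      Real.rpow_le_rpow hX h (by linarith)
    rw [Real.mul_rpow (by positivity) hY] at h1
    have h2 : p * X ^ (p - 1) * Y ≤ p * (2 * p) ^ (p - 1) * Y ^ p := by
      rw [e Y hY]
      have := mul_le_mul_of_nonneg_left h1 (mul_nonneg hp0.le hY)
      nlinarith
    have : 0 ≤ X ^ p / 2 := by positivity
    linarith

theorem add_rpow_le_two_rpow_mul {p : ℝ} (hp : 1 ≤ p) {X Y : ℝ} (hX : 0 ≤ X) (hY : 0 ≤ Y) :
    (X + Y) ^ p ≤ 2 ^ (p - 1) * (X ^ p + Y ^ p) := by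
  lift X to NNReal using hX
  lift Y to NNReal using hY
  exact_mod_cast NNReal.rpow_add_le_mul_rpow_add_rpow X Y hp

/-- The graph of the convex function `t ↦ t^p` lies above its tangent at `b`. For `b > 0` this is
Bernoulli's inequality applied to `a / b`. -/
theorem rpow_sub_rpow_le {p : ℝ} (hp : 1 < p) {a b : ℝ} (ha : 0 ≤ a) (hb : 0 ≤ b) :
    b ^ p - a ^ p ≤ p * b ^ (p - 1) * (b - a) := by
  rcases hb.eq_or_lt with rfl | hb'
  · rw [Real.zero_rpow (by linarith), Real.zero_rpow (by linarith)]
    have : 0 ≤ a ^ p := by positivity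
    simpa using this
  have h := one_add_mul_self_le_rpow_one_add (s := a / b - 1)
    (by have : 0 ≤ a / b := by positivity
        linarith) hp.le
  have h2 : (1 + (a / b - 1)) ^ p = a ^ p / b ^ p := by
    rw [← Real.div_rpow ha hb]; congr 1; ring
  rw [h2, le_div_iff₀ (by positivity)] at h
  have e : b ^ p = b ^ (p - 1) * b := by
    conv_lhs => rw [show p = (p - 1) + 1 by ring]
    rw [Real.rpow_add_one' hb (by linarith)]
  have h3 : (1 + p * (a / b - 1)) * b ^ p = b ^ p - p * b ^ (p - 1) * (b - a) := by
    rw [e]; field_simp; ring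
  linarith

/-- The constant of the pointwise inequalities behind the Caccioppoli estimate. -/
noncomputable def caccioppoliConst (p : ℝ) : ℝ := 2 ^ p * (p * (2 * p) ^ (p - 1) + 1)

theorem two_rpow_le_caccioppoliConst {p : ℝ} (hp : 1 < p) : (2 : ℝ) ^ p ≤ caccioppoliConst p := by
  have : 0 ≤ p * (2 * p) ^ (p - 1) := by positivity
  have h2 : (0 : ℝ) < 2 ^ p := by positivity
  unfold caccioppoliConst
  nlinarith

theorem caccioppoliConst_pos {p : ℝ} (hp : 1 < p) : 0 < caccioppoliConst p :=
  (show (0 : ℝ) < 2 ^ p by positivity).trans_le (two_rpow_le_caccioppoliConst hp)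

/-- The difference `f a - g b` splits into a variation `X = (f - g) max(a, b)` of the function and a
variation `Y = f |a - b|` of the cutoff. If `b ≤ a`, then `X^p` is at most the signed term `T`. If
`a ≤ b`, the tangent inequality for `b^p - a^p` costs `p X^(p-1) Y`, and Young's inequality absorbs
half of `X^p`. -/
theorem abs_mul_sub_mul_rpow_le_of_le {p : ℝ} (hp : 1 < p) {f g a b : ℝ}
    (hg : 0 ≤ g) (hgf : g ≤ f) (ha : 0 ≤ a) (hb : 0 ≤ b) :
    |f * a - g * b| ^ p ≤ 2 ^ p * ((f - g) ^ (p - 1) * (f * a ^ p - g * b ^ p))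
      + caccioppoliConst p * (f ^ p * |a - b| ^ p) := by
  have hp0 : 0 < p := by linarith
  have hf : 0 ≤ f := hg.trans hgf
  have hd : 0 ≤ f - g := sub_nonneg.2 hgf
  set T := (f - g) ^ (p - 1) * (f * a ^ p - g * b ^ p) with hT
  set m := max a b with hm
  have hm0 : 0 ≤ m := le_max_of_le_left ha
  set X := (f - g) * m with hX
  set Y := f * |a - b| with hY
  have hX0 : 0 ≤ X := by positivity
  have hY0 : 0 ≤ Y := by positivity
  have e : ∀ Z : ℝ, 0 ≤ Z → Z ^ p = Z ^ (p - 1) * Z := fun Z hZ => by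
    conv_lhs => rw [show p = (p - 1) + 1 by ring]
    rw [Real.rpow_add_one' hZ (by linarith)]
  have hXp : X ^ p = (f - g) ^ (p - 1) * ((f - g) * m ^ p) := by
    rw [hX, Real.mul_rpow hd hm0, e _ hd]; ring
  have hYp : Y ^ p = f ^ p * |a - b| ^ p := by rw [hY, Real.mul_rpow hf (abs_nonneg _)]
  have hD : 0 ≤ (f - g) ^ (p - 1) := by positivity
  have key : X ^ p / 2 ≤ T + p * (2 * p) ^ (p - 1) * Y ^ p := by
    rcases le_total b a with h | h
    · have h1 : X ^ p ≤ T := by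
        rw [hXp, hT]
        apply mul_le_mul_of_nonneg_left _ hD
        rw [hm, max_eq_left h]
        have := Real.rpow_le_rpow hb h hp0.le
        nlinarith
      have : 0 ≤ X ^ p := by positivity
      have : 0 ≤ p * (2 * p) ^ (p - 1) * Y ^ p := by positivity
      linarith
    · have hmb : m = b := max_eq_right h
      have h1 : X ^ p - p * X ^ (p - 1) * Y ≤ T := by
        have e1 : X ^ (p - 1) = (f - g) ^ (p - 1) * b ^ (p - 1) := by
          rw [hX, hmb, Real.mul_rpow hd hb]
        have e2 : |a - b| = b - a := by rw [abs_sub_comm, abs_of_nonneg (by linarith)]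
        rw [hXp, hT, e1, hmb, hY, e2]
        have h3 := rpow_sub_rpow_le hp ha hb
        have h4 : (f - g) * b ^ p - f * (p * b ^ (p - 1) * (b - a)) ≤ f * a ^ p - g * b ^ p := by
          nlinarith
        have := mul_le_mul_of_nonneg_left h4 hD
        linarith
      have := mul_rpow_sub_one_mul_le hp hX0 hY0
      linarith
  have h1 : |f * a - g * b| ≤ X + Y := by
    rcases le_total b a with h | h
    · rw [hX, hY, hm, max_eq_left h, abs_of_nonneg (sub_nonneg.2 h), abs_le]
      constructor <;> nlinarith
    · rw [hX, hY, hm, max_eq_right h, abs_sub_comm a b, abs_of_nonneg (sub_nonneg.2 h), abs_le]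
      constructor <;> nlinarith
  have h2 : |f * a - g * b| ^ p ≤ 2 ^ (p - 1) * (X ^ p + Y ^ p) :=
    (Real.rpow_le_rpow (abs_nonneg _) h1 hp0.le).trans
      (add_rpow_le_two_rpow_mul hp.le hX0 hY0)
  have h3 : (2 : ℝ) ^ p = 2 ^ (p - 1) * 2 := e 2 (by norm_num)
  rw [← hYp]
  unfold caccioppoliConst
  have h4 : (0 : ℝ) ≤ 2 ^ (p - 1) := by positivity
  have h5 : 0 ≤ Y ^ p := by positivity
  rw [h3]
  have := mul_le_mul_of_nonneg_left key h4
  nlinarith [mul_nonneg h4 h5]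

/-- The kernel nonlinearity of the `p`-Laplacian dominates that of the truncations. -/
theorem signed_rpow_mul_ge {p : ℝ} (hp : 1 < p) {a b k A B : ℝ} (hab : b ≤ a) (hA : 0 ≤ A)  :
    (max (a - k) 0 - max (b - k) 0) ^ (p - 1) * (max (a - k) 0 * A - max (b - k) 0 * B)
      ≤ |a - b| ^ (p - 2) * (a - b) * (max (a - k) 0 * A - max (b - k) 0 * B) := by
  have hd : 0 ≤ a - b := sub_nonneg.2 hab
  have e : |a - b| ^ (p - 2) * (a - b) = (a - b) ^ (p - 1) := by
    rw [abs_of_nonneg hd, ← Real.rpow_add_one' hd (by linarith)]; congr 1; ring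
  rw [e]
  rcases le_total k b with h | h
  · rw [max_eq_left (by linarith), max_eq_left (by linarith)]
    rw [show a - k - (b - k) = a - b by ring]
  · rw [max_eq_right (a := b - k) (by linarith)]
    simp only [sub_zero, zero_mul]
    apply mul_le_mul_of_nonneg_right _ (by positivity)
    apply Real.rpow_le_rpow (by positivity) _ (by linarith)
    exact max_le (by linarith) hd

/-- The pointwise inequality for the nonlocal energy of the truncation `(u - k)_+`. -/
theorem abs_truncation_mul_sub_rpow_le {p : ℝ} (hp : 1 < p) (a b k : ℝ) {A B : ℝ}
    (hA : 0 ≤ A) (hB : 0 ≤ B) :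
    |max (a - k) 0 * A - max (b - k) 0 * B| ^ p
      ≤ 2 ^ p * (|a - b| ^ (p - 2) * (a - b) * (max (a - k) 0 * A ^ p - max (b - k) 0 * B ^ p))
      + caccioppoliConst p * (max (max (a - k) 0) (max (b - k) 0) ^ p * |A - B| ^ p) := by
  have h2 : (0 : ℝ) ≤ 2 ^ p := by positivity
  have main : ∀ a b A B : ℝ, b ≤ a → 0 ≤ A → 0 ≤ B →
      |max (a - k) 0 * A - max (b - k) 0 * B| ^ p
      ≤ 2 ^ p * (|a - b| ^ (p - 2) * (a - b) * (max (a - k) 0 * A ^ p - max (b - k) 0 * B ^ p))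
      + caccioppoliConst p * (max (max (a - k) 0) (max (b - k) 0) ^ p * |A - B| ^ p) := by
    intro a b A B hab hA hB
    have hm : max (b - k) 0 ≤ max (a - k) 0 := max_le_max (by linarith) le_rfl
    have h := abs_mul_sub_mul_rpow_le_of_le hp (le_max_right (b - k) 0) hm hA hB
    have h3 := mul_le_mul_of_nonneg_left
      (signed_rpow_mul_ge hp (k := k) (B := B ^ p) hab (Real.rpow_nonneg hA p)) h2
    rw [max_eq_left hm]
    linarith
  rcases le_total b a with h | h
  · exact main a b A B h hA hB
  · have := main b a B A h hB hA
    rw [abs_sub_comm (max (b - k) 0 * B), abs_sub_comm b a, abs_sub_comm B A,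
      max_comm (max (b - k) 0)] at this
    calc _ ≤ _ := this
      _ = _ := by ring

/-- The pointwise inequality for the interaction of the truncation with the exterior. -/
theorem neg_truncation_rpow_mul_le {p : ℝ} (hp : 1 < p) (a b k : ℝ) :
    -(max (b - k) 0 ^ (p - 1) * max (a - k) 0) ≤ |a - b| ^ (p - 2) * (a - b) * max (a - k) 0 := by
  rcases le_total a k with hk | hk
  · rw [max_eq_right (a := a - k) (by linarith)]; simp
  rw [← neg_mul]
  apply mul_le_mul_of_nonneg_right _ (le_max_right _ _)
  -- For `b ≤ a` the right side is nonnegative. Otherwise `k ≤ a ≤ b` and `b - a ≤ b - k`.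
  rcases le_total b a with h | h
  · have : 0 ≤ max (b - k) 0 ^ (p - 1) := by positivity
    have h2 : 0 ≤ |a - b| ^ (p - 2) * (a - b) :=
      mul_nonneg (by positivity) (by linarith)
    linarith
  · have hd : 0 ≤ b - a := by linarith
    have e : |a - b| ^ (p - 2) * (a - b) = -(b - a) ^ (p - 1) := by
      rw [abs_sub_comm, abs_of_nonneg hd, show a - b = -(b - a) by ring, mul_neg,
        ← Real.rpow_add_one' hd (by linarith)]
      congr 2; ring
    rw [e, neg_le_neg_iff]
    exact Real.rpow_le_rpow hd (le_max_of_le_left (by linarith)) (by linarith)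

/-- The pointwise inequality for the local energy. -/
theorem rpow_mul_norm_rpow_le {F : Type*} [NormedAddCommGroup F] [InnerProductSpace ℝ F]
    {p : ℝ} (hp : 1 < p) (U W : F) {a f : ℝ} (ha : 0 ≤ a) (hf : 0 ≤ f) :
    a ^ p * ‖U‖ ^ p
      ≤ 2 ^ p * (‖U‖ ^ (p - 2) * inner ℝ U (a ^ p • U + (f * (p * a ^ (p - 1))) • W))
      + caccioppoliConst p * (f ^ p * ‖W‖ ^ p) := by
  have e : ∀ Z : ℝ, 0 ≤ Z → Z ^ p = Z ^ (p - 1) * Z := fun Z hZ => by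
    conv_lhs => rw [show p = (p - 1) + 1 by ring]
    rw [Real.rpow_add_one' hZ (by linarith)]
  have e' : ∀ Z : ℝ, 0 ≤ Z → Z ^ (p - 1) = Z ^ (p - 2) * Z := fun Z hZ => by
    conv_lhs => rw [show p - 1 = (p - 2) + 1 by ring]
    rw [Real.rpow_add_one' hZ (by linarith)]
  set T := ‖U‖ ^ (p - 2) * inner ℝ U (a ^ p • U + (f * (p * a ^ (p - 1))) • W) with hT
  have hX0 : 0 ≤ a * ‖U‖ := by positivity
  have hY0 : 0 ≤ f * ‖W‖ := by positivity
  have hXp : (a * ‖U‖) ^ p = a ^ p * ‖U‖ ^ p := Real.mul_rpow ha (norm_nonneg _)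
  have hYp : (f * ‖W‖) ^ p = f ^ p * ‖W‖ ^ p := Real.mul_rpow hf (norm_nonneg _)
  have hX1 : (a * ‖U‖) ^ (p - 1) = a ^ (p - 1) * (‖U‖ ^ (p - 2) * ‖U‖) := by
    rw [Real.mul_rpow ha (norm_nonneg _), e' ‖U‖ (norm_nonneg _)]
  have hTe : T = a ^ p * ‖U‖ ^ p
      + p * a ^ (p - 1) * f * ‖U‖ ^ (p - 2) * inner ℝ U W := by
    rw [hT, inner_add_right, real_inner_smul_right, real_inner_smul_right,
      real_inner_self_eq_norm_sq, e ‖U‖ (norm_nonneg _), e' ‖U‖ (norm_nonneg _)]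
    ring
  have hin : -(‖U‖ * ‖W‖) ≤ inner ℝ U W := (abs_le.1 (abs_real_inner_le_norm U W)).1
  have hc : 0 ≤ p * a ^ (p - 1) * f * ‖U‖ ^ (p - 2) := by
    have : 0 ≤ p := by linarith
    positivity
  have h1 := mul_le_mul_of_nonneg_left hin hc
  have h2 := mul_rpow_sub_one_mul_le hp hX0 hY0
  rw [hXp, hYp, hX1] at h2
  have h3 : a ^ p * ‖U‖ ^ p / 2 ≤ T + p * (2 * p) ^ (p - 1) * (f ^ p * ‖W‖ ^ p) := by
    rw [hTe]; linarith
  -- The factor `2` would do here. It is enlarged to `2 ^ p` to match the factor in the nonlocal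
  -- estimate, since the weak inequality controls only the sum of the two forms.
  have h4 : (2 : ℝ) ≤ 2 ^ p := by
    simpa using Real.rpow_le_rpow_of_exponent_le (x := 2) (by norm_num) hp.le
  have h5 : 0 ≤ f ^ p * ‖W‖ ^ p := by positivity
  have h6 : 0 ≤ a ^ p * ‖U‖ ^ p := by positivity
  unfold caccioppoliConst
  have h7 : 2 * (T + p * (2 * p) ^ (p - 1) * (f ^ p * ‖W‖ ^ p))
      ≤ 2 ^ p * (T + p * (2 * p) ^ (p - 1) * (f ^ p * ‖W‖ ^ p)) :=
    mul_le_mul_of_nonneg_right h4 (by linarith)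
  nlinarith

/-! ### Translations and difference quotients of Sobolev functions -/

/-- The shear `(t, x) ↦ (t, x + t e)` preserves the product measure. This justifies exchanging the
integral along segments with the integral in space. -/
theorem integrable_translate_unitInterval {N : ℕ} {F : Type*} [NormedAddCommGroup F]
    {g : EuclideanSpace ℝ (Fin N) → F} (hg : Integrable g) (e : EuclideanSpace ℝ (Fin N)) :
    Integrable (fun z : ℝ × EuclideanSpace ℝ (Fin N) => g (z.2 + z.1 • e))
      ((volume.restrict (Icc (0 : ℝ) 1)).prod volume) := by
  have hmp : MeasurePreserving
      (fun z : ℝ × EuclideanSpace ℝ (Fin N) => (z.1, z.2 + z.1 • e))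
      ((volume.restrict (Icc (0 : ℝ) 1)).prod volume)
      ((volume.restrict (Icc (0 : ℝ) 1)).prod volume) := by
    refine (MeasurePreserving.id (volume.restrict (Icc (0 : ℝ) 1))).skew_product
      (g := fun t x => x + t • e) ?_ ?_
    · exact Continuous.measurable (by fun_prop)
    · exact ae_of_all _ fun t => map_add_right_eq_self volume (t • e)
  exact (hmp.integrable_comp_of_integrable (hg.comp_snd _) :)

/-- Both sides are integrated against a test function `η`. Fubini and translation invariance move
the shift onto `η`, the hypothesis trades `g` for a derivative of `η`, and the fundamental theorem
in `t` turns that derivative into `η(y) - η(y - e)`. Equality against all `η` gives equality almost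
everywhere. -/
theorem ae_sub_eq_integral_translate {N : ℕ} {u g : EuclideanSpace ℝ (Fin N) → ℝ}
    (hu : Integrable u) (hg : Integrable g) {W : Set (EuclideanSpace ℝ (Fin N))}
    (hW : IsOpen W) (e : EuclideanSpace ℝ (Fin N))
    (h : ∀ t ∈ Icc (0 : ℝ) 1, ∀ η, IsTestFunction W η →
      ∫ y, fderiv ℝ η (y - t • e) e * u y = -∫ y, η (y - t • e) * g y) :
    ∀ᵐ x, x ∈ W → u (x + e) - u x = ∫ t in Icc (0 : ℝ) 1, g (x + t • e) := by
  set ν : Measure ℝ := volume.restrict (Icc (0 : ℝ) 1) with hν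
  have hG := integrable_translate_unitInterval hg e
  have hI : Integrable (fun x => ∫ t, g (x + t • e) ∂ν) := hG.integral_prod_right
  have hue : Integrable (fun x => u (x + e)) := hu.comp_add_right e
  have hf : Integrable (fun x => u (x + e) - u x - ∫ t, g (x + t • e) ∂ν) := (hue.sub hu).sub hI
  have := hW.ae_eq_zero_of_integral_contDiff_smul_eq_zero (μ := volume)
    (f := fun x => u (x + e) - u x - ∫ t, g (x + t • e) ∂ν)
    (hf.locallyIntegrable.locallyIntegrableOn W) ?_
  · filter_upwards [this] with x hx hxW
    exact sub_eq_zero.1 (hx hxW)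
  intro η hη hηc hηW
  have hdc : Continuous (fderiv ℝ η) := hη.continuous_fderiv (by simp)
  have hηcont := hη.continuous
  obtain ⟨C, hC⟩ := hηcont.bounded_above_of_compact_support hηc
  obtain ⟨D, hD⟩ := hdc.bounded_above_of_compact_support (hηc.fderiv ℝ)
  have i1 : Integrable (fun x => η x * u (x + e)) :=
    hue.bdd_mul hηcont.aestronglyMeasurable (ae_of_all _ hC)
  have i2 : Integrable (fun x => η x * u x) :=
    hu.bdd_mul hηcont.aestronglyMeasurable (ae_of_all _ hC)
  have i3 : Integrable (fun x => η x * ∫ t, g (x + t • e) ∂ν) :=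
    hI.bdd_mul hηcont.aestronglyMeasurable (ae_of_all _ hC)
  have i4 : Integrable (fun z : ℝ × EuclideanSpace ℝ (Fin N) => η z.2 * g (z.2 + z.1 • e))
      (ν.prod volume) :=
    hG.bdd_mul (hηcont.comp continuous_snd).aestronglyMeasurable (ae_of_all _ fun z => hC z.2)
  have i5 : Integrable (fun z : ℝ × EuclideanSpace ℝ (Fin N) =>
      fderiv ℝ η (z.2 - z.1 • e) e * u z.2) (ν.prod volume) := by
    refine (hu.comp_snd ν).bdd_mul (c := D * ‖e‖) ?_ (ae_of_all _ fun z => ?_)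
    · have : Continuous fun z : ℝ × EuclideanSpace ℝ (Fin N) => fderiv ℝ η (z.2 - z.1 • e) e := by
        fun_prop
      exact this.aestronglyMeasurable
    · exact ((fderiv ℝ η _).le_opNorm e).trans (by gcongr; exact hD _)
  have hFTC : ∀ y, ∫ t, fderiv ℝ η (y - t • e) e ∂ν = η y - η (y - e) := by
    intro y
    have hder : ∀ t ∈ uIcc (0 : ℝ) 1, HasDerivAt (fun t : ℝ => - η (y - t • e))
        (fderiv ℝ η (y - t • e) e) t := by
      intro t _
      have h1 : HasDerivAt (fun t : ℝ => y - t • e) (-((1 : ℝ) • e)) t :=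
        ((hasDerivAt_id t).smul_const e).const_sub y
      have h2 := ((hη.differentiable (by simp)).differentiableAt
        (x := y - t • e)).hasFDerivAt.comp_hasDerivAt t h1
      have h3 := h2.neg
      simp only [one_smul, map_neg, neg_neg] at h3
      exact h3
    have := intervalIntegral.integral_eq_sub_of_hasDerivAt hder
      (Continuous.intervalIntegrable (by fun_prop) _ _)
    rw [hν, integral_Icc_eq_integral_Ioc, ← intervalIntegral.integral_of_le zero_le_one, this]
    simp; ring
  have key : ∫ x, η x * ∫ t, g (x + t • e) ∂ν = (∫ x, η x * u (x + e)) - ∫ x, η x * u x := by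
    calc ∫ x, η x * ∫ t, g (x + t • e) ∂ν
        = ∫ x, ∫ t, η x * g (x + t • e) ∂ν := by simp_rw [integral_const_mul]
      _ = ∫ t, (∫ x, η x * g (x + t • e)) ∂ν := (integral_integral_swap i4).symm
      _ = ∫ t, (-∫ y, fderiv ℝ η (y - t • e) e * u y) ∂ν := by
          refine setIntegral_congr_fun measurableSet_Icc fun t ht => ?_
          rw [h t ht η ⟨hη, hηc, hηW⟩, neg_neg,
            ← integral_add_right_eq_self (fun y => η (y - t • e) * g y) (t • e)]
          simp
      _ = -∫ y, ∫ t, fderiv ℝ η (y - t • e) e * u y ∂ν := by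
          rw [integral_neg, integral_integral_swap i5]
      _ = -∫ y, (η y * u y - η (y - e) * u y) := by
          congr 1; congr 1; ext y
          rw [integral_mul_const, hFTC]; ring
      _ = (∫ x, η x * u (x + e)) - ∫ x, η x * u x := by
          have i6 : Integrable (fun x => η (x - e) * u x) := by
            simpa using i1.comp_sub_right e
          rw [integral_sub i2 i6, ← integral_add_right_eq_self (fun y => η (y - e) * u y) e]
          simp
  simp only [smul_eq_mul, mul_sub]
  rw [integral_sub (f := fun x => η x * u (x + e) - η x * u x) (i1.sub i2) i3, integral_sub i1 i2, key, sub_self]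

theorem integrable_smul_of_tsupport_subset {N : ℕ} {F : Type*} [NormedAddCommGroup F]
    [NormedSpace ℝ F] {f : EuclideanSpace ℝ (Fin N) → F} {η : EuclideanSpace ℝ (Fin N) → ℝ}
    (hη : Continuous η) (hc : HasCompactSupport η) (hf : IntegrableOn f (tsupport η)) :
    Integrable (fun x => η x • f x) := by
  have h1 : IntegrableOn (fun x => η x • f x) (tsupport η) := hf.continuousOn_smul hη.continuousOn hc
  refine (integrableOn_iff_integrable_of_support_subset ?_).1 h1
  exact (Function.support_smul_subset_left _ _).trans (subset_tsupport η)

/-- Pairing the vector identity with a fixed direction gives a scalar integration by parts over the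
whole space, the form used for translations. `HasWeakGradient.of_integral_fderiv_mul` is the
converse. -/
theorem HasWeakGradient.integral_fderiv_mul {N : ℕ} {Ω : Set (EuclideanSpace ℝ (Fin N))}
    {u : EuclideanSpace ℝ (Fin N) → ℝ} {U : EuclideanSpace ℝ (Fin N) → EuclideanSpace ℝ (Fin N)}
    (h : HasWeakGradient Ω u U) {η : EuclideanSpace ℝ (Fin N) → ℝ} (hη : IsTestFunction Ω η)
    (e : EuclideanSpace ℝ (Fin N)) :
    ∫ x, fderiv ℝ η x e * u x = -∫ x, η x * inner ℝ (U x) e := by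
  obtain ⟨hηs, hηc, hηΩ⟩ := hη
  have hdc : Continuous (fderiv ℝ η) := hηs.continuous_fderiv (by simp)
  have hgc : Continuous (gradient η) := (InnerProductSpace.toDual ℝ _).symm.continuous.comp hdc
  have hU : Integrable (fun x => η x • U x) :=
    integrable_smul_of_tsupport_subset hηs.continuous hηc
      (h.2.1.integrableOn_compact_subset hηΩ hηc)
  have hz : ∀ x, x ∉ tsupport η → fderiv ℝ η x = 0 := fun x hx =>
    image_eq_zero_of_notMem_tsupport fun hx' => hx (tsupport_fderiv_subset ℝ hx')
  have hz2 : ∀ x, x ∉ tsupport η → gradient η x = 0 := fun x hx => by simp [gradient, hz x hx]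
  have hu : Integrable (fun x => u x • gradient η x) := by
    have h1 : IntegrableOn (fun x => u x • gradient η x) (tsupport η) :=
      (h.1.integrableOn_compact_subset hηΩ hηc).smul_continuousOn hgc.continuousOn hηc
    refine (integrableOn_iff_integrable_of_support_subset ?_).1 h1
    intro x hx
    by_contra hx'
    exact hx (by simp [hz2 x hx'])
  have h2 := h.2.2 η ⟨hηs, hηc, hηΩ⟩
  rw [setIntegral_eq_integral_of_forall_compl_eq_zero
      (fun x hx => by rw [hz2 x fun hx' => hx (hηΩ hx'), smul_zero]),
    setIntegral_eq_integral_of_forall_compl_eq_zero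
      (fun x hx => by rw [image_eq_zero_of_notMem_tsupport fun hx' => hx (hηΩ hx'), zero_smul])] at h2
  have h3 := congrArg (fun v => inner ℝ e v) h2
  simp only [inner_neg_right] at h3
  rw [← integral_inner hu, ← integral_inner hU] at h3
  simp only [inner_smul_right, inner_gradient_right, conj_trivial] at h3
  simp_rw [real_inner_comm e, mul_comm (fderiv ℝ η _ e)]
  exact h3

/-- Sobolev functions are absolutely continuous along almost every translation segment. -/
theorem HasWeakGradient.ae_sub_eq_integral {N : ℕ} {Ω : Set (EuclideanSpace ℝ (Fin N))}
    {u : EuclideanSpace ℝ (Fin N) → ℝ} {U : EuclideanSpace ℝ (Fin N) → EuclideanSpace ℝ (Fin N)}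
    (h : HasWeakGradient Ω u U) {W K : Set (EuclideanSpace ℝ (Fin N))} (hW : IsOpen W)
    (hK : IsCompact K) (hKΩ : K ⊆ Ω) (e : EuclideanSpace ℝ (Fin N))
    (hWK : ∀ x ∈ W, ∀ t ∈ Icc (0 : ℝ) 1, x + t • e ∈ K) :
    ∀ᵐ x, x ∈ W → u (x + e) - u x = ∫ t in Icc (0 : ℝ) 1, inner ℝ (U (x + t • e)) e := by
  -- Cutting `u` and `U` off outside `K` makes them globally integrable. The cutoff is invisible to
  -- the identity, because every translate of a test function on `W` along the segment is supported
  -- in `K`.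
  have hu : Integrable (K.indicator u) :=
    (h.1.integrableOn_compact_subset hKΩ hK).integrable_indicator hK.measurableSet
  have hU : Integrable (K.indicator fun x => inner ℝ (U x) e) :=
    IntegrableOn.integrable_indicator
      ((h.2.1.integrableOn_compact_subset hKΩ hK).inner_const e) hK.measurableSet
  have := ae_sub_eq_integral_translate hu hU hW e ?_
  · filter_upwards [this] with x hx hxW
    have h0 := hWK x hxW 0 (by simp)
    have h1 := hWK x hxW 1 (by simp)
    simp only [zero_smul, add_zero, one_smul] at h0 h1
    have h2 := hx hxW
    rw [indicator_of_mem h0, indicator_of_mem h1] at h2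
    rw [h2]
    exact setIntegral_congr_fun measurableSet_Icc fun t ht => indicator_of_mem (hWK x hxW t ht) _
  · intro t ht η ⟨hηs, hηc, hηW⟩
    set ζ : EuclideanSpace ℝ (Fin N) → ℝ := fun y => η (y - t • e) with hζ
    have hsub : tsupport ζ ⊆ K := by
      have h1 : tsupport ζ ⊆ (fun y => y - t • e) ⁻¹' tsupport η :=
        tsupport_comp_subset_preimage η (by fun_prop)
      intro y hy
      simpa using hWK _ (hηW (h1 hy)) t ht
    have hζt : IsTestFunction Ω ζ :=
      ⟨hηs.comp (contDiff_id.sub contDiff_const), hK.of_isClosed_subset (isClosed_tsupport _) hsub,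
        hsub.trans hKΩ⟩
    have h1 := h.integral_fderiv_mul hζt e
    have hd : ∀ y, fderiv ℝ ζ y = fderiv ℝ η (y - t • e) := fun y => fderiv_comp_sub (t • e)
    have hz : ∀ x, x ∉ K → fderiv ℝ ζ x = 0 := fun x hx =>
      image_eq_zero_of_notMem_tsupport fun hx' => hx (hsub (tsupport_fderiv_subset ℝ hx'))
    have hz2 : ∀ x, x ∉ K → ζ x = 0 := fun x hx =>
      image_eq_zero_of_notMem_tsupport fun hx' => hx (hsub hx')
    calc ∫ y, fderiv ℝ η (y - t • e) e * K.indicator u y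
        = ∫ y, fderiv ℝ ζ y e * u y := by
          congr 1; ext y
          by_cases hy : y ∈ K
          · rw [indicator_of_mem hy, hd]
          · rw [indicator_of_notMem hy, hz y hy]; simp
      _ = -∫ y, ζ y * inner ℝ (U y) e := h1
      _ = _ := by
          congr 2; ext y
          by_cases hy : y ∈ K
          · rw [indicator_of_mem hy]
          · rw [indicator_of_notMem hy, hz2 y hy]; simp

-- Continuity of translations in `L¹`, as an instance of the continuity of composition with
-- measure-preserving maps.
open Filter Topology in
theorem tendsto_lintegral_translate_sub {N : ℕ} {f : EuclideanSpace ℝ (Fin N) → ℝ}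
    (hf : Integrable f) :
    Tendsto (fun h => ∫⁻ x, ‖f (x + h) - f x‖ₑ) (𝓝 0) (𝓝 0) := by
  have hL : MemLp f 1 volume := memLp_one_iff_integrable.2 hf
  let T : C(EuclideanSpace ℝ (Fin N), C(EuclideanSpace ℝ (Fin N), EuclideanSpace ℝ (Fin N))) :=
    ContinuousMap.curry ⟨fun z => z.2 + z.1, by fun_prop⟩
  have hT : ∀ h, MeasurePreserving (T h) volume volume := fun h =>
    measurePreserving_add_right volume h
  have hc : Continuous (fun h => Lp.compMeasurePreserving (T h) (hT h) (hL.toLp f)) :=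
    continuous_const.compMeasurePreservingLp T.continuous hT (by simp)
  have h2 := (hc.tendsto 0).edist (tendsto_const_nhds (x := hL.toLp f))
  have h3 : Lp.compMeasurePreserving (T 0) (hT 0) (hL.toLp f) = hL.toLp f := by
    rw [Lp.toLp_compMeasurePreserving]
    congr 1
    ext x; simp [T]
  rw [h3, edist_self] at h2
  refine h2.congr fun h => ?_
  rw [Lp.toLp_compMeasurePreserving, Lp.edist_toLp_toLp, eLpNorm_one_eq_lintegral_enorm]
  rfl

open Filter Topology in
/-- Difference quotients of Sobolev functions converge in `L¹_loc` to the weak derivative. -/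
theorem HasWeakGradient.tendsto_lintegral_diffQuot {N : ℕ} {Ω : Set (EuclideanSpace ℝ (Fin N))}
    (hΩ : IsOpen Ω)
    {u : EuclideanSpace ℝ (Fin N) → ℝ} {U : EuclideanSpace ℝ (Fin N) → EuclideanSpace ℝ (Fin N)}
    (h : HasWeakGradient Ω u U) {K : Set (EuclideanSpace ℝ (Fin N))} (hK : IsCompact K)
    (hKΩ : K ⊆ Ω) (e : EuclideanSpace ℝ (Fin N)) :
    Tendsto (fun t : ℝ => ∫⁻ x in K, ‖t⁻¹ * (u (x + t • e) - u x) - inner ℝ (U x) e‖ₑ)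
      (𝓝[>] 0) (𝓝 0) := by
  obtain ⟨δ, hδ, hδΩ⟩ := hK.exists_cthickening_subset_open hΩ hKΩ
  set K' := cthickening δ K with hK'
  have hK'c : IsCompact K' := hK.cthickening
  set g := K'.indicator (fun x => inner ℝ (U x) e) with hg
  have hgi : Integrable g := IntegrableOn.integrable_indicator
      ((h.2.1.integrableOn_compact_subset hδΩ hK'c).inner_const e) hK'c.measurableSet
  have hKK' : K ⊆ K' := self_subset_cthickening K
  rw [ENNReal.tendsto_nhds_zero]
  intro ε hε
  obtain ⟨δ', hδ', hball⟩ := Metric.eventually_nhds_iff.1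
    ((ENNReal.tendsto_nhds_zero.1 (tendsto_lintegral_translate_sub hgi)) ε hε)
  have hsmall : ∀ᶠ t : ℝ in 𝓝[>] 0, ‖t • e‖ < min (δ / 2) δ' := by
    have : Tendsto (fun t : ℝ => ‖t • e‖) (𝓝[>] 0) (𝓝 0) := by
      have : Continuous fun t : ℝ => ‖t • e‖ := by fun_prop
      simpa using (this.tendsto 0).mono_left nhdsWithin_le_nhds
    exact this.eventually_lt_const (lt_min (by linarith) hδ')
  filter_upwards [hsmall, self_mem_nhdsWithin] with t ht ht0
  have ht0 : (0 : ℝ) < t := ht0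
  -- Half of `δ` is spent on the distance of `x` from `K` and half on the translation, so whole
  -- segments stay in `K'`.
  have hseg : ∀ x ∈ thickening (δ / 2) K, ∀ s ∈ Icc (0 : ℝ) 1, x + s • (t • e) ∈ K' := by
    intro x hx s hs
    obtain ⟨y, hy, hxy⟩ := mem_thickening_iff.1 hx
    refine mem_cthickening_of_dist_le _ y δ K hy ?_
    have h1 : ‖s • (t • e)‖ ≤ ‖t • e‖ := by
      rw [norm_smul, Real.norm_of_nonneg hs.1]
      exact mul_le_of_le_one_left (norm_nonneg _) hs.2
    calc dist (x + s • (t • e)) y ≤ dist (x + s • (t • e)) x + dist x y := dist_triangle _ _ _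
      _ ≤ δ / 2 + δ / 2 := by
          gcongr
          rw [dist_eq_norm, add_sub_cancel_left]
          exact h1.trans (ht.le.trans (min_le_left _ _))
      _ = δ := by ring
  have hae := h.ae_sub_eq_integral isOpen_thickening hK'c hδΩ (t • e) hseg
  set ν : Measure ℝ := volume.restrict (Icc (0 : ℝ) 1) with hν
  have hνp : IsProbabilityMeasure ν := ⟨by simp [hν]⟩
  have hGi := integrable_translate_unitInterval hgi (t • e)
  have hGx : ∀ᵐ x : EuclideanSpace ℝ (Fin N),
      Integrable (fun s : ℝ => g (x + s • (t • e))) ν := hGi.prod_left_ae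
  calc ∫⁻ x in K, ‖t⁻¹ * (u (x + t • e) - u x) - inner ℝ (U x) e‖ₑ
      ≤ ∫⁻ x in K, ∫⁻ s, ‖g (x + s • (t • e)) - g x‖ₑ ∂ν := by
        refine lintegral_mono_ae ?_
        filter_upwards [ae_restrict_of_ae hae, ae_restrict_of_ae hGx,
          ae_restrict_mem hK.measurableSet] with x hx hxi hxK
        have hxK2 : x ∈ thickening (δ / 2) K := self_subset_thickening (by linarith) K hxK
        -- The error of the difference quotient is the average over the segment of `g(x + s t e) -
        -- g(x)`. Its `L¹` norm is therefore controlled by the translation modulus of `g`.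
        have e1 : t⁻¹ * (u (x + t • e) - u x) - inner ℝ (U x) e
            = ∫ s, (g (x + s • (t • e)) - g x) ∂ν := by
          rw [integral_sub hxi (integrable_const _), hx hxK2]
          simp only [integral_const, probReal_univ, one_smul]
          rw [← integral_const_mul, hg, indicator_of_mem (hKK' hxK)]
          congr 1
          refine setIntegral_congr_fun measurableSet_Icc fun s hs => ?_
          rw [indicator_of_mem (hseg x hxK2 s hs), inner_smul_right]
          field_simp
        rw [e1]
        exact enorm_integral_le_lintegral_enorm _
    _ ≤ ∫⁻ x, ∫⁻ s, ‖g (x + s • (t • e)) - g x‖ₑ ∂ν := setLIntegral_le_lintegral _ _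
    _ = ∫⁻ s, (∫⁻ x, ‖g (x + s • (t • e)) - g x‖ₑ) ∂ν := by
        refine lintegral_lintegral_swap ?_
        exact (hGi.swap.sub (hgi.comp_fst ν)).aestronglyMeasurable.enorm
    _ ≤ ∫⁻ s, ε ∂ν := by
        refine setLIntegral_mono' measurableSet_Icc fun s hs => hball ?_
        rw [dist_zero_right]
        calc ‖s • (t • e)‖ ≤ ‖t • e‖ := by
              rw [norm_smul, Real.norm_of_nonneg hs.1]
              exact mul_le_of_le_one_left (norm_nonneg _) hs.2
          _ < δ' := ht.trans_le (min_le_right _ _)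
    _ = ε := by simp

open Filter Topology in
/-- A function whose difference quotients converge in `L¹` near the support of a `C¹` function
can be integrated by parts against it. -/
theorem integral_fderiv_mul_of_tendsto_diffQuot {N : ℕ} {ζ f G : EuclideanSpace ℝ (Fin N) → ℝ}
    (hζ : ContDiff ℝ 1 ζ) (hζc : HasCompactSupport ζ) {δ : ℝ} (hδ : 0 < δ)
    (hf : IntegrableOn f (cthickening δ (tsupport ζ))) (hG : IntegrableOn G (tsupport ζ))
    (e : EuclideanSpace ℝ (Fin N))
    (h : Tendsto (fun t : ℝ => ∫⁻ x in tsupport ζ, ‖t⁻¹ * (f (x + t • e) - f x) - G x‖ₑ)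
      (𝓝[>] 0) (𝓝 0)) :
    ∫ x, fderiv ℝ ζ x e * f x = -∫ x, ζ x * G x := by
  set K := tsupport ζ with hK
  set K' := cthickening δ K with hK'
  have hK'c : IsCompact K' := hζc.isCompact.cthickening
  have hKK' : K ⊆ K' := self_subset_cthickening K
  set F := K'.indicator f with hF
  have hFi : Integrable F := IntegrableOn.integrable_indicator hf hK'c.measurableSet
  have hζ0 : ∀ x, x ∉ K → ζ x = 0 := fun x hx => image_eq_zero_of_notMem_tsupport hx
  have hζ1 : ∀ x, x ∉ K → fderiv ℝ ζ x = 0 := fun x hx =>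
      image_eq_zero_of_notMem_tsupport fun hx' => hx (tsupport_fderiv_subset ℝ hx')
  obtain ⟨C, hC⟩ := hζ.continuous.bounded_above_of_compact_support hζc
  obtain ⟨L, hL⟩ := hζ.lipschitzWith_of_hasCompactSupport hζc (by simp)
  have hζG : Integrable (fun x => ζ x * G x) := by
    have := integrable_smul_of_tsupport_subset hζ.continuous hζc hG
    exact this
  have hsmall : ∀ᶠ t : ℝ in 𝓝[>] 0, ‖t • e‖ < δ := by
    have : Tendsto (fun t : ℝ => ‖t • e‖) (𝓝[>] 0) (𝓝 0) := by
      have : Continuous fun t : ℝ => ‖t • e‖ := by fun_prop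
      simpa using (this.tendsto 0).mono_left nhdsWithin_le_nhds
    exact this.eventually_lt_const hδ
  have hFf : ∀ t : ℝ, ‖t • e‖ < δ → ∀ x,
      ζ x * (t⁻¹ * (f (x + t • e) - f x)) = ζ x * (t⁻¹ * (F (x + t • e) - F x)) := by
    intro t ht x
    by_cases hx : x ∈ K
    · have : x + t • e ∈ K' := mem_cthickening_of_dist_le _ x δ K hx (by
        rw [dist_eq_norm, add_sub_cancel_left]; exact ht.le)
      rw [hF, indicator_of_mem (hKK' hx), indicator_of_mem this]
    · rw [hζ0 x hx]; simp
  have hi1 : ∀ v, Integrable (fun x => ζ x * F (x + v)) := fun v =>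
    (hFi.comp_add_right v).bdd_mul hζ.continuous.aestronglyMeasurable (ae_of_all _ hC)
  have hi2 : ∀ t : ℝ, Integrable (fun x => ζ x * (t⁻¹ * (F (x + t • e) - F x))) := fun t =>
    (((hFi.comp_add_right (t • e)).sub hFi).const_mul t⁻¹).bdd_mul
      hζ.continuous.aestronglyMeasurable (ae_of_all _ hC)
  -- the limit as an integral of the weak derivative
  have lim1 : Tendsto (fun t : ℝ => ∫ x, ζ x * (t⁻¹ * (F (x + t • e) - F x))) (𝓝[>] 0)
      (𝓝 (∫ x, ζ x * G x)) := by
    rw [tendsto_iff_edist_tendsto_0]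
    have hb : Tendsto (fun t : ℝ => ENNReal.ofReal C *
        ∫⁻ x in K, ‖t⁻¹ * (f (x + t • e) - f x) - G x‖ₑ) (𝓝[>] 0) (𝓝 0) := by
      simpa using ENNReal.Tendsto.const_mul h (Or.inr ENNReal.ofReal_ne_top)
    refine tendsto_of_tendsto_of_tendsto_of_le_of_le' tendsto_const_nhds hb
      (Eventually.of_forall fun _ => zero_le) ?_
    filter_upwards [hsmall] with t ht
    rw [edist_eq_enorm_sub, ← integral_sub (hi2 t) hζG]
    refine (enorm_integral_le_lintegral_enorm _).trans ?_
    have e1 : ∀ x, ζ x * (t⁻¹ * (F (x + t • e) - F x)) - ζ x * G x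
        = ζ x * (t⁻¹ * (f (x + t • e) - f x) - G x) := fun x => by
      rw [← hFf t ht x]; ring
    simp_rw [e1]
    rw [← lintegral_const_mul' _ _ ENNReal.ofReal_ne_top,
      ← lintegral_indicator hζc.isCompact.measurableSet]
    refine lintegral_mono fun x => ?_
    by_cases hx : x ∈ K
    · rw [indicator_of_mem hx, enorm_mul]
      gcongr
      rw [← ofReal_norm]
      exact ENNReal.ofReal_le_ofReal (hC x)
    · rw [hζ0 x hx]; simp
  -- the limit as an integral of the derivative of the test function
  have lim2 : Tendsto (fun t : ℝ => ∫ x, ζ x * (t⁻¹ * (F (x + t • e) - F x))) (𝓝[>] 0)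
      (𝓝 (∫ x, (-fderiv ℝ ζ x e) * F x)) := by
    -- Discrete integration by parts: translation invariance moves the difference quotient from `F`
    -- to `ζ`, reversing the direction.
    have e2 : ∀ t : ℝ, ∫ x, ζ x * (t⁻¹ * (F (x + t • e) - F x))
        = ∫ x, (t⁻¹ * (ζ (x + t • (-e)) - ζ x)) * F x := by
      intro t
      have j1 : Integrable (fun x => ζ (x - t • e) * F x) := by
        simpa using (hi1 (t • e)).comp_sub_right (t • e)
      have j2 : Integrable (fun x => ζ x * F x) := by simpa using hi1 0
      calc ∫ x, ζ x * (t⁻¹ * (F (x + t • e) - F x))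
          = t⁻¹ * ∫ x, (ζ x * F (x + t • e) - ζ x * F x) := by
            rw [← integral_const_mul]; congr 1; ext x; ring
        _ = t⁻¹ * ∫ x, (ζ (x - t • e) * F x - ζ x * F x) := by
            rw [integral_sub (hi1 _) j2, integral_sub j1 j2,
              ← integral_add_right_eq_self (fun x => ζ (x - t • e) * F x) (t • e)]
            simp
        _ = _ := by
            rw [← integral_const_mul]; congr 1; ext x
            rw [smul_neg, ← sub_eq_add_neg]; ring
    simp_rw [e2]
    refine tendsto_integral_filter_of_dominated_convergence (fun x => (L * ‖e‖) * ‖F x‖) ?_ ?_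
      (hFi.norm.const_mul _) ?_
    · refine Eventually.of_forall fun t => ?_
      have : Continuous fun x => t⁻¹ * (ζ (x + t • (-e)) - ζ x) := by
        have := hζ.continuous
        fun_prop
      exact this.aestronglyMeasurable.mul hFi.aestronglyMeasurable
    · filter_upwards [self_mem_nhdsWithin] with t ht0
      have ht0 : (0 : ℝ) < t := ht0
      refine ae_of_all _ fun x => ?_
      rw [norm_mul]
      gcongr
      have := hL.dist_le_mul (x + t • (-e)) x
      rw [dist_eq_norm, dist_eq_norm, add_sub_cancel_left, norm_smul, norm_neg,
        Real.norm_of_nonneg ht0.le] at this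
      rw [norm_mul, norm_inv, Real.norm_of_nonneg ht0.le, inv_mul_le_iff₀ ht0]
      linarith
    · refine ae_of_all _ fun x => ?_
      refine Tendsto.mul_const _ ?_
      have h1 : HasDerivAt (fun t : ℝ => ζ (x + t • (-e))) (fderiv ℝ ζ x (-e)) 0 := by
        have h2 : HasDerivAt (fun t : ℝ => x + t • (-e)) ((1 : ℝ) • (-e)) 0 :=
          ((hasDerivAt_id (0 : ℝ)).smul_const (-e)).const_add x
        have h3 : HasFDerivAt ζ (fderiv ℝ ζ x) (x + (0 : ℝ) • (-e)) := by
          simpa using ((hζ.differentiable (by simp)).differentiableAt (x := x)).hasFDerivAt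
        simpa using! h3.comp_hasDerivAt (0 : ℝ) h2
      have h4 := hasDerivAt_iff_tendsto_slope_zero.1 h1
      simp only [zero_add, zero_smul, add_zero, smul_eq_mul, map_neg] at h4
      exact h4.mono_left (nhdsWithin_mono _ fun t ht => ne_of_gt ht)
  have := tendsto_nhds_unique lim1 lim2
  rw [this, ← integral_neg]
  congr 1; ext x
  by_cases hx : x ∈ K
  · rw [hF, indicator_of_mem (hKK' hx)]; ring
  · rw [hζ1 x hx]; simp

/-! ### Chain rule for truncations and the test function -/

theorem abs_max_add_sub_max_le (a b : ℝ) : |max (a + b) 0 - max a 0| ≤ |b| := by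
  simpa using abs_max_sub_max_le_abs (a + b) a 0

/-- The one-sided directional derivative at `a` of the positive part, in direction `g`. -/
noncomputable def posPartDeriv (a g : ℝ) : ℝ :=
  if 0 < a then g else if a = 0 then max g 0 else 0

theorem measurable_posPartDeriv : Measurable fun z : ℝ × ℝ => posPartDeriv z.1 z.2 := by
  unfold posPartDeriv
  refine Measurable.ite (measurableSet_lt measurable_const measurable_fst) measurable_snd ?_
  exact Measurable.ite (measurableSet_eq_fun measurable_fst measurable_const)
    (measurable_snd.max measurable_const) measurable_const

theorem abs_posPartDeriv_le (a g : ℝ) : |posPartDeriv a g| ≤ |g| := by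
  unfold posPartDeriv
  split_ifs
  · exact le_rfl
  · rw [abs_of_nonneg (le_max_right _ _)]
    exact max_le (le_abs_self g) (abs_nonneg g)
  · simp

-- In each of the three cases the difference quotient equals its limit for all small `t > 0`.
open Filter Topology in
theorem tendsto_posPart_diffQuot (a g : ℝ) :
    Tendsto (fun t : ℝ => t⁻¹ * (max (a + t * g) 0 - max a 0)) (𝓝[>] 0)
      (𝓝 (posPartDeriv a g)) := by
  have hc : Tendsto (fun t : ℝ => a + t * g) (𝓝[>] 0) (𝓝 a) := by
    have : Continuous fun t : ℝ => a + t * g := by fun_prop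
    simpa using (this.tendsto 0).mono_left nhdsWithin_le_nhds
  unfold posPartDeriv
  split_ifs with h1 h2
  · refine tendsto_const_nhds.congr' ?_
    filter_upwards [hc.eventually_const_lt h1, self_mem_nhdsWithin] with t ht ht0
    have ht0 : (0 : ℝ) < t := ht0
    rw [max_eq_left ht.le, max_eq_left h1.le]
    field_simp; ring
  · subst h2
    refine tendsto_const_nhds.congr' ?_
    filter_upwards [self_mem_nhdsWithin] with t ht0
    have ht0 : (0 : ℝ) < t := ht0
    have : max (0 + t * g) 0 = t * max g 0 := by
      rw [mul_max_of_nonneg _ _ ht0.le]; simp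
    rw [this, max_self, sub_zero]
    field_simp
  · have h3 : a < 0 := lt_of_le_of_ne (not_lt.1 h1) h2
    refine tendsto_const_nhds.congr' ?_
    filter_upwards [hc.eventually_lt_const h3] with t ht
    rw [max_eq_right ht.le, max_eq_right h3.le]; simp

theorem HasWeakGradient.of_integral_fderiv_mul {N : ℕ} {Ω : Set (EuclideanSpace ℝ (Fin N))}
    {u : EuclideanSpace ℝ (Fin N) → ℝ} {U : EuclideanSpace ℝ (Fin N) → EuclideanSpace ℝ (Fin N)}
    (hu : LocallyIntegrableOn u Ω) (hU : LocallyIntegrableOn U Ω)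
    (h : ∀ η, IsTestFunction Ω η → ∀ e,
      ∫ x, fderiv ℝ η x e * u x = -∫ x, η x * inner ℝ (U x) e) :
    HasWeakGradient Ω u U := by
  refine ⟨hu, hU, fun η hη => ?_⟩
  have hη' := hη
  obtain ⟨hηs, hηc, hηΩ⟩ := hη
  have hdc : Continuous (fderiv ℝ η) := hηs.continuous_fderiv (by simp)
  have hgc : Continuous (gradient η) := (InnerProductSpace.toDual ℝ _).symm.continuous.comp hdc
  have hUi : Integrable (fun x => η x • U x) :=
    integrable_smul_of_tsupport_subset hηs.continuous hηc
      (hU.integrableOn_compact_subset hηΩ hηc)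
  have hz : ∀ x, x ∉ tsupport η → fderiv ℝ η x = 0 := fun x hx =>
    image_eq_zero_of_notMem_tsupport fun hx' => hx (tsupport_fderiv_subset ℝ hx')
  have hz2 : ∀ x, x ∉ tsupport η → gradient η x = 0 := fun x hx => by simp [gradient, hz x hx]
  have hui : Integrable (fun x => u x • gradient η x) := by
    have h1 : IntegrableOn (fun x => u x • gradient η x) (tsupport η) :=
      (hu.integrableOn_compact_subset hηΩ hηc).smul_continuousOn hgc.continuousOn hηc
    refine (integrableOn_iff_integrable_of_support_subset ?_).1 h1
    intro x hx
    by_contra hx'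
    exact hx (by simp [hz2 x hx'])
  rw [setIntegral_eq_integral_of_forall_compl_eq_zero
      (fun x hx => by rw [hz2 x fun hx' => hx (hηΩ hx'), smul_zero]),
    setIntegral_eq_integral_of_forall_compl_eq_zero
      (fun x hx => by rw [image_eq_zero_of_notMem_tsupport fun hx' => hx (hηΩ hx'), zero_smul])]
  refine ext_inner_left ℝ fun e => ?_
  rw [inner_neg_right, ← integral_inner hui, ← integral_inner hUi]
  simp only [inner_smul_right, inner_gradient_right, conj_trivial]
  have := h η hη' e
  simp_rw [real_inner_comm e, mul_comm (fderiv ℝ η _ e)] at this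
  exact this

/-- The gradient of the truncation `(u - k)_+`. -/
noncomputable def truncationGradient {N : ℕ} (u : EuclideanSpace ℝ (Fin N) → ℝ)
    (U : EuclideanSpace ℝ (Fin N) → EuclideanSpace ℝ (Fin N)) (k : ℝ) :
    EuclideanSpace ℝ (Fin N) → EuclideanSpace ℝ (Fin N) := {x | k < u x}.indicator U

section Truncation

variable {N : ℕ} {Ω : Set (EuclideanSpace ℝ (Fin N))} {u : EuclideanSpace ℝ (Fin N) → ℝ}
  {U : EuclideanSpace ℝ (Fin N) → EuclideanSpace ℝ (Fin N)}

theorem MeasureTheory.AEStronglyMeasurable.truncationGradient {ν : Measure (EuclideanSpace ℝ (Fin N))}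
    (hu : AEStronglyMeasurable u ν) (hU : AEStronglyMeasurable U ν) (k : ℝ) :
    AEStronglyMeasurable (truncationGradient u U k) ν :=
  hU.indicator₀ (nullMeasurableSet_lt aestronglyMeasurable_const hu)

theorem norm_truncationGradient_le (k : ℝ) (x : EuclideanSpace ℝ (Fin N)) :
    ‖truncationGradient u U k x‖ ≤ ‖U x‖ := norm_indicator_le_norm_self _ _

theorem integrableOn_truncation {K : Set (EuclideanSpace ℝ (Fin N))} (hK : IsCompact K)
    (hu : IntegrableOn u K) (k : ℝ) : IntegrableOn (fun x => max (u x - k) 0) K :=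
  (hu.sub (integrableOn_const hK.measure_lt_top.ne)).pos_part

-- The positive part is `1`-Lipschitz, so replacing `u(x + t e)` by `u(x) + t U(x)·e` changes its
-- difference quotient by at most the error of the quotient of `u`, which tends to `0` in `L¹`. The
-- quotients of the affine replacement converge pointwise, and their errors are dominated by `2
-- |U·e|`. The test function is only `C¹`, as required later for the factor `w^p`.
open Filter Topology in
theorem HasWeakGradient.integral_fderiv_mul_posPart (hΩ : IsOpen Ω) (h : HasWeakGradient Ω u U)
    (k : ℝ) {ζ : EuclideanSpace ℝ (Fin N) → ℝ} (hζ : ContDiff ℝ 1 ζ) (hζc : HasCompactSupport ζ)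
    (hζΩ : tsupport ζ ⊆ Ω) (e : EuclideanSpace ℝ (Fin N)) :
    ∫ x, fderiv ℝ ζ x e * max (u x - k) 0
      = -∫ x, ζ x * posPartDeriv (u x - k) (inner ℝ (U x) e) := by
  obtain ⟨δ, hδ, hδΩ⟩ := hζc.isCompact.exists_cthickening_subset_open hΩ hζΩ
  set K := tsupport ζ with hK
  have hKc : IsCompact K := hζc
  have huK : IntegrableOn u K := h.1.integrableOn_compact_subset hζΩ hKc
  have hgK : IntegrableOn (fun x => inner ℝ (U x) e) K :=
    (h.2.1.integrableOn_compact_subset hζΩ hKc).inner_const e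
  have huk : AEMeasurable (fun x => u x - k) (volume.restrict K) :=
    huK.aestronglyMeasurable.aemeasurable.sub_const k
  have hg := hgK.aestronglyMeasurable.aemeasurable
  have hDm : AEMeasurable (fun x => posPartDeriv (u x - k) (inner ℝ (U x) e))
      (volume.restrict K) := measurable_posPartDeriv.comp_aemeasurable (huk.prodMk hg)
  have hqm : ∀ t : ℝ, AEMeasurable (fun x =>
      t⁻¹ * (max (u x - k + t * inner ℝ (U x) e) 0 - max (u x - k) 0)) (volume.restrict K) :=
    fun t => (((huk.add (hg.const_mul t)).max aemeasurable_const).sub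
      (huk.max aemeasurable_const)).const_mul _
  refine integral_fderiv_mul_of_tendsto_diffQuot hζ hζc hδ
    (integrableOn_truncation hKc.cthickening
      (h.1.integrableOn_compact_subset hδΩ hKc.cthickening) k)
    (hgK.norm.mono' hDm.aestronglyMeasurable (ae_of_all _ fun x => abs_posPartDeriv_le _ _)) e ?_
  have lim1 := h.tendsto_lintegral_diffQuot hΩ hKc hζΩ e
  have lim2 : Tendsto (fun t : ℝ => ∫⁻ x in K,
      ‖t⁻¹ * (max (u x - k + t * inner ℝ (U x) e) 0 - max (u x - k) 0)
        - posPartDeriv (u x - k) (inner ℝ (U x) e)‖ₑ) (𝓝[>] 0) (𝓝 0) := by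
    have : (0 : ℝ≥0∞) = ∫⁻ x in K, 0 := by simp
    rw [this]
    refine tendsto_lintegral_filter_of_dominated_convergence'
      (fun x => 2 * ‖(inner ℝ (U x) e : ℝ)‖ₑ) ?_ ?_ ?_ ?_
    · exact Eventually.of_forall fun t => ((hqm t).sub hDm).enorm
    · filter_upwards [self_mem_nhdsWithin] with t ht0
      have ht0 : (0 : ℝ) < t := ht0
      refine ae_of_all _ fun x => ?_
      refine enorm_sub_le.trans ?_
      rw [two_mul]
      gcongr
      · rw [enorm_le_iff_norm_le, norm_mul, norm_inv, Real.norm_of_nonneg ht0.le,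
          inv_mul_le_iff₀ ht0]
        refine (abs_max_add_sub_max_le _ _).trans_eq ?_
        rw [abs_mul, abs_of_pos ht0]; rfl
      · rw [enorm_le_iff_norm_le]
        exact abs_posPartDeriv_le _ _
    · rw [lintegral_const_mul' _ _ (by simp)]
      exact ENNReal.mul_ne_top (by simp) hgK.2.ne
    · refine ae_of_all _ fun x => ?_
      have := ((tendsto_posPart_diffQuot (u x - k) (inner ℝ (U x) e)).sub_const
        (posPartDeriv (u x - k) (inner ℝ (U x) e))).enorm
      simpa using this
  refine tendsto_of_tendsto_of_tendsto_of_le_of_le' tendsto_const_nhds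
    (by simpa using lim1.add lim2) (Eventually.of_forall fun _ => zero_le) ?_
  filter_upwards [self_mem_nhdsWithin] with t ht0
  have ht0 : (0 : ℝ) < t := ht0
  have hm : AEMeasurable (fun x =>
      ‖t⁻¹ * (max (u x - k + t * inner ℝ (U x) e) 0 - max (u x - k) 0)
        - posPartDeriv (u x - k) (inner ℝ (U x) e)‖ₑ) (volume.restrict K) :=
    ((hqm t).sub hDm).enorm
  rw [← lintegral_add_right' _ hm]
  refine lintegral_mono fun x => ?_
  set q := t⁻¹ * (u (x + t • e) - u x) with hq
  set g := (inner ℝ (U x) e : ℝ) with hg'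
  have e1 : t⁻¹ * (max (u (x + t • e) - k) 0 - max (u x - k) 0) - posPartDeriv (u x - k) g
      = (t⁻¹ * (max (u (x + t • e) - k) 0 - max (u x - k + t * g) 0))
        + (t⁻¹ * (max (u x - k + t * g) 0 - max (u x - k) 0) - posPartDeriv (u x - k) g) := by ring
  dsimp only
  rw [e1]
  refine (enorm_add_le _ _).trans ?_
  gcongr
  rw [enorm_le_iff_norm_le, norm_mul, norm_inv, Real.norm_of_nonneg ht0.le, inv_mul_le_iff₀ ht0]
  refine (abs_max_sub_max_le_abs _ _ _).trans_eq ?_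
  rw [← Real.norm_of_nonneg ht0.le, ← norm_mul, Real.norm_of_nonneg ht0.le, Real.norm_eq_abs, hq]
  congr 1
  field_simp; ring

/-- The preceding identity for `e` and for `-e` has opposite left sides, so the sum of the two
one-sided derivatives is orthogonal to all test functions and vanishes almost everywhere. On `{u =
k}` this sum is `max(g, 0) + max(-g, 0) = |g|` with `g = U·e`. Hence `U·e = 0` almost everywhere
there, and the one-sided derivative is the linear expression given by the truncated gradient. -/
theorem HasWeakGradient.ae_posPartDeriv_eq_inner (hΩ : IsOpen Ω) (h : HasWeakGradient Ω u U)
    (k : ℝ) (e : EuclideanSpace ℝ (Fin N)) :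
    ∀ᵐ x, x ∈ Ω → posPartDeriv (u x - k) (inner ℝ (U x) e)
      = inner ℝ (truncationGradient u U k x) e := by
  set D : EuclideanSpace ℝ (Fin N) → EuclideanSpace ℝ (Fin N) → ℝ :=
    fun v x => posPartDeriv (u x - k) (inner ℝ (U x) v) with hD
  have hDi : ∀ v, ∀ K ⊆ Ω, IsCompact K → IntegrableOn (D v) K := by
    intro v K hKΩ hKc
    have hgK : IntegrableOn (fun x => inner ℝ (U x) v) K :=
      (h.2.1.integrableOn_compact_subset hKΩ hKc).inner_const v
    have huk : AEMeasurable (fun x => u x - k) (volume.restrict K) :=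
      (h.1.integrableOn_compact_subset hKΩ hKc).aestronglyMeasurable.aemeasurable.sub_const k
    exact hgK.norm.mono' (measurable_posPartDeriv.comp_aemeasurable
      (huk.prodMk hgK.aestronglyMeasurable.aemeasurable)).aestronglyMeasurable
      (ae_of_all _ fun x => abs_posPartDeriv_le _ _)
  have hae := hΩ.ae_eq_zero_of_integral_contDiff_smul_eq_zero (μ := volume)
    (f := fun x => D e x + D (-e) x)
    ((locallyIntegrableOn_iff hΩ.isLocallyClosed).2 fun K hK hKc =>
      (hDi e K hK hKc).add (hDi (-e) K hK hKc)) ?_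
  · filter_upwards [hae] with x hx hxΩ
    have h1 := hx hxΩ
    simp only [hD, posPartDeriv, inner_neg_right] at h1 ⊢
    unfold truncationGradient
    by_cases h2 : k < u x
    · rw [if_pos (sub_pos.2 h2), indicator_of_mem (show x ∈ {x | k < u x} from h2)]
    · rw [indicator_of_notMem (show x ∉ {x | k < u x} from h2), inner_zero_left]
      have h3 : ¬ 0 < u x - k := by linarith
      rw [if_neg h3, if_neg h3] at h1
      rw [if_neg h3]
      split_ifs at h1 ⊢ with h4
      · have := le_max_right (inner ℝ (U x) e) 0
        have := le_max_right (-inner ℝ (U x) e) 0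
        linarith
      · rfl
  · intro ζ hζ hζc hζΩ
    have hζ1 : ContDiff ℝ 1 ζ := hζ.of_le (by norm_cast)
    have h1 := h.integral_fderiv_mul_posPart hΩ k hζ1 hζc hζΩ e
    have h2 := h.integral_fderiv_mul_posPart hΩ k hζ1 hζc hζΩ (-e)
    have i : ∀ v, Integrable (fun x => ζ x * D v x) := fun v =>
      integrable_smul_of_tsupport_subset hζ.continuous hζc (hDi v _ hζΩ hζc)
    simp only [smul_eq_mul, mul_add]
    rw [integral_add (i e) (i (-e))]
    simp only [map_neg, neg_mul, integral_neg] at h2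
    simp only [hD]
    linarith

/-- The chain rule for truncations, tested with `C¹` functions. -/
theorem HasWeakGradient.integral_fderiv_mul_truncation (hΩ : IsOpen Ω)
    (h : HasWeakGradient Ω u U)
    (k : ℝ) {ζ : EuclideanSpace ℝ (Fin N) → ℝ} (hζ : ContDiff ℝ 1 ζ) (hζc : HasCompactSupport ζ)
    (hζΩ : tsupport ζ ⊆ Ω) (e : EuclideanSpace ℝ (Fin N)) :
    ∫ x, fderiv ℝ ζ x e * max (u x - k) 0
      = -∫ x, ζ x * inner ℝ (truncationGradient u U k x) e := by
  rw [h.integral_fderiv_mul_posPart hΩ k hζ hζc hζΩ e]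
  congr 1
  refine integral_congr_ae ?_
  filter_upwards [h.ae_posPartDeriv_eq_inner hΩ k e] with x hx
  by_cases hxΩ : x ∈ Ω
  · rw [hx hxΩ]
  · rw [image_eq_zero_of_notMem_tsupport fun hx' => hxΩ (hζΩ hx')]; simp

theorem MemW1pLoc.truncation {p : ℝ} (hΩ : IsOpen Ω) (h : MemW1pLoc p Ω u U) (k : ℝ) :
    MemW1pLoc p Ω (fun x => max (u x - k) 0) (truncationGradient u U k) := by
  obtain ⟨h1, h2⟩ := h
  refine ⟨.of_integral_fderiv_mul ?_ ?_ fun η hη e => ?_, fun K hK hKc => ⟨?_, ?_⟩⟩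
  · exact (locallyIntegrableOn_iff hΩ.isLocallyClosed).2 fun K hK hKc =>
      integrableOn_truncation hKc (h1.1.integrableOn_compact_subset hK hKc) k
  · refine (locallyIntegrableOn_iff hΩ.isLocallyClosed).2 fun K hK hKc => ?_
    have hU := h1.2.1.integrableOn_compact_subset hK hKc
    exact hU.norm.mono' ((h1.1.integrableOn_compact_subset hK
      hKc).aestronglyMeasurable.truncationGradient hU.aestronglyMeasurable k)
      (ae_of_all _ fun x => norm_truncationGradient_le k x)
  · exact h1.integral_fderiv_mul_truncation hΩ k (hη.1.of_le (by norm_cast)) hη.2.1 hη.2.2 e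
  · have hfin : IsFiniteMeasure (volume.restrict K) := ⟨by simpa using hKc.measure_lt_top⟩
    exact ((h2 K hK hKc).1.sub (memLp_const k)).pos_part
  · exact (h2 K hK hKc).2.mono
      ((h2 K hK hKc).1.1.truncationGradient (h2 K hK hKc).2.1 k)
      (ae_of_all _ fun x => norm_truncationGradient_le k x)

/-- The weak gradient of `(u - k)_+ w ^ p`. -/
noncomputable def truncationMulGradient (u : EuclideanSpace ℝ (Fin N) → ℝ)
    (U : EuclideanSpace ℝ (Fin N) → EuclideanSpace ℝ (Fin N)) (k p : ℝ)
    (w : EuclideanSpace ℝ (Fin N) → ℝ) (x : EuclideanSpace ℝ (Fin N)) :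
    EuclideanSpace ℝ (Fin N) :=
  w x ^ p • truncationGradient u U k x + (max (u x - k) 0 * (p * w x ^ (p - 1))) • gradient w x

theorem memLp_of_tsupport {F : Type*} [NormedAddCommGroup F] {q : ℝ≥0∞}
    {f : EuclideanSpace ℝ (Fin N) → F} {K : Set (EuclideanSpace ℝ (Fin N))} (hK : IsCompact K)
    (hf : MemLp f q (volume.restrict K)) (h0 : ∀ x, x ∉ K → f x = 0) : MemLp f q volume := by
  have : K.indicator f = f := indicator_eq_self.2 fun x hx => by
    by_contra h
    exact hx (h0 x h)
  rw [← this]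
  exact (memLp_indicator_iff_restrict hK.measurableSet).2 hf

/-- Since `p > 1` is an arbitrary real number, `w^p` is in general only `C¹`. The product rule
follows by testing the chain rule for the truncation with the `C¹` function `w^p η` and expanding
its derivative. -/
theorem MemW1pLoc.truncation_mul {p : ℝ} (hp : 1 < p) (hΩ : IsOpen Ω) (h : MemW1pLoc p Ω u U)
    (k : ℝ) {w : EuclideanSpace ℝ (Fin N) → ℝ} (hw : IsTestFunction Ω w)
    {Ω' : Set (EuclideanSpace ℝ (Fin N))} (hwΩ' : tsupport w ⊆ Ω') :
    MemW1pZero p Ω' (fun x => max (u x - k) 0 * w x ^ p) (truncationMulGradient u U k p w) := by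
  have hφ := h.truncation hΩ k
  set φ : EuclideanSpace ℝ (Fin N) → ℝ := fun x => max (u x - k) 0 with hφd
  obtain ⟨hws, hwc, hwΩ⟩ := hw
  set K := tsupport w with hK
  have hKc : IsCompact K := hwc
  have hp0 : 0 < p := by linarith
  have hw1 : ContDiff ℝ 1 w := hws.of_le (by norm_cast)
  have hwp : ContDiff ℝ 1 (fun x => w x ^ p) := hw1.rpow_const_of_le (by simpa using hp.le)
  have hwK : ∀ x, x ∉ K → w x = 0 := fun x hx => image_eq_zero_of_notMem_tsupport hx
  have hdc : Continuous (fderiv ℝ w) := hws.continuous_fderiv (by simp)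
  have hgc : Continuous (gradient w) := (InnerProductSpace.toDual ℝ _).symm.continuous.comp hdc
  have hwp1 : Continuous (fun x => p * w x ^ (p - 1)) :=
    continuous_const.mul (hws.continuous.rpow_const fun x => Or.inr (by linarith))
  have hwd : ∀ x, HasFDerivAt w (fderiv ℝ w x) x := fun x =>
    (hw1.differentiable (by simp) x).hasFDerivAt
  obtain ⟨hφL, hDL⟩ := hφ.2 K hwΩ hKc
  obtain ⟨C, hC⟩ := hKc.exists_bound_of_continuousOn (f := fun x => w x ^ p)
    hwp.continuous.continuousOn
  obtain ⟨C', hC'⟩ := hKc.exists_bound_of_continuousOn (f := fun x => (p * w x ^ (p - 1)) • gradient w x)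
    (hwp1.smul hgc).continuousOn
  have hVm : ∀ x, x ∉ K → truncationMulGradient u U k p w x = 0 := fun x hx => by
    simp [truncationMulGradient, hwK x hx, Real.zero_rpow hp0.ne', Real.zero_rpow (sub_pos.2 hp).ne']
  have hvm : ∀ x, x ∉ K → φ x * w x ^ p = 0 := fun x hx => by
    simp [hwK x hx, Real.zero_rpow hp0.ne']
  have hvL : MemLp (fun x => φ x * w x ^ p) (ENNReal.ofReal p) volume := by
    refine memLp_of_tsupport hKc (hφL.of_le_mul (c := C)
      (hφL.1.mul hwp.continuous.aestronglyMeasurable) ?_) hvm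
    filter_upwards [ae_restrict_mem hKc.measurableSet] with x hx
    rw [norm_mul, mul_comm]
    gcongr
    exact hC x hx
  have hVL : MemLp (truncationMulGradient u U k p w) (ENNReal.ofReal p) volume := by
    refine memLp_of_tsupport hKc ?_ hVm
    refine MemLp.add (f := fun x => w x ^ p • truncationGradient u U k x)
      (g := fun x => (max (u x - k) 0 * (p * w x ^ (p - 1))) • gradient w x) ?_ ?_
    · refine hDL.of_le_mul (c := C) (hwp.continuous.aestronglyMeasurable.smul hDL.1) ?_
      filter_upwards [ae_restrict_mem hKc.measurableSet] with x hx
      rw [norm_smul]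
      gcongr
      exact hC x hx
    · have : (fun x => (max (u x - k) 0 * (p * w x ^ (p - 1))) • gradient w x)
          = fun x => φ x • ((p * w x ^ (p - 1)) • gradient w x) := by
        ext1 x; rw [mul_smul]
      rw [this]
      refine hφL.of_le_mul (c := C') (hφL.1.smul (hwp1.smul hgc).aestronglyMeasurable) ?_
      filter_upwards [ae_restrict_mem hKc.measurableSet] with x hx
      rw [norm_smul, mul_comm]
      gcongr
      exact hC' x hx
  have h1p : (1 : ℝ≥0∞) ≤ ENNReal.ofReal p := by
    rw [← ENNReal.ofReal_one]; exact ENNReal.ofReal_le_ofReal hp.le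
  refine ⟨.of_integral_fderiv_mul ?_ ?_ ?_, hvL, hVL, fun x hx => hvm x fun hx' => hx (hwΩ' hx')⟩
  · exact (hvL.locallyIntegrable h1p).locallyIntegrableOn _
  · exact (hVL.locallyIntegrable h1p).locallyIntegrableOn _
  intro η hη e
  have hη1 : ContDiff ℝ 1 η := hη.1.of_le (by norm_cast)
  -- Here `η` is an arbitrary test function on the whole space. The factor `w^p` brings the support
  -- back into `Ω`, where `u` has a weak gradient.
  have hsub : tsupport (fun x => w x ^ p * η x) ⊆ K := by
    refine closure_mono fun x hx => ?_
    simp only [Function.mem_support] at hx ⊢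
    intro h0
    exact hx (by rw [h0, Real.zero_rpow hp0.ne', zero_mul])
  have hkey := h.1.integral_fderiv_mul_truncation hΩ k (ζ := fun x => w x ^ p * η x)
    (hwp.mul hη1) (hKc.of_isClosed_subset (isClosed_tsupport _) hsub) (hsub.trans hwΩ) e
  have hd : ∀ x, fderiv ℝ (fun x => w x ^ p * η x) x e
      = w x ^ p * fderiv ℝ η x e + η x * (p * w x ^ (p - 1) * inner ℝ (gradient w x) e) := by
    intro x
    have := ((hwd x).rpow_const (Or.inr hp.le)).mul (hη1.differentiable (by simp) x).hasFDerivAt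
    rw [HasFDerivAt.fderiv (f := fun x => w x ^ p * η x) this, inner_gradient_left]
    simp
  have i1 : Integrable (fun x => fderiv ℝ η x e * (φ x * w x ^ p)) := by
    have hvi : Integrable (fun x => φ x * w x ^ p) := by
      have : IntegrableOn (fun x => φ x * w x ^ p) K :=
        (hφ.1.1.integrableOn_compact_subset hwΩ hKc).mul_continuousOn hwp.continuous.continuousOn hKc
      refine (integrableOn_iff_integrable_of_support_subset fun x hx => ?_).1 this
      by_contra h
      exact hx (hvm x h)
    have hηd : Continuous (fun x => fderiv ℝ η x e) :=
      (hη1.continuous_fderiv (by simp)).clm_apply continuous_const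
    obtain ⟨C, hC⟩ := hηd.bounded_above_of_compact_support (hη.2.1.fderiv_apply ℝ e)
    exact hvi.bdd_mul hηd.aestronglyMeasurable (ae_of_all _ hC)
  have i2 : Integrable (fun x => η x *
      inner ℝ ((φ x * (p * w x ^ (p - 1))) • gradient w x) e) := by
    have hc : Continuous (fun x => η x * ((p * w x ^ (p - 1)) * inner ℝ (gradient w x) e)) :=
      hη1.continuous.mul (hwp1.mul (hgc.inner continuous_const))
    have : IntegrableOn (fun x => φ x * (η x * ((p * w x ^ (p - 1)) * inner ℝ (gradient w x) e))) K :=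
      (hφ.1.1.integrableOn_compact_subset hwΩ hKc).mul_continuousOn hc.continuousOn hKc
    have h3 := (integrableOn_iff_integrable_of_support_subset fun x hx => ?_).1 this
    · refine h3.congr (ae_of_all _ fun x => ?_)
      simp only [real_inner_smul_left]; ring
    · by_contra h
      exact hx (by simp [hwK x h, Real.zero_rpow (sub_pos.2 hp).ne'])
  have i3 : Integrable (fun x => η x * inner ℝ (w x ^ p • truncationGradient u U k x) e) := by
    have hD : IntegrableOn (fun x => inner ℝ (truncationGradient u U k x) e) K :=
      (hφ.1.2.1.integrableOn_compact_subset hwΩ hKc).inner_const (𝕜 := ℝ) e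
    have : IntegrableOn (fun x => inner ℝ (truncationGradient u U k x) e * (η x * w x ^ p)) K :=
      hD.mul_continuousOn (hη1.continuous.mul hwp.continuous).continuousOn hKc
    have h3 := (integrableOn_iff_integrable_of_support_subset fun x hx => ?_).1 this
    · refine h3.congr (ae_of_all _ fun x => ?_)
      simp only [real_inner_smul_left]; ring
    · by_contra h
      exact hx (by simp [hwK x h, Real.zero_rpow hp0.ne'])
  have e1 : ∫ x, fderiv ℝ (fun x => w x ^ p * η x) x e * max (u x - k) 0
      = (∫ x, fderiv ℝ η x e * (φ x * w x ^ p))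
        + ∫ x, η x * inner ℝ ((φ x * (p * w x ^ (p - 1))) • gradient w x) e := by
    rw [← integral_add i1 i2]
    congr 1; ext x
    rw [hd, real_inner_smul_left]; ring
  have e2 : ∫ x, η x * inner ℝ (truncationMulGradient u U k p w x) e
      = (∫ x, (w x ^ p * η x) * inner ℝ (truncationGradient u U k x) e)
        + ∫ x, η x * inner ℝ ((φ x * (p * w x ^ (p - 1))) • gradient w x) e := by
    have : ∀ x, (w x ^ p * η x) * inner ℝ (truncationGradient u U k x) e
        = η x * inner ℝ (w x ^ p • truncationGradient u U k x) e := fun x => by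
      rw [real_inner_smul_left]; ring
    simp_rw [this]
    rw [← integral_add i3 i2]
    congr 1; ext x
    rw [← mul_add, ← inner_add_left]; rfl
  rw [e2]
  linarith

end Truncation

/-! ### Integrals of the kernel and the normalizing constant -/

/-- The power `q - N` of the norm is integrable on balls for `q > 0`. -/
theorem setLIntegral_ball_norm_rpow {N : ℕ} (hN : 1 ≤ N) {q δ : ℝ} (hq : 0 < q) (hδ : 0 < δ) :
    ∫⁻ h in ball (0 : EuclideanSpace ℝ (Fin N)) δ, ENNReal.ofReal (‖h‖ ^ (q - N))
      = ENNReal.ofReal (N * volume.real (ball (0 : EuclideanSpace ℝ (Fin N)) 1) * (δ ^ q / q)) := by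
  have : Nontrivial (EuclideanSpace ℝ (Fin N)) := by
    have : Nonempty (Fin N) := ⟨⟨0, hN⟩⟩
    infer_instance
  -- Cutting off the radial profile turns the integral over the ball into one over the whole space.
  -- In polar coordinates the Jacobian `y^(N-1)` changes the exponent `q - N` into `q - 1`.
  set f : ℝ → ℝ := (Iio δ).indicator fun y => y ^ (q - N) with hf
  have e1 : ∀ y ∈ Ioi (0 : ℝ), y ^ (Module.finrank ℝ (EuclideanSpace ℝ (Fin N)) - 1) • f y
      = (Ioo 0 δ).indicator (fun y => y ^ (q - 1)) y := by
    intro y hy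
    have hy : 0 < y := hy
    rw [finrank_euclideanSpace_fin, smul_eq_mul]
    by_cases hyδ : y < δ
    · rw [hf, indicator_of_mem (show y ∈ Iio δ from hyδ), indicator_of_mem (show y ∈ Ioo 0 δ from ⟨hy, hyδ⟩),
        ← Real.rpow_natCast, ← Real.rpow_add hy, Nat.cast_sub hN]
      congr 1; push_cast; ring
    · rw [hf, indicator_of_notMem (show y ∉ Iio δ from hyδ), indicator_of_notMem fun h => hyδ h.2,
        mul_zero]
  have hint : IntegrableOn (fun y : ℝ => y ^ (q - 1)) (Ioo 0 δ) := by
    have := (intervalIntegral.intervalIntegrable_rpow' (a := 0) (b := δ) (r := q - 1)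
      (by linarith))
    rwa [intervalIntegrable_iff_integrableOn_Ioo_of_le hδ.le] at this
  have hsub : Ioo 0 δ ⊆ Ioi (0 : ℝ) := fun y hy => hy.1
  have hi : Integrable (fun h : EuclideanSpace ℝ (Fin N) => f ‖h‖) := by
    rw [integrable_fun_norm_addHaar volume (f := f)]
    refine IntegrableOn.congr_fun ?_ (fun y hy => (e1 y hy).symm) measurableSet_Ioi
    exact ((integrable_indicator_iff measurableSet_Ioo).2 hint).integrableOn
  have hval : ∫ h : EuclideanSpace ℝ (Fin N), f ‖h‖
      = N * volume.real (ball (0 : EuclideanSpace ℝ (Fin N)) 1) * (δ ^ q / q) := by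
    rw [integral_fun_norm_addHaar volume f, setIntegral_congr_fun measurableSet_Ioi e1,
      setIntegral_indicator measurableSet_Ioo, inter_eq_right.2 hsub,
      ← integral_Ioc_eq_integral_Ioo, ← intervalIntegral.integral_of_le hδ.le,
      integral_rpow (Or.inl (by linarith)), finrank_euclideanSpace_fin]
    simp [Real.zero_rpow hq.ne', mul_assoc]
  rw [← hval, ofReal_integral_eq_lintegral_ofReal hi, ← lintegral_indicator measurableSet_ball]
  · congr 1; ext h
    by_cases hh : ‖h‖ < δ
    · rw [indicator_of_mem (by simpa using hh), hf, indicator_of_mem (show ‖h‖ ∈ Iio δ from hh)]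
    · rw [indicator_of_notMem (by simpa using hh), hf,
        indicator_of_notMem (show ‖h‖ ∉ Iio δ from hh)]; simp
  · exact ae_of_all _ fun h => indicator_apply_nonneg fun _ => by positivity

/-- The power `-(N + q)` of the norm is integrable away from the origin for `q > 0`. -/
theorem setLIntegral_compl_ball_norm_rpow {N : ℕ} (hN : 1 ≤ N) {q δ : ℝ} (hq : 0 < q)
    (hδ : 0 < δ) :
    ∫⁻ h in (ball (0 : EuclideanSpace ℝ (Fin N)) δ)ᶜ, ENNReal.ofReal (‖h‖ ^ (-(N + q)))
      = ENNReal.ofReal (N * volume.real (ball (0 : EuclideanSpace ℝ (Fin N)) 1)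
          * (δ ^ (-q) / q)) := by
  have : Nontrivial (EuclideanSpace ℝ (Fin N)) := by
    have : Nonempty (Fin N) := ⟨⟨0, hN⟩⟩
    infer_instance
  set f : ℝ → ℝ := (Ici δ).indicator fun y => y ^ (-(N + q)) with hf
  have e1 : ∀ y ∈ Ioi (0 : ℝ), y ^ (Module.finrank ℝ (EuclideanSpace ℝ (Fin N)) - 1) • f y
      = (Ici δ).indicator (fun y => y ^ (-q - 1)) y := by
    intro y hy
    have hy : 0 < y := hy
    rw [finrank_euclideanSpace_fin, smul_eq_mul]
    by_cases hyδ : δ ≤ y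
    · rw [hf, indicator_of_mem (show y ∈ Ici δ from hyδ), indicator_of_mem (show y ∈ Ici δ from hyδ),
        ← Real.rpow_natCast, ← Real.rpow_add hy, Nat.cast_sub hN]
      congr 1; push_cast; ring
    · rw [hf, indicator_of_notMem (show y ∉ Ici δ from hyδ),
        indicator_of_notMem (show y ∉ Ici δ from hyδ), mul_zero]
  have hint : IntegrableOn (fun y : ℝ => y ^ (-q - 1)) (Ici δ) :=
    (integrableOn_Ici_iff_integrableOn_Ioi (by simp)).2 (integrableOn_Ioi_rpow_of_lt (by linarith) hδ)
  have hsub : Ici δ ⊆ Ioi (0 : ℝ) := fun y hy => lt_of_lt_of_le hδ hy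
  have hi : Integrable (fun h : EuclideanSpace ℝ (Fin N) => f ‖h‖) := by
    rw [integrable_fun_norm_addHaar volume (f := f)]
    refine IntegrableOn.congr_fun ?_ (fun y hy => (e1 y hy).symm) measurableSet_Ioi
    exact ((integrable_indicator_iff measurableSet_Ici).2 hint).integrableOn
  have hval : ∫ h : EuclideanSpace ℝ (Fin N), f ‖h‖
      = N * volume.real (ball (0 : EuclideanSpace ℝ (Fin N)) 1) * (δ ^ (-q) / q) := by
    rw [integral_fun_norm_addHaar volume f, setIntegral_congr_fun measurableSet_Ioi e1,
      setIntegral_indicator measurableSet_Ici, inter_eq_right.2 hsub,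
      integral_Ici_eq_integral_Ioi, integral_Ioi_rpow_of_lt (by linarith) hδ,
      finrank_euclideanSpace_fin]
    simp [mul_assoc, neg_div_neg_eq]
  rw [← hval, ofReal_integral_eq_lintegral_ofReal hi,
    ← lintegral_indicator measurableSet_ball.compl]
  · congr 1; ext h
    by_cases hh : δ ≤ ‖h‖
    · rw [indicator_of_mem (by simpa using hh), hf, indicator_of_mem (show ‖h‖ ∈ Ici δ from hh)]
    · rw [indicator_of_notMem (by simpa using hh), hf,
        indicator_of_notMem (show ‖h‖ ∉ Ici δ from hh)]; simp
  · exact ae_of_all _ fun h => indicator_apply_nonneg fun _ => by positivity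

/-- The part of the normalizing constant without its zeros at `s = 0` and `s = 1`. -/
theorem continuousOn_normConst_factor {N : ℕ} (hN : 1 ≤ N) {p : ℝ} (hp : 1 < p) :
    ContinuousOn (fun s : ℝ => (p / 2 * 2 ^ (2 * s - 1)) / Real.pi ^ (((N : ℝ) - 1) / 2) *
      (Real.Gamma ((N + p * s) / 2) / (Real.Gamma ((p + 1) / 2) * Real.Gamma (2 - s))))
      (Icc 0 1) := by
  have hN' : (1 : ℝ) ≤ N := by exact_mod_cast hN
  have hG : ∀ y : ℝ, 0 < y → ContinuousAt Real.Gamma y := fun y hy =>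
    (Real.differentiableAt_Gamma fun m h => by
      have : (0 : ℝ) ≤ m := Nat.cast_nonneg m
      linarith).continuousAt
  have h1 : ContinuousOn (fun s : ℝ => Real.Gamma ((N + p * s) / 2)) (Icc 0 1) := by
    intro s hs
    have hpos : 0 < (N + p * s) / 2 := by
      have := mul_nonneg (by linarith : (0 : ℝ) ≤ p) hs.1
      linarith
    exact (ContinuousAt.comp (f := fun s : ℝ => (N + p * s) / 2) (hG _ hpos)
      (by fun_prop)).continuousWithinAt
  have h2 : ContinuousOn (fun s : ℝ => Real.Gamma (2 - s)) (Icc 0 1) := by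
    intro s hs
    exact (ContinuousAt.comp (f := fun s : ℝ => 2 - s) (hG _ (by linarith [hs.2]))
      (by fun_prop)).continuousWithinAt
  have h3 : Continuous (fun s : ℝ => (2 : ℝ) ^ (2 * s - 1)) :=
    continuous_const.rpow (by fun_prop) fun _ => Or.inl (by norm_num)
  refine ((continuousOn_const.mul h3.continuousOn).div_const _).mul
    (h1.div (continuousOn_const.mul h2) fun s hs => ?_)
  exact (mul_pos (Real.Gamma_pos_of_pos (by linarith))
    (Real.Gamma_pos_of_pos (by linarith [hs.2]))).ne'

theorem normConst_eq (N : ℕ) (p s : ℝ) :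
    normConst N p s = s * (1 - s) * ((p / 2 * 2 ^ (2 * s - 1)) / Real.pi ^ (((N : ℝ) - 1) / 2) *
      (Real.Gamma ((N + p * s) / 2) / (Real.Gamma ((p + 1) / 2) * Real.Gamma (2 - s)))) := by
  unfold normConst; ring

theorem normConst_nonneg (N : ℕ) {p s : ℝ} (hp : 1 < p) (hs : s ∈ Ioo (0 : ℝ) 1) :
    0 ≤ normConst N p s := by
  rw [normConst_eq]
  have h1 : 0 < Real.Gamma ((p + 1) / 2) := Real.Gamma_pos_of_pos (by linarith)
  have h2 : 0 < Real.Gamma (2 - s) := Real.Gamma_pos_of_pos (by linarith [hs.2])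
  have h3 : 0 < Real.Gamma ((N + p * s) / 2) := Real.Gamma_pos_of_pos (by
    have := mul_pos (by linarith : 0 < p) hs.1
    have : (0 : ℝ) ≤ N := Nat.cast_nonneg N
    linarith)
  have h4 := hs.1
  have h5 : 0 < 1 - s := sub_pos.2 hs.2
  have := Real.pi_pos
  positivity

/-- The factor `1 - s` offsets the divergence of the near-diagonal integral as `s → 1`, and the
factor `s` that of the far integral as `s → 0`. The remaining factor is continuous on the compact
interval `[0, 1]`. -/
theorem exists_normConst_le {N : ℕ} (hN : 1 ≤ N) {p : ℝ} (hp : 1 < p) :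
    ∃ B : ℝ, 0 ≤ B ∧ ∀ s ∈ Ioo (0 : ℝ) 1, normConst N p s ≤ B * (s * (1 - s)) := by
  obtain ⟨B, hB⟩ := isCompact_Icc.exists_bound_of_continuousOn (continuousOn_normConst_factor hN hp)
  refine ⟨B, (norm_nonneg _).trans (hB 0 (by simp)), fun s hs => ?_⟩
  rw [normConst_eq, mul_comm B]
  refine mul_le_mul_of_nonneg_left ((le_abs_self _).trans (hB s ⟨hs.1.le, hs.2.le⟩)) ?_
  exact mul_nonneg hs.1.le (sub_nonneg.2 hs.2.le)

theorem aemeasurable_normConst {N : ℕ} (hN : 1 ≤ N) {p : ℝ} (hp : 1 < p) (μ : Measure ℝ) :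
    AEMeasurable (normConst N p) (μ.restrict (Ioo 0 1)) := by
  have : ContinuousOn (normConst N p) (Ioo 0 1) := by
    have h0 : ContinuousOn (fun s : ℝ => s * (1 - s)) (Icc 0 1) := by fun_prop
    have h := h0.mul (continuousOn_normConst_factor hN hp)
    refine (h.congr fun s _ => normConst_eq N p s).mono Ioo_subset_Icc_self
  exact this.aemeasurable measurableSet_Ioo

/-! ### Absolute convergence of the weak form -/

/-- Jensen's inequality for `t ↦ t^p`, obtained from Hölder's inequality against the constant `1`.
-/
theorem lintegral_rpow_le_of_isProbabilityMeasure {α : Type*} [MeasurableSpace α] {ν : Measure α}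
    [IsProbabilityMeasure ν] {f : α → ℝ≥0∞} (hf : AEMeasurable f ν) {p : ℝ} (hp : 1 < p) :
    (∫⁻ x, f x ∂ν) ^ p ≤ ∫⁻ x, f x ^ p ∂ν := by
  have h := ENNReal.lintegral_mul_le_Lp_mul_Lq ν (Real.HolderConjugate.conjExponent hp) hf
    (aemeasurable_const (b := (1 : ℝ≥0∞)))
  simp only [Pi.mul_apply, mul_one, ENNReal.one_rpow, lintegral_const, measure_univ] at h
  calc (∫⁻ x, f x ∂ν) ^ p ≤ ((∫⁻ x, f x ^ p ∂ν) ^ (1 / p)) ^ p := by gcongr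
    _ = _ := by rw [← ENNReal.rpow_mul, one_div_mul_cancel (by linarith), ENNReal.rpow_one]

/-- The `L^p` modulus of continuity of a Sobolev function. -/
theorem HasWeakGradient.setLIntegral_translate_sub_rpow_le {N : ℕ}
    {Ω : Set (EuclideanSpace ℝ (Fin N))} {u : EuclideanSpace ℝ (Fin N) → ℝ}
    {U : EuclideanSpace ℝ (Fin N) → EuclideanSpace ℝ (Fin N)}
    (h : HasWeakGradient Ω u U) {p : ℝ} (hp : 1 < p) {W K : Set (EuclideanSpace ℝ (Fin N))}
    (hW : IsOpen W)
    (hK : IsCompact K) (hKΩ : K ⊆ Ω) (e : EuclideanSpace ℝ (Fin N))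
    (hWK : ∀ x ∈ W, ∀ t ∈ Icc (0 : ℝ) 1, x + t • e ∈ K) :
    ∫⁻ x in W, ‖u (x + e) - u x‖ₑ ^ p ≤ ‖e‖ₑ ^ p * ∫⁻ x in K, ‖U x‖ₑ ^ p := by
  have hp0 : 0 < p := by linarith
  set ν : Measure ℝ := volume.restrict (Icc (0 : ℝ) 1) with hν
  have hνp : IsProbabilityMeasure ν := ⟨by simp [hν]⟩
  set G := K.indicator U with hG
  have hGi : Integrable G :=
    (h.2.1.integrableOn_compact_subset hKΩ hK).integrable_indicator hK.measurableSet
  have hGt := integrable_translate_unitInterval hGi e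
  have hGx : ∀ᵐ x : EuclideanSpace ℝ (Fin N),
      Integrable (fun s : ℝ => G (x + s • e)) ν := hGt.prod_left_ae
  calc ∫⁻ x in W, ‖u (x + e) - u x‖ₑ ^ p
      ≤ ∫⁻ x in W, ‖e‖ₑ ^ p * ∫⁻ s, ‖G (x + s • e)‖ₑ ^ p ∂ν := by
        refine lintegral_mono_ae ?_
        filter_upwards [ae_restrict_of_ae (h.ae_sub_eq_integral hW hK hKΩ e hWK),
          ae_restrict_of_ae hGx, ae_restrict_mem hW.measurableSet] with x hx hxi hxW
        rw [hx hxW]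
        have h1 : ‖∫ t in Icc (0 : ℝ) 1, (inner ℝ (U (x + t • e)) e : ℝ)‖ₑ
            ≤ ‖e‖ₑ * ∫⁻ s, ‖G (x + s • e)‖ₑ ∂ν := by
          refine (enorm_integral_le_lintegral_enorm _).trans ?_
          rw [← lintegral_const_mul' _ _ (by simp)]
          refine setLIntegral_mono' measurableSet_Icc fun s hs => ?_
          rw [hG, indicator_of_mem (hWK x hxW s hs), ← enorm_norm e, ← enorm_norm (U _),
            ← enorm_mul, enorm_le_iff_norm_le, mul_comm, norm_mul, norm_norm, norm_norm]
          exact norm_inner_le_norm _ _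
        calc _ ≤ (‖e‖ₑ * ∫⁻ s, ‖G (x + s • e)‖ₑ ∂ν) ^ p := by gcongr
          _ = ‖e‖ₑ ^ p * (∫⁻ s, ‖G (x + s • e)‖ₑ ∂ν) ^ p := ENNReal.mul_rpow_of_nonneg _ _ hp0.le
          _ ≤ _ := by
            gcongr
            exact lintegral_rpow_le_of_isProbabilityMeasure hxi.aestronglyMeasurable.enorm hp
    _ ≤ ∫⁻ x, ‖e‖ₑ ^ p * ∫⁻ s, ‖G (x + s • e)‖ₑ ^ p ∂ν := setLIntegral_le_lintegral _ _
    _ = ‖e‖ₑ ^ p * ∫⁻ x, ∫⁻ s, ‖G (x + s • e)‖ₑ ^ p ∂ν := by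
        rw [lintegral_const_mul' _ _ (ENNReal.rpow_ne_top_of_nonneg hp0.le (by simp))]
    _ = ‖e‖ₑ ^ p * ∫⁻ s, (∫⁻ x, ‖G (x + s • e)‖ₑ ^ p) ∂ν := by
        rw [lintegral_lintegral_swap]
        exact hGt.swap.aestronglyMeasurable.enorm.pow_const p
    _ = ‖e‖ₑ ^ p * ∫⁻ s, (∫⁻ x, ‖G x‖ₑ ^ p) ∂ν := by
        congr 2; ext s
        exact lintegral_add_right_eq_self (fun x => ‖G x‖ₑ ^ p) (s • e)
    _ = ‖e‖ₑ ^ p * ∫⁻ x in K, ‖U x‖ₑ ^ p := by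
        rw [lintegral_const, measure_univ, mul_one, ← lintegral_indicator hK.measurableSet]
        congr 2; ext x
        by_cases hx : x ∈ K
        · rw [hG, indicator_of_mem hx, indicator_of_mem hx]
        · rw [hG, indicator_of_notMem hx, indicator_of_notMem hx]; simp [hp0]

/-- The integrand of the nonlocal part of the weak form. -/
noncomputable def nonlocalDensity {N : ℕ} (p : ℝ) (u v : EuclideanSpace ℝ (Fin N) → ℝ) (s : ℝ)
    (z : EuclideanSpace ℝ (Fin N) × EuclideanSpace ℝ (Fin N)) : ℝ :=
  |u z.1 - u z.2| ^ (p - 2) * (u z.1 - u z.2) * (v z.1 - v z.2) / ‖z.1 - z.2‖ ^ (N + s * p)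

theorem abs_rpow_mul_mul_le {p : ℝ} (hp : 1 < p) (a c : ℝ) :
    |(|a| ^ (p - 2) * a * c)| ≤ |a| ^ p + |c| ^ p := by
  have e' : |a| ^ (p - 2) * |a| = |a| ^ (p - 1) := by
    rw [← Real.rpow_add_one' (abs_nonneg a) (by linarith)]; congr 1; ring
  have e : ∀ Z : ℝ, 0 ≤ Z → Z ^ p = Z ^ (p - 1) * Z := fun Z hZ => by
    conv_lhs => rw [show p = (p - 1) + 1 by ring]
    rw [Real.rpow_add_one' hZ (by linarith)]
  rw [abs_mul, abs_mul, abs_of_nonneg (Real.rpow_nonneg (abs_nonneg a) _), e']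
  have ha := abs_nonneg a
  have hc := abs_nonneg c
  rcases le_total |c| |a| with h | h
  · have := mul_le_mul_of_nonneg_left h (Real.rpow_nonneg ha (p - 1))
    have h2 : 0 ≤ |c| ^ p := by positivity
    rw [e _ ha]; linarith
  · have := mul_le_mul_of_nonneg_right
      (Real.rpow_le_rpow ha h (by linarith : 0 ≤ p - 1)) hc
    have h2 : 0 ≤ |a| ^ p := by positivity
    rw [e _ hc]; linarith

theorem abs_sub_rpow_mul_le {p : ℝ} (hp : 1 < p) (a b c : ℝ) :
    |(|a - b| ^ (p - 2) * (a - b) * c)| ≤ 2 ^ p * (|a| ^ (p - 1) * |c| + |b| ^ (p - 1) * |c|) := by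
  have e' : |a - b| ^ (p - 2) * |a - b| = |a - b| ^ (p - 1) := by
    rw [← Real.rpow_add_one' (abs_nonneg _) (by linarith)]; congr 1; ring
  rw [abs_mul, abs_mul, abs_of_nonneg (Real.rpow_nonneg (abs_nonneg _) _), e', ← add_mul,
    ← mul_assoc]
  refine mul_le_mul_of_nonneg_right ?_ (abs_nonneg c)
  have h1 : |a - b| ≤ 2 * max |a| |b| := by
    have := abs_sub a b
    have := le_max_left |a| |b|
    have := le_max_right |a| |b|
    linarith
  have hm : 0 ≤ max |a| |b| := le_max_of_le_left (abs_nonneg a)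
  have h0 : (2 : ℝ) ^ (p - 1) ≤ 2 ^ p :=
    Real.rpow_le_rpow_of_exponent_le (by norm_num) (by linarith)
  calc |a - b| ^ (p - 1) ≤ (2 * max |a| |b|) ^ (p - 1) :=
        Real.rpow_le_rpow (abs_nonneg _) h1 (by linarith)
    _ = 2 ^ (p - 1) * max |a| |b| ^ (p - 1) := Real.mul_rpow (by norm_num) hm
    _ ≤ 2 ^ p * (|a| ^ (p - 1) + |b| ^ (p - 1)) := by
        gcongr
        have ha : 0 ≤ |a| ^ (p - 1) := by positivity
        have hb : 0 ≤ |b| ^ (p - 1) := by positivity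
        rcases max_cases |a| |b| with h | h <;> rw [h.1] <;> linarith

/-- The pairs whose first component lies in `A` and whose difference lies in `B`. -/
def shearSet {N : ℕ} (A B : Set (EuclideanSpace ℝ (Fin N))) :
    Set (EuclideanSpace ℝ (Fin N) × EuclideanSpace ℝ (Fin N)) :=
  {z | z.1 ∈ A ∧ z.2 - z.1 ∈ B}

theorem measurableSet_shearSet {N : ℕ} {A B : Set (EuclideanSpace ℝ (Fin N))}
    (hA : MeasurableSet A) (hB : MeasurableSet B) : MeasurableSet (shearSet A B) :=
  (measurable_fst hA).inter ((measurable_snd.sub measurable_fst) hB)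

/-- The change of variables `(h, x) ↦ (x, x + h)` makes the kernel depend on `h` alone. Only the
inequality half of Tonelli is used, so `G` need not be measurable. -/
theorem setLIntegral_shear_le {N : ℕ} {A B : Set (EuclideanSpace ℝ (Fin N))}
    (G : EuclideanSpace ℝ (Fin N) × EuclideanSpace ℝ (Fin N) → ℝ≥0∞) :
    ∫⁻ z in shearSet A B, G z ≤ ∫⁻ h in B, ∫⁻ x in A, G (x, x + h) := by
  have hmp : MeasurePreserving
      (fun z : EuclideanSpace ℝ (Fin N) × EuclideanSpace ℝ (Fin N) => (z.2, z.2 + z.1))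
      (volume.prod volume) (volume.prod volume) :=
    (measurePreserving_prod_add volume volume).comp Measure.measurePreserving_swap
  have hemb : MeasurableEmbedding
      (fun z : EuclideanSpace ℝ (Fin N) × EuclideanSpace ℝ (Fin N) => (z.2, z.2 + z.1)) :=
    (Homeomorph.shearAddRight _).measurableEmbedding.comp
      MeasurableEquiv.prodComm.measurableEmbedding
  have h := hmp.setLIntegral_comp_preimage_emb hemb G (shearSet A B)
  have hpre : (fun z : EuclideanSpace ℝ (Fin N) × EuclideanSpace ℝ (Fin N) =>
      (z.2, z.2 + z.1)) ⁻¹' shearSet A B = B ×ˢ A := by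
    ext z; simp [shearSet, and_comm]
  rw [Measure.volume_eq_prod, ← h, hpre, ← Measure.prod_restrict]
  exact lintegral_prod_le _

/-- After the shear, the modulus of continuity contributes `|h|^p` against the kernel `|h|^(-N-sp)`.
The resulting power `|h|^(p(1-s)-N)` is integrable at the origin, at the price of a factor `1 / (1 -
s)`. -/
theorem setLIntegral_near_le {N : ℕ} (hN : 1 ≤ N) {p : ℝ} (hp : 1 < p)
    {f : EuclideanSpace ℝ (Fin N) → ℝ}
    {W : Set (EuclideanSpace ℝ (Fin N))} {δ : ℝ} (hδ : 0 < δ) {M : ℝ≥0∞} (hM : M ≠ ⊤)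
    (hf : ∀ h ∈ ball (0 : EuclideanSpace ℝ (Fin N)) δ,
      ∫⁻ x in W, ‖f (x + h) - f x‖ₑ ^ p ≤ ‖h‖ₑ ^ p * M) {s : ℝ} (hs : s ∈ Ioo (0 : ℝ) 1) :
    ∫⁻ z in shearSet W (ball 0 δ),
        ENNReal.ofReal (|f z.1 - f z.2| ^ p / ‖z.1 - z.2‖ ^ (N + s * p))
      ≤ ENNReal.ofReal (N * volume.real (ball (0 : EuclideanSpace ℝ (Fin N)) 1)
          * (δ ^ (p * (1 - s)) / (p * (1 - s)))) * M := by
  have hp0 : 0 < p := by linarith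
  have hps : 0 < p * (1 - s) := mul_pos hp0 (sub_pos.2 hs.2)
  rw [← setLIntegral_ball_norm_rpow hN hps hδ, ← lintegral_mul_const' _ _ hM]
  refine (setLIntegral_shear_le _).trans (setLIntegral_mono' measurableSet_ball fun h hh => ?_)
  rcases eq_or_ne h 0 with rfl | h0
  · simp [Real.zero_rpow hp0.ne']
  have hn : 0 < ‖h‖ := norm_pos_iff.2 h0
  have e1 : ∀ x, ENNReal.ofReal (|f x - f (x + h)| ^ p / ‖x - (x + h)‖ ^ (N + s * p))
      = ENNReal.ofReal ((‖h‖ ^ (N + s * p))⁻¹) * ‖f (x + h) - f x‖ₑ ^ p := by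
    intro x
    rw [sub_add_cancel_left, norm_neg, abs_sub_comm, div_eq_inv_mul,
      ENNReal.ofReal_mul (by positivity), ← ENNReal.ofReal_rpow_of_nonneg (abs_nonneg _) hp0.le,
      ← Real.norm_eq_abs, ofReal_norm]
  simp_rw [e1]
  rw [lintegral_const_mul' _ _ ENNReal.ofReal_ne_top]
  calc _ ≤ ENNReal.ofReal ((‖h‖ ^ (N + s * p))⁻¹) * (‖h‖ₑ ^ p * M) := by gcongr; exact hf h hh
    _ = ENNReal.ofReal (‖h‖ ^ (p * (1 - s) - N)) * M := by
        rw [← mul_assoc, ← ofReal_norm, ENNReal.ofReal_rpow_of_nonneg hn.le hp0.le,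
          ← ENNReal.ofReal_mul (by positivity), ← Real.rpow_neg hn.le, ← Real.rpow_add hn]
        congr 3; ring

theorem setLIntegral_far_le {N : ℕ} (hN : 1 ≤ N) {p : ℝ} (hp : 1 < p)
    {K : Set (EuclideanSpace ℝ (Fin N))} {δ : ℝ} (hδ : 0 < δ)
    {a : EuclideanSpace ℝ (Fin N) → ℝ}
    (haK : ∫⁻ x in K, ENNReal.ofReal (a x) ≠ ⊤) {s : ℝ} (hs : s ∈ Ioo (0 : ℝ) 1) :
    ∫⁻ z in shearSet K (ball 0 δ)ᶜ,
        ENNReal.ofReal (a z.1 / ‖z.1 - z.2‖ ^ (N + s * p))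
      ≤ ENNReal.ofReal (N * volume.real (ball (0 : EuclideanSpace ℝ (Fin N)) 1)
          * (δ ^ (-(s * p)) / (s * p))) * ∫⁻ x in K, ENNReal.ofReal (a x) := by
  have hp0 : 0 < p := by linarith
  have hps : 0 < s * p := mul_pos hs.1 hp0
  rw [← setLIntegral_compl_ball_norm_rpow hN hps hδ, ← lintegral_mul_const' _ _ haK]
  refine (setLIntegral_shear_le _).trans (lintegral_mono fun h => le_of_eq ?_)
  rw [← lintegral_const_mul' _ _ ENNReal.ofReal_ne_top]
  congr 1; ext x
  rw [sub_add_cancel_left, norm_neg, div_eq_inv_mul, ENNReal.ofReal_mul (by positivity),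
    Real.rpow_neg (norm_nonneg _)]

/-- For `x` in `K` and `|x - y| ≥ δ`, the kernel is bounded by a constant when `|y| < 1`. When `|y|
≥ 1` it is comparable to `|y|^(-N-sp)`, because `|y| ≤ (1 + R/δ) |x - y|`. The assumption `δ ≤ 1`
and the bound `1 ≤ 1 + R/δ` let the exponent `N + p` replace `N + sp` in the constants, which makes
them independent of `s`. -/
theorem setLIntegral_tail_le {N : ℕ} {p : ℝ} (hp : 1 < p)
    {K : Set (EuclideanSpace ℝ (Fin N))} {δ R : ℝ} (hδ : 0 < δ) (hδ1 : δ ≤ 1) (hR : 0 < R)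
    (hKR : K ⊆ ball 0 R) {a b : EuclideanSpace ℝ (Fin N) → ℝ} (ha : ∀ x, 0 ≤ a x)
    (hb : ∀ x, 0 ≤ b x) (hKm : MeasurableSet K)
    (ham : AEMeasurable a (volume.restrict K)) {s : ℝ} (hs : s ∈ Ioo (0 : ℝ) 1) :
    ∫⁻ z in shearSet K (ball 0 δ)ᶜ,
        ENNReal.ofReal (b z.2 * a z.1 / ‖z.1 - z.2‖ ^ (N + s * p))
      ≤ (∫⁻ x in K, ENNReal.ofReal (a x)) *
        (ENNReal.ofReal ((δ ^ (N + p))⁻¹) * (∫⁻ y in ball 0 1, ENNReal.ofReal (b y))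
          + ENNReal.ofReal ((1 + R / δ) ^ (N + p)) *
            ∫⁻ y in (ball 0 1)ᶜ, ENNReal.ofReal (b y / ‖y - 0‖ ^ (N + s * p))) := by
  have hp0 : 0 < p := by linarith
  have hps : 0 < s * p := mul_pos hs.1 hp0
  have hexp : (N : ℝ) + s * p ≤ N + p := by nlinarith [hs.2]
  have hexp0 : 0 < (N : ℝ) + s * p := by
    have : (0 : ℝ) ≤ N := Nat.cast_nonneg N
    linarith
  have hL : 1 ≤ 1 + R / δ := by
    have : 0 < R / δ := by positivity
    linarith
  set g : EuclideanSpace ℝ (Fin N) → ℝ≥0∞ := fun y =>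
    (ball 0 1).indicator (fun y => ENNReal.ofReal ((δ ^ (N + p))⁻¹) * ENNReal.ofReal (b y)) y
    + (ball 0 1)ᶜ.indicator (fun y => ENNReal.ofReal ((1 + R / δ) ^ (N + p)) *
        ENNReal.ofReal (b y / ‖y - 0‖ ^ (N + s * p))) y with hg
  have hgint : ∫⁻ y, g y = ENNReal.ofReal ((δ ^ (N + p))⁻¹) *
      (∫⁻ y in ball 0 1, ENNReal.ofReal (b y))
      + ENNReal.ofReal ((1 + R / δ) ^ (N + p)) *
        ∫⁻ y in (ball 0 1)ᶜ, ENNReal.ofReal (b y / ‖y - 0‖ ^ (N + s * p)) := by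
    rw [← lintegral_const_mul' _ _ ENNReal.ofReal_ne_top,
      ← lintegral_const_mul' _ _ ENNReal.ofReal_ne_top,
      ← lintegral_add_compl g measurableSet_ball (A := ball 0 1)]
    congr 1
    · refine setLIntegral_congr_fun measurableSet_ball fun y hy => ?_
      rw [hg]
      simp only
      rw [indicator_of_mem hy, indicator_of_notMem (by simpa using hy), add_zero]
    · refine setLIntegral_congr_fun measurableSet_ball.compl fun y hy => ?_
      rw [hg]
      simp only
      rw [indicator_of_mem hy, indicator_of_notMem hy, zero_add]
  rw [← hgint]
  have hpt : ∀ z ∈ shearSet K (ball (0 : EuclideanSpace ℝ (Fin N)) δ)ᶜ,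
      ENNReal.ofReal (b z.2 * a z.1 / ‖z.1 - z.2‖ ^ (N + s * p))
        ≤ ENNReal.ofReal (a z.1) * g z.2 := by
    intro ⟨x, y⟩ hz
    obtain ⟨hx, hxy⟩ := hz
    have hxy : δ ≤ ‖x - y‖ := by
      rw [norm_sub_rev]; simpa using hxy
    have hxy0 : 0 < ‖x - y‖ := hδ.trans_le hxy
    rw [mul_comm (b y), mul_div_assoc, ENNReal.ofReal_mul (ha x)]
    dsimp only
    gcongr
    by_cases hy : y ∈ ball (0 : EuclideanSpace ℝ (Fin N)) 1
    · rw [hg]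
      simp only
      rw [indicator_of_mem hy, indicator_of_notMem (by simpa using hy), add_zero,
        ← ENNReal.ofReal_mul (by positivity), div_eq_inv_mul]
      refine ENNReal.ofReal_le_ofReal (mul_le_mul_of_nonneg_right ?_ (hb y))
      refine inv_anti₀ (by positivity) ?_
      calc δ ^ (N + p) ≤ δ ^ (N + s * p) :=
            Real.rpow_le_rpow_of_exponent_ge hδ hδ1 hexp
        _ ≤ _ := Real.rpow_le_rpow hδ.le hxy hexp0.le
    · rw [hg]
      simp only
      rw [indicator_of_mem (show y ∈ (ball 0 1)ᶜ from hy), indicator_of_notMem hy, zero_add,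
        ← ENNReal.ofReal_mul (by positivity), sub_zero]
      have hy1 : 1 ≤ ‖y‖ := by simpa using hy
      have hx1 : ‖x‖ < R := by simpa using hKR hx
      have h1 : ‖y‖ ≤ (1 + R / δ) * ‖x - y‖ := by
        have h2 : ‖y‖ ≤ ‖x‖ + ‖x - y‖ := by
          have := norm_sub_le x (x - y)
          simpa using this
        have h3 : R ≤ R / δ * ‖x - y‖ := by
          calc R = R / δ * δ := by field_simp
            _ ≤ _ := by gcongr
        linarith
      refine ENNReal.ofReal_le_ofReal ?_
      rw [div_eq_mul_inv, div_eq_mul_inv (b y) (‖y‖ ^ _), mul_left_comm]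
      refine mul_le_mul_of_nonneg_left ?_ (hb y)
      rw [← div_eq_mul_inv, le_div_iff₀ (by positivity), inv_mul_le_iff₀ (by positivity)]
      calc ‖y‖ ^ (N + s * p) ≤ ((1 + R / δ) * ‖x - y‖) ^ (N + s * p) :=
            Real.rpow_le_rpow (norm_nonneg _) h1 hexp0.le
        _ = (1 + R / δ) ^ (N + s * p) * ‖x - y‖ ^ (N + s * p) :=
            Real.mul_rpow (by linarith) hxy0.le
        _ ≤ (1 + R / δ) ^ (N + p) * ‖x - y‖ ^ (N + s * p) := by
            gcongr
        _ = _ := mul_comm _ _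
  calc _ ≤ ∫⁻ z in shearSet K (ball 0 δ)ᶜ, ENNReal.ofReal (a z.1) * g z.2 :=
        setLIntegral_mono' (measurableSet_shearSet hKm measurableSet_ball.compl) hpt
    _ ≤ ∫⁻ z in K ×ˢ univ, ENNReal.ofReal (a z.1) * g z.2 :=
        lintegral_mono_set fun z hz => (⟨hz.1, mem_univ _⟩ : z ∈ K ×ˢ univ)
    _ ≤ ∫⁻ x in K, ∫⁻ y, ENNReal.ofReal (a x) * g y := by
        rw [Measure.volume_eq_prod, ← Measure.prod_restrict, Measure.restrict_univ]
        exact lintegral_prod_le _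
    _ = ∫⁻ x in K, ENNReal.ofReal (a x) * ∫⁻ y, g y := by
        congr 1; ext x
        exact lintegral_const_mul' _ _ ENNReal.ofReal_ne_top
    _ = _ := lintegral_mul_const'' _ ham.ennreal_ofReal

theorem aemeasurable_nonlocalDensity {N : ℕ} (p : ℝ) {u v : EuclideanSpace ℝ (Fin N) → ℝ}
    (hu : AEMeasurable u) (hv : AEMeasurable v) (μ : Measure ℝ) [SFinite μ] :
    AEMeasurable (fun q : ℝ × (EuclideanSpace ℝ (Fin N) × EuclideanSpace ℝ (Fin N)) =>
      nonlocalDensity p u v q.1 q.2) (μ.prod volume) := by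
  unfold nonlocalDensity
  have hu1 : AEMeasurable (fun q : ℝ × (EuclideanSpace ℝ (Fin N) × EuclideanSpace ℝ (Fin N)) =>
      u q.2.1) (μ.prod volume) := AEMeasurable.comp_snd (f := fun z : EuclideanSpace ℝ (Fin N) × EuclideanSpace ℝ (Fin N) =>
        u z.1) hu.comp_fst
  have hu2 : AEMeasurable (fun q : ℝ × (EuclideanSpace ℝ (Fin N) × EuclideanSpace ℝ (Fin N)) =>
      u q.2.2) (μ.prod volume) := AEMeasurable.comp_snd (f := fun z : EuclideanSpace ℝ (Fin N) × EuclideanSpace ℝ (Fin N) =>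
        u z.2) hu.comp_snd
  have hv1 : AEMeasurable (fun q : ℝ × (EuclideanSpace ℝ (Fin N) × EuclideanSpace ℝ (Fin N)) =>
      v q.2.1) (μ.prod volume) := AEMeasurable.comp_snd (f := fun z : EuclideanSpace ℝ (Fin N) × EuclideanSpace ℝ (Fin N) =>
        v z.1) hv.comp_fst
  have hv2 : AEMeasurable (fun q : ℝ × (EuclideanSpace ℝ (Fin N) × EuclideanSpace ℝ (Fin N)) =>
      v q.2.2) (μ.prod volume) := AEMeasurable.comp_snd (f := fun z : EuclideanSpace ℝ (Fin N) × EuclideanSpace ℝ (Fin N) =>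
        v z.2) hv.comp_snd
  have hk : Measurable (fun q : ℝ × (EuclideanSpace ℝ (Fin N) × EuclideanSpace ℝ (Fin N)) =>
      ‖q.2.1 - q.2.2‖ ^ (N + q.1 * p)) := by fun_prop
  have hd := hu1.sub hu2
  exact (((hd.abs.pow_const (p - 2)).mul hd).mul (hv1.sub hv2)).div hk.aemeasurable

/-- Near the diagonal, `|a|^(p-1) |c| ≤ |a|^p + |c|^p` reduces the density to the separate energies
of `u` and `v`, and the density vanishes unless `x` is within `δ` of `K`. Away from the diagonal, no
cancellation in `v(x) - v(y)` is needed: the two terms are estimated separately, each has its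
`v`-variable in `K`, and one bound is the swap of the other. -/
theorem enorm_nonlocalDensity_le {N : ℕ} {p : ℝ} (hp : 1 < p)
    {u v : EuclideanSpace ℝ (Fin N) → ℝ}
    {K : Set (EuclideanSpace ℝ (Fin N))} (hv0 : ∀ x, x ∉ K → v x = 0) {δ : ℝ} (hδ : 0 < δ)
    (s : ℝ) (z : EuclideanSpace ℝ (Fin N) × EuclideanSpace ℝ (Fin N)) :
    ‖nonlocalDensity p u v s z‖ₑ ≤
      (shearSet (thickening δ K) (ball 0 δ)).indicator (fun z =>
        ENNReal.ofReal (|u z.1 - u z.2| ^ p / ‖z.1 - z.2‖ ^ (N + s * p))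
        + ENNReal.ofReal (|v z.1 - v z.2| ^ p / ‖z.1 - z.2‖ ^ (N + s * p))) z
      + ((shearSet K (ball 0 δ)ᶜ).indicator (fun z => ENNReal.ofReal (2 ^ p) *
          (ENNReal.ofReal (|u z.1| ^ (p - 1) * |v z.1| / ‖z.1 - z.2‖ ^ (N + s * p))
          + ENNReal.ofReal (|u z.2| ^ (p - 1) * |v z.1| / ‖z.1 - z.2‖ ^ (N + s * p)))) z
        + (shearSet K (ball 0 δ)ᶜ).indicator (fun z => ENNReal.ofReal (2 ^ p) *
          (ENNReal.ofReal (|u z.1| ^ (p - 1) * |v z.1| / ‖z.1 - z.2‖ ^ (N + s * p))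
          + ENNReal.ofReal (|u z.2| ^ (p - 1) * |v z.1| / ‖z.1 - z.2‖ ^ (N + s * p)))) z.swap) := by
  obtain ⟨x, y⟩ := z
  have hE : 0 ≤ ‖x - y‖ ^ (N + s * p) := by positivity
  have hF : ‖nonlocalDensity p u v s (x, y)‖ₑ = ENNReal.ofReal
      (|(|u x - u y| ^ (p - 2) * (u x - u y) * (v x - v y))| / ‖x - y‖ ^ (N + s * p)) := by
    rw [← ofReal_norm, nonlocalDensity, norm_div, Real.norm_eq_abs, Real.norm_of_nonneg hE]
  rcases lt_or_ge ‖y - x‖ δ with hxy | hxy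
  · by_cases hx : x ∈ thickening δ K
    · refine le_add_right ?_
      rw [indicator_of_mem (show (x, y) ∈ shearSet (thickening δ K) (ball 0 δ) from
        ⟨hx, by simpa using hxy⟩), hF, ← ENNReal.ofReal_add (by positivity) (by positivity),
        ← add_div]
      exact ENNReal.ofReal_le_ofReal
        (div_le_div_of_nonneg_right (abs_rpow_mul_mul_le hp _ _) hE)
    · have h1 : v x = 0 := hv0 x fun h => hx (self_subset_thickening hδ K h)
      have h2 : v y = 0 := hv0 y fun h => hx (mem_thickening_iff.2
        ⟨y, h, by rwa [dist_comm, dist_eq_norm]⟩)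
      rw [hF, h1, h2]; simp
  · refine le_add_left ?_
    have key : ∀ x y : EuclideanSpace ℝ (Fin N), δ ≤ ‖y - x‖ → ENNReal.ofReal
        (|(|u x - u y| ^ (p - 2) * (u x - u y) * v x)| / ‖x - y‖ ^ (N + s * p)) ≤
        (shearSet K (ball 0 δ)ᶜ).indicator (fun z => ENNReal.ofReal (2 ^ p) *
          (ENNReal.ofReal (|u z.1| ^ (p - 1) * |v z.1| / ‖z.1 - z.2‖ ^ (N + s * p))
          + ENNReal.ofReal (|u z.2| ^ (p - 1) * |v z.1| / ‖z.1 - z.2‖ ^ (N + s * p)))) (x, y) := by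
      intro x y hxy
      by_cases hx : x ∈ K
      · rw [indicator_of_mem (show (x, y) ∈ shearSet K (ball 0 δ)ᶜ from ⟨hx, by simpa using hxy⟩),
          ← ENNReal.ofReal_add (by positivity) (by positivity), ← add_div,
          ← ENNReal.ofReal_mul (by positivity), ← mul_div_assoc]
        exact ENNReal.ofReal_le_ofReal
          (div_le_div_of_nonneg_right (abs_sub_rpow_mul_le hp _ _ _) (by positivity))
      · rw [hv0 x hx]; simp
    refine le_trans ?_ (add_le_add (key x y hxy) (key y x (by rwa [norm_sub_rev])))
    rw [hF, ← ENNReal.ofReal_add (by positivity) (by positivity)]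
    refine ENNReal.ofReal_le_ofReal ?_
    rw [norm_sub_rev y x, ← add_div]
    refine div_le_div_of_nonneg_right ?_ hE
    have e1 : |(|u y - u x| ^ (p - 2) * (u y - u x) * v y)|
        = |(|u x - u y| ^ (p - 2) * (u x - u y) * v y)| := by
      rw [abs_sub_comm (u y), ← abs_neg]; congr 1; ring
    rw [e1, mul_sub]
    exact abs_sub _ _

/-- The dependence on `s` is kept explicit, because the factors `1 / (1 - s)` and `1 / s` become
harmless only after multiplication by the normalizing constant. -/
theorem lintegral_enorm_nonlocalDensity_le {N : ℕ} (hN : 1 ≤ N) {p : ℝ} (hp : 1 < p)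
    {u v : EuclideanSpace ℝ (Fin N) → ℝ} (hu : AEMeasurable u) (hv : AEMeasurable v)
    {K : Set (EuclideanSpace ℝ (Fin N))} (hK : MeasurableSet K) (hv0 : ∀ x, x ∉ K → v x = 0)
    {δ R : ℝ} (hδ : 0 < δ) (hδ1 : δ ≤ 1) (hR : 0 < R) (hKR : K ⊆ ball 0 R)
    {Mu Mv : ℝ≥0∞} (hMu : Mu ≠ ⊤) (hMv : Mv ≠ ⊤)
    (hu' : ∀ h ∈ ball (0 : EuclideanSpace ℝ (Fin N)) δ,
      ∫⁻ x in thickening δ K, ‖u (x + h) - u x‖ₑ ^ p ≤ ‖h‖ₑ ^ p * Mu)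
    (hv' : ∀ h ∈ ball (0 : EuclideanSpace ℝ (Fin N)) δ,
      ∫⁻ x in thickening δ K, ‖v (x + h) - v x‖ₑ ^ p ≤ ‖h‖ₑ ^ p * Mv)
    (huv : ∫⁻ x in K, ENNReal.ofReal (|u x| ^ (p - 1) * |v x|) ≠ ⊤)
    {s : ℝ} (hs : s ∈ Ioo (0 : ℝ) 1) :
    ∫⁻ z, ‖nonlocalDensity p u v s z‖ₑ ≤
      ENNReal.ofReal (N * volume.real (ball (0 : EuclideanSpace ℝ (Fin N)) 1)
          * (δ ^ (p * (1 - s)) / (p * (1 - s)))) * (Mu + Mv)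
      + 2 * (ENNReal.ofReal (2 ^ p) *
        (ENNReal.ofReal (N * volume.real (ball (0 : EuclideanSpace ℝ (Fin N)) 1)
          * (δ ^ (-(s * p)) / (s * p))) * (∫⁻ x in K, ENNReal.ofReal (|u x| ^ (p - 1) * |v x|))
        + (∫⁻ x in K, ENNReal.ofReal |v x|) *
          (ENNReal.ofReal ((δ ^ (N + p))⁻¹) *
            (∫⁻ y in ball 0 1, ENNReal.ofReal (|u y| ^ (p - 1)))
          + ENNReal.ofReal ((1 + R / δ) ^ (N + p)) *
            ∫⁻ y in (ball 0 1)ᶜ, ENNReal.ofReal (|u y| ^ (p - 1) / ‖y - 0‖ ^ (N + s * p))))) := by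
  have hu1 : AEMeasurable (fun z : EuclideanSpace ℝ (Fin N) × EuclideanSpace ℝ (Fin N) => u z.1)
    volume := hu.comp_fst
  have hu2 : AEMeasurable (fun z : EuclideanSpace ℝ (Fin N) × EuclideanSpace ℝ (Fin N) => u z.2)
    volume := hu.comp_snd
  have hv1 : AEMeasurable (fun z : EuclideanSpace ℝ (Fin N) × EuclideanSpace ℝ (Fin N) => v z.1)
    volume := hv.comp_fst
  have hv2 : AEMeasurable (fun z : EuclideanSpace ℝ (Fin N) × EuclideanSpace ℝ (Fin N) => v z.2)
    volume := hv.comp_snd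
  have hk : AEMeasurable (fun z : EuclideanSpace ℝ (Fin N) × EuclideanSpace ℝ (Fin N) =>
      ‖z.1 - z.2‖ ^ (N + s * p)) volume :=
    Measurable.aemeasurable (by fun_prop)
  have m1 : AEMeasurable (fun z : EuclideanSpace ℝ (Fin N) × EuclideanSpace ℝ (Fin N) =>
      ENNReal.ofReal (|u z.1 - u z.2| ^ p / ‖z.1 - z.2‖ ^ (N + s * p))) volume :=
    (((hu1.sub hu2).abs.pow_const p).div hk).ennreal_ofReal
  have m2 : AEMeasurable (fun z : EuclideanSpace ℝ (Fin N) × EuclideanSpace ℝ (Fin N) =>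
      ENNReal.ofReal (|v z.1 - v z.2| ^ p / ‖z.1 - z.2‖ ^ (N + s * p))) volume :=
    (((hv1.sub hv2).abs.pow_const p).div hk).ennreal_ofReal
  have m3 : AEMeasurable (fun z : EuclideanSpace ℝ (Fin N) × EuclideanSpace ℝ (Fin N) =>
      ENNReal.ofReal (|u z.1| ^ (p - 1) * |v z.1| / ‖z.1 - z.2‖ ^ (N + s * p))) volume :=
    (((hu1.abs.pow_const _).mul hv1.abs).div hk).ennreal_ofReal
  have m4 : AEMeasurable (fun z : EuclideanSpace ℝ (Fin N) × EuclideanSpace ℝ (Fin N) =>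
      ENNReal.ofReal (|u z.2| ^ (p - 1) * |v z.1| / ‖z.1 - z.2‖ ^ (N + s * p))) volume :=
    (((hu2.abs.pow_const _).mul hv1.abs).div hk).ennreal_ofReal
  have hS1 : MeasurableSet (shearSet (thickening δ K) (ball (0 : EuclideanSpace ℝ (Fin N)) δ)) :=
    measurableSet_shearSet isOpen_thickening.measurableSet measurableSet_ball
  have hS2 : MeasurableSet (shearSet K (ball (0 : EuclideanSpace ℝ (Fin N)) δ)ᶜ) :=
    measurableSet_shearSet hK measurableSet_ball.compl
  have mA : AEMeasurable ((shearSet K (ball (0 : EuclideanSpace ℝ (Fin N)) δ)ᶜ).indicator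
      (fun z => ENNReal.ofReal (2 ^ p) *
          (ENNReal.ofReal (|u z.1| ^ (p - 1) * |v z.1| / ‖z.1 - z.2‖ ^ (N + s * p))
          + ENNReal.ofReal (|u z.2| ^ (p - 1) * |v z.1| / ‖z.1 - z.2‖ ^ (N + s * p))))) volume :=
    ((m3.add m4).const_mul _).indicator hS2
  have mN : AEMeasurable ((shearSet (thickening δ K) (ball 0 δ)).indicator
      (fun z : EuclideanSpace ℝ (Fin N) × EuclideanSpace ℝ (Fin N) =>
        ENNReal.ofReal (|u z.1 - u z.2| ^ p / ‖z.1 - z.2‖ ^ (N + s * p))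
        + ENNReal.ofReal (|v z.1 - v z.2| ^ p / ‖z.1 - z.2‖ ^ (N + s * p)))) volume :=
    (m1.add m2).indicator hS1
  refine (lintegral_mono (enorm_nonlocalDensity_le hp hv0 hδ s)).trans ?_
  rw [lintegral_add_left' mN, lintegral_add_left' mA,
    lintegral_indicator hS1, lintegral_add_left' m1.restrict]
  rw [Measure.volume_eq_prod, lintegral_prod_swap, ← two_mul, ← Measure.volume_eq_prod,
    lintegral_indicator hS2, lintegral_const_mul' _ _ ENNReal.ofReal_ne_top,
    lintegral_add_left' m3.restrict]
  refine add_le_add ?_ ?_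
  · rw [mul_add]
    exact add_le_add (setLIntegral_near_le hN hp hδ hMu hu' hs)
      (setLIntegral_near_le hN hp hδ hMv hv' hs)
  · gcongr
    · exact setLIntegral_far_le hN hp hδ huv hs
    · exact setLIntegral_tail_le hp hδ hδ1 hR hKR (fun x => abs_nonneg (v x))
        (fun y => by positivity) hK hv.abs.restrict hs

theorem MemTailSpace.aemeasurable {N : ℕ} {μ : Measure ℝ} {p : ℝ}
    {u : EuclideanSpace ℝ (Fin N) → ℝ} (h : MemTailSpace μ p u) : AEMeasurable u := by
  rw [← Measure.restrict_univ (μ := volume), ← iUnion_closedBall_nat (0 : EuclideanSpace ℝ (Fin N)),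
    aemeasurable_iUnion_iff]
  exact fun n => (h.1 _ (isCompact_closedBall _ _)).1.aemeasurable

theorem MemTailSpace.lintegral_tail_lt_top {N : ℕ} {μ : Measure ℝ} {p : ℝ} (hp : 1 < p)
    {u : EuclideanSpace ℝ (Fin N) → ℝ} (h : MemTailSpace μ p u) :
    ∫⁻ s in Ioo (0 : ℝ) 1, ENNReal.ofReal (normConst N p s) *
      (∫⁻ y in (ball 0 1)ᶜ, ENNReal.ofReal (|u y| ^ (p - 1) / ‖y - 0‖ ^ (N + s * p))) ∂μ < ⊤ := by
  have := h.2 0 1 one_pos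
  rw [superTail, ENNReal.rpow_lt_top_iff_of_pos (one_div_pos.2 (sub_pos.2 hp))] at this
  simpa only [Real.one_rpow, mul_one] using this

theorem MeasureTheory.MemLp.lintegral_enorm_rpow_lt_top {α F : Type*} [MeasurableSpace α]
    [NormedAddCommGroup F] {ν : Measure α} {f : α → F} {p : ℝ} (hp : 0 < p)
    (h : MemLp f (ENNReal.ofReal p) ν) : ∫⁻ x, ‖f x‖ₑ ^ p ∂ν < ⊤ := by
  have := lintegral_rpow_enorm_lt_top_of_eLpNorm_lt_top (by simpa using hp)
    ENNReal.ofReal_ne_top h.2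
  rwa [ENNReal.toReal_ofReal hp.le] at this

theorem ofReal_abs_rpow {p : ℝ} (hp : 0 ≤ p) (a : ℝ) : ENNReal.ofReal (|a| ^ p) = ‖a‖ₑ ^ p := by
  rw [← ENNReal.ofReal_rpow_of_nonneg (abs_nonneg _) hp, ← Real.norm_eq_abs, ofReal_norm]

theorem rpow_sub_one_mul_le {p : ℝ} (hp : 1 < p) (a c : ℝ) :
    |a| ^ (p - 1) * |c| ≤ |a| ^ p + |c| ^ p := by
  have h := abs_rpow_mul_mul_le hp a c
  rwa [abs_mul, abs_mul, abs_of_nonneg (Real.rpow_nonneg (abs_nonneg a) _),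
    ← Real.rpow_add_one' (abs_nonneg a) (by linarith), show p - 2 + 1 = p - 1 by ring] at h

theorem setLIntegral_rpow_mul_lt_top {N : ℕ} {p : ℝ} (hp : 1 < p)
    {u v : EuclideanSpace ℝ (Fin N) → ℝ} {ν : Measure (EuclideanSpace ℝ (Fin N))}
    (hu : MemLp u (ENNReal.ofReal p) ν) (hv : MemLp v (ENNReal.ofReal p) ν) :
    ∫⁻ x, ENNReal.ofReal (|u x| ^ (p - 1) * |v x|) ∂ν < ⊤ := by
  have hp0 : 0 < p := by linarith
  calc ∫⁻ x, ENNReal.ofReal (|u x| ^ (p - 1) * |v x|) ∂ν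
      ≤ ∫⁻ x, (‖u x‖ₑ ^ p + ‖v x‖ₑ ^ p) ∂ν := by
        refine lintegral_mono fun x => ?_
        rw [← ofReal_abs_rpow hp0.le, ← ofReal_abs_rpow hp0.le,
          ← ENNReal.ofReal_add (by positivity) (by positivity)]
        exact ENNReal.ofReal_le_ofReal (rpow_sub_one_mul_le hp _ _)
    _ = _ := lintegral_add_left' (hu.1.enorm.pow_const p) _
    _ < ⊤ := ENNReal.add_lt_top.2
        ⟨hu.lintegral_enorm_rpow_lt_top hp0, hv.lintegral_enorm_rpow_lt_top hp0⟩

theorem ofReal_normConst_mul_near_le {N : ℕ} {p : ℝ} (hp : 1 < p) {B δ c s : ℝ}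
    (hc : 0 ≤ c) (hδ : 0 < δ) (hδ1 : δ ≤ 1) (hs : s ∈ Ioo (0 : ℝ) 1)
    (hB : normConst N p s ≤ B * (s * (1 - s))) :
    ENNReal.ofReal (normConst N p s) *
      ENNReal.ofReal (c * (δ ^ (p * (1 - s)) / (p * (1 - s)))) ≤ ENNReal.ofReal (B * c / p) := by
  have hp0 : 0 < p := by linarith
  have h1 : 0 < 1 - s := sub_pos.2 hs.2
  have hn := normConst_nonneg N hp hs
  have hB0 : 0 ≤ B := by
    have := hn.trans hB
    exact nonneg_of_mul_nonneg_left this (mul_pos hs.1 h1)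
  rw [← ENNReal.ofReal_mul hn]
  refine ENNReal.ofReal_le_ofReal ?_
  have hB1 : 0 ≤ B * (s * (1 - s)) := hn.trans hB
  have h2 : δ ^ (p * (1 - s)) ≤ 1 := Real.rpow_le_one hδ.le hδ1 (by positivity)
  calc normConst N p s * (c * (δ ^ (p * (1 - s)) / (p * (1 - s))))
      ≤ (B * (s * (1 - s))) * (c * (1 / (p * (1 - s)))) := by gcongr
    _ = s * (B * c / p) := by field_simp
    _ ≤ 1 * (B * c / p) := by
        gcongr
        exact hs.2.le
    _ = _ := one_mul _

theorem ofReal_normConst_mul_far_le {N : ℕ} {p : ℝ} (hp : 1 < p) {B δ c s : ℝ}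
    (hc : 0 ≤ c) (hδ : 0 < δ) (hδ1 : δ ≤ 1) (hs : s ∈ Ioo (0 : ℝ) 1)
    (hB : normConst N p s ≤ B * (s * (1 - s))) :
    ENNReal.ofReal (normConst N p s) *
      ENNReal.ofReal (c * (δ ^ (-(s * p)) / (s * p))) ≤ ENNReal.ofReal (B * c * δ ^ (-p) / p) := by
  have hp0 : 0 < p := by linarith
  have h1 : 0 < 1 - s := sub_pos.2 hs.2
  have hs0 := hs.1
  have hn := normConst_nonneg N hp hs
  have hB0 : 0 ≤ B := by
    have := hn.trans hB
    exact nonneg_of_mul_nonneg_left this (mul_pos hs.1 h1)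
  rw [← ENNReal.ofReal_mul hn]
  refine ENNReal.ofReal_le_ofReal ?_
  have h2 : δ ^ (-(s * p)) ≤ δ ^ (-p) :=
    Real.rpow_le_rpow_of_exponent_ge hδ hδ1 (by nlinarith [hs.2])
  calc normConst N p s * (c * (δ ^ (-(s * p)) / (s * p)))
      ≤ (B * (s * (1 - s))) * (c * (δ ^ (-p) / (s * p))) := by gcongr
    _ = (1 - s) * (B * c * δ ^ (-p) / p) := by field_simp
    _ ≤ 1 * (B * c * δ ^ (-p) / p) := by
        gcongr
        linarith
    _ = _ := one_mul _

/-- The nonlocal part of the weak form converges absolutely. -/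
theorem integrable_normConst_mul_nonlocalDensity {N : ℕ} (hN : 1 ≤ N) {p : ℝ} (hp : 1 < p)
    {μ : Measure ℝ} [IsFiniteMeasure μ] {Ω : Set (EuclideanSpace ℝ (Fin N))} (hΩ : IsOpen Ω)
    {u v : EuclideanSpace ℝ (Fin N) → ℝ}
    {U V : EuclideanSpace ℝ (Fin N) → EuclideanSpace ℝ (Fin N)}
    (hut : MemTailSpace μ p u) (hu : MemW1pLoc p Ω u U)
    {K : Set (EuclideanSpace ℝ (Fin N))} (hK : IsCompact K) (hKΩ : K ⊆ Ω)
    (hv : MemW1pZero p K v V) :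
    Integrable (fun q : ℝ × (EuclideanSpace ℝ (Fin N) × EuclideanSpace ℝ (Fin N)) =>
      normConst N p q.1 * nonlocalDensity p u v q.1 q.2)
      ((μ.restrict (Ioo 0 1)).prod volume) := by
  have hp0 : 0 < p := by linarith
  obtain ⟨δ₀, hδ₀, hδΩ⟩ := hK.exists_cthickening_subset_open hΩ hKΩ
  obtain ⟨R, hR, hKR⟩ := hK.isBounded.subset_ball_lt 0 (0 : EuclideanSpace ℝ (Fin N))
  obtain ⟨B, hB0, hB⟩ := exists_normConst_le hN hp
  obtain ⟨hvw, hvL, hVL, hv0⟩ := hv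
  -- Half of `δ₀` leaves room for both the distance from `K` and the translation. The bound by `1`
  -- is what makes the estimates uniform in `s`.
  set δ := min (δ₀ / 2) 1 with hδd
  have hδ : 0 < δ := lt_min (by linarith) one_pos
  have hδ1 : δ ≤ 1 := min_le_right _ _
  set K' := cthickening δ₀ K with hK'
  have hK'c : IsCompact K' := hK.cthickening
  have hseg : ∀ h ∈ ball (0 : EuclideanSpace ℝ (Fin N)) δ, ∀ x ∈ thickening δ K,
      ∀ t ∈ Icc (0 : ℝ) 1, x + t • h ∈ K' := by
    intro h hh x hx t ht
    obtain ⟨y, hy, hxy⟩ := mem_thickening_iff.1 hx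
    refine mem_cthickening_of_dist_le _ y δ₀ K hy ?_
    have h1 : ‖t • h‖ ≤ δ := by
      rw [norm_smul, Real.norm_of_nonneg ht.1]
      exact (mul_le_of_le_one_left (norm_nonneg _) ht.2).trans (by simpa using (mem_ball.1 hh).le)
    have h2 : δ ≤ δ₀ / 2 := min_le_left _ _
    calc dist (x + t • h) y ≤ dist (x + t • h) x + dist x y := dist_triangle _ _ _
      _ ≤ δ + δ := by
          gcongr
          rwa [dist_eq_norm, add_sub_cancel_left]
      _ ≤ δ₀ := by linarith
  set Mu := ∫⁻ x in K', ‖U x‖ₑ ^ p with hMu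
  set Mv := ∫⁻ x in K', ‖V x‖ₑ ^ p with hMv
  have hMu' : Mu ≠ ⊤ := ((hu.2 K' hδΩ hK'c).2.lintegral_enorm_rpow_lt_top hp0).ne
  have hMv' : Mv ≠ ⊤ := ((hVL.restrict K').lintegral_enorm_rpow_lt_top hp0).ne
  have hmu : AEMeasurable u := hut.aemeasurable
  have hmv : AEMeasurable v := hvL.1.aemeasurable
  have hbound : ∀ s ∈ Ioo (0 : ℝ) 1, _ := fun s hs =>
    lintegral_enorm_nonlocalDensity_le hN hp hmu hmv hK.measurableSet hv0 hδ hδ1 hR hKR hMu' hMv'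
    (fun h hh => hu.1.setLIntegral_translate_sub_rpow_le hp isOpen_thickening hK'c hδΩ h (hseg h hh))
    (fun h hh => hvw.setLIntegral_translate_sub_rpow_le hp isOpen_thickening hK'c (subset_univ _) h
      (hseg h hh))
    (setLIntegral_rpow_mul_lt_top hp (hu.2 K hKΩ hK).1 (hvL.restrict K)).ne hs
  set κ := N * volume.real (ball (0 : EuclideanSpace ℝ (Fin N)) 1) with hκ
  have hκ0 : 0 ≤ κ := by positivity
  set I1 := ∫⁻ x in K, ENNReal.ofReal (|u x| ^ (p - 1) * |v x|) with hI1
  set I2 := ∫⁻ x in K, ENNReal.ofReal |v x| with hI2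
  set I3 := ∫⁻ y in ball (0 : EuclideanSpace ℝ (Fin N)) 1, ENNReal.ofReal (|u y| ^ (p - 1)) with hI3
  set L := ENNReal.ofReal ((1 + R / δ) ^ (N + p)) with hL
  set D := ENNReal.ofReal ((δ ^ (N + p))⁻¹) with hD
  set T : ℝ → ℝ≥0∞ := fun s =>
    ∫⁻ y in (ball 0 1)ᶜ, ENNReal.ofReal (|u y| ^ (p - 1) / ‖y - 0‖ ^ (N + s * p)) with hT
  have hI1' : I1 ≠ ⊤ := (setLIntegral_rpow_mul_lt_top hp (hu.2 K hKΩ hK).1 (hvL.restrict K)).ne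
  have hI2' : I2 ≠ ⊤ := by
    have hfin : IsFiniteMeasure (volume.restrict K) := ⟨by simpa using hK.measure_lt_top⟩
    have h1p : (1 : ℝ≥0∞) ≤ ENNReal.ofReal p := by
      rw [← ENNReal.ofReal_one]; exact ENNReal.ofReal_le_ofReal hp.le
    have := ((hvL.restrict K).integrable h1p).2.ne
    simp_rw [hI2, ← Real.norm_eq_abs, ofReal_norm]
    exact this
  have hI3' : I3 ≠ ⊤ := by
    have h1 := (hut.1 _ (isCompact_closedBall 0 1)).lintegral_enorm_rpow_lt_top (sub_pos.2 hp)
    refine ((lintegral_mono_set ball_subset_closedBall).trans_lt ?_).ne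
    simp_rw [ofReal_abs_rpow (sub_pos.2 hp).le]
    exact h1
  -- `Q` collects the terms bounded uniformly in `s`, integrable because `μ` is finite. `Q'` is the
  -- coefficient of the superposition tail, whose integral in `s` is finite because `u` belongs to
  -- the tail space.
  set Q : ℝ≥0∞ := ENNReal.ofReal (B * κ / p) * (Mu + Mv)
    + 2 * (ENNReal.ofReal (2 ^ p) * (ENNReal.ofReal (B * κ * δ ^ (-p) / p) * I1
      + I2 * (D * (ENNReal.ofReal B * I3)))) with hQ
  set Q' : ℝ≥0∞ := 2 * (ENNReal.ofReal (2 ^ p) * (I2 * L)) with hQ'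
  have hQfin : Q ≠ ⊤ := by finiteness
  have hQ'fin : Q' ≠ ⊤ := by finiteness
  have hpt : ∀ s ∈ Ioo (0 : ℝ) 1,
      ∫⁻ z, ‖normConst N p s * nonlocalDensity p u v s z‖ₑ
        ≤ Q + Q' * (ENNReal.ofReal (normConst N p s) * T s) := by
    intro s hs
    have hn := normConst_nonneg N hp hs
    have e1 : ∀ z, ‖normConst N p s * nonlocalDensity p u v s z‖ₑ
        = ENNReal.ofReal (normConst N p s) * ‖nonlocalDensity p u v s z‖ₑ := fun z => by
      rw [enorm_mul, ← ofReal_norm (normConst N p s), Real.norm_of_nonneg hn]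
    simp_rw [e1]
    rw [lintegral_const_mul' _ _ ENNReal.ofReal_ne_top]
    have hn1 := ofReal_normConst_mul_near_le hp hκ0 hδ hδ1 hs (hB s hs)
    have hn2 := ofReal_normConst_mul_far_le hp hκ0 hδ hδ1 hs (hB s hs)
    have hn3 : ENNReal.ofReal (normConst N p s) ≤ ENNReal.ofReal B := by
      refine ENNReal.ofReal_le_ofReal ((hB s hs).trans ?_)
      have : s * (1 - s) ≤ 1 := by nlinarith [hs.1, hs.2]
      nlinarith
    set c := ENNReal.ofReal (normConst N p s)
    set a1 := ENNReal.ofReal (κ * (δ ^ (p * (1 - s)) / (p * (1 - s))))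
    set a2 := ENNReal.ofReal (κ * (δ ^ (-(s * p)) / (s * p)))
    calc c * ∫⁻ z, ‖nonlocalDensity p u v s z‖ₑ
        ≤ c * (a1 * (Mu + Mv) + 2 * (ENNReal.ofReal (2 ^ p) * (a2 * I1
            + I2 * (D * I3 + L * T s)))) := by
          gcongr
          exact hbound s hs
      _ = (c * a1) * (Mu + Mv) + 2 * (ENNReal.ofReal (2 ^ p) * ((c * a2) * I1
            + I2 * (D * (c * I3)))) + Q' * (c * T s) := by rw [hQ']; ring
      _ ≤ _ := by
          rw [hQ]
          gcongr
  refine ⟨?_, ?_⟩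
  · exact ((aemeasurable_normConst hN hp μ).comp_fst.mul
      (aemeasurable_nonlocalDensity p hmu hmv (μ.restrict (Ioo 0 1)))).aestronglyMeasurable
  · calc _ ≤ ∫⁻ s in Ioo (0 : ℝ) 1,
          (∫⁻ z, ‖normConst N p s * nonlocalDensity p u v s z‖ₑ) ∂μ := lintegral_prod_le _
      _ ≤ ∫⁻ s in Ioo (0 : ℝ) 1, (Q + Q' * (ENNReal.ofReal (normConst N p s) * T s)) ∂μ :=
          setLIntegral_mono' measurableSet_Ioo hpt
      _ = Q * μ (Ioo 0 1)
          + Q' * ∫⁻ s in Ioo (0 : ℝ) 1, ENNReal.ofReal (normConst N p s) * T s ∂μ := by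
          rw [lintegral_add_left measurable_const, setLIntegral_const,
            lintegral_const_mul' _ _ hQ'fin]
      _ < ⊤ := ENNReal.add_lt_top.2 ⟨ENNReal.mul_lt_top hQfin.lt_top (measure_lt_top μ _),
          ENNReal.mul_lt_top hQ'fin.lt_top (hut.lintegral_tail_lt_top hp)⟩

theorem truncationMulGradient_eq_zero {N : ℕ} {u : EuclideanSpace ℝ (Fin N) → ℝ}
    {U : EuclideanSpace ℝ (Fin N) → EuclideanSpace ℝ (Fin N)} {k p : ℝ} (hp : 1 < p)
    {w : EuclideanSpace ℝ (Fin N) → ℝ} {x : EuclideanSpace ℝ (Fin N)} (hx : w x = 0) :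
    truncationMulGradient u U k p w x = 0 := by
  simp [truncationMulGradient, hx, Real.zero_rpow (by linarith : p ≠ 0),
    Real.zero_rpow (sub_pos.2 hp).ne']

/-- The local part of the weak form converges absolutely. -/
theorem integrable_norm_rpow_mul_inner {N : ℕ} {p : ℝ} (hp : 1 < p)
    {K : Set (EuclideanSpace ℝ (Fin N))}
    {U V : EuclideanSpace ℝ (Fin N) → EuclideanSpace ℝ (Fin N)}
    (hU : MemLp U (ENNReal.ofReal p) (volume.restrict K)) (hV : MemLp V (ENNReal.ofReal p) volume)
    (hV0 : ∀ x, x ∉ K → V x = 0) :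
    Integrable (fun x => ‖U x‖ ^ (p - 2) * inner ℝ (U x) (V x)) := by
  have hp0 : 0 < p := by linarith
  have hVK := hV.restrict K
  have hsum : IntegrableOn (fun x => ‖U x‖ ^ p + ‖V x‖ ^ p) K := by
    have h1 := hU.integrable_norm_rpow (by simpa using hp0) ENNReal.ofReal_ne_top
    have h2 := hVK.integrable_norm_rpow (by simpa using hp0) ENNReal.ofReal_ne_top
    rw [ENNReal.toReal_ofReal hp0.le] at h1 h2
    exact h1.add h2
  have h : IntegrableOn (fun x => ‖U x‖ ^ (p - 2) * inner ℝ (U x) (V x)) K := by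
    refine hsum.mono' ?_ (ae_of_all _ fun x => ?_)
    · exact ((hU.1.norm.aemeasurable.pow_const _).aestronglyMeasurable).mul (hU.1.inner hVK.1)
    · have h1 := rpow_sub_one_mul_le hp ‖U x‖ ‖V x‖
      rw [abs_of_nonneg (norm_nonneg (U x)), abs_of_nonneg (norm_nonneg (V x))] at h1
      refine le_trans ?_ h1
      rw [norm_mul, Real.norm_of_nonneg (by positivity)]
      calc ‖U x‖ ^ (p - 2) * ‖inner ℝ (U x) (V x)‖
          ≤ ‖U x‖ ^ (p - 2) * (‖U x‖ * ‖V x‖) := by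
            gcongr
            exact norm_inner_le_norm _ _
        _ = ‖U x‖ ^ (p - 1) * ‖V x‖ := by
            rw [← mul_assoc, ← Real.rpow_add_one' (norm_nonneg _) (by linarith)]
            congr 2; ring
  refine (integrableOn_iff_integrable_of_support_subset fun x hx => ?_).1 h
  by_contra hxK
  exact hx (by simp [hV0 x hxK])

/-! ### Energy estimates in `[0, ∞]` -/

/-- Moving the negative part of `d` to the left removes every subtraction. The pointwise inequality
can then be integrated in `[0, ∞]` before any energy is known to be finite. -/
theorem ofReal_add_ofReal_mul_ofReal_neg_le {X A d Y : ℝ} (hX : 0 ≤ X) (hA : 0 ≤ A) (hY : 0 ≤ Y)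
    (h : X ≤ A * d + Y) :
    ENNReal.ofReal X + ENNReal.ofReal A * ENNReal.ofReal (-d)
      ≤ ENNReal.ofReal A * ENNReal.ofReal d + ENNReal.ofReal Y := by
  rcases le_total 0 d with hd | hd
  · rw [ENNReal.ofReal_of_nonpos (neg_nonpos.2 hd), mul_zero, add_zero, ← ENNReal.ofReal_mul hA,
      ← ENNReal.ofReal_add (by positivity) hY]
    exact ENNReal.ofReal_le_ofReal h
  · rw [ENNReal.ofReal_of_nonpos hd, mul_zero, zero_add, ← ENNReal.ofReal_mul hA,
      ← ENNReal.ofReal_add hX (mul_nonneg hA (neg_nonneg.2 hd))]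
    exact ENNReal.ofReal_le_ofReal (by linarith)

theorem nonlocalDensity_swap {N : ℕ} (p : ℝ) (u v : EuclideanSpace ℝ (Fin N) → ℝ) (s : ℝ)
    (x y : EuclideanSpace ℝ (Fin N)) :
    nonlocalDensity p u v s (y, x) = nonlocalDensity p u v s (x, y) := by
  unfold nonlocalDensity
  dsimp only
  rw [abs_sub_comm (u y), norm_sub_rev y]; ring

section Truncation

variable {N : ℕ} {p : ℝ} {u φ w : EuclideanSpace ℝ (Fin N) → ℝ} {k : ℝ}
  {B : Set (EuclideanSpace ℝ (Fin N))}

/-- The pointwise form of the nonlocal energy estimate. -/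
theorem indicator_add_ofReal_neg_nonlocalDensity_le (hp : 1 < p)
    (hφ : ∀ x, φ x = max (u x - k) 0) (hw0 : ∀ x, 0 ≤ w x) (hwB : ∀ x, x ∉ B → w x = 0) (s : ℝ)
    (z : EuclideanSpace ℝ (Fin N) × EuclideanSpace ℝ (Fin N)) :
    (B ×ˢ B).indicator (fun z => ENNReal.ofReal (|φ z.1 * w z.1 - φ z.2 * w z.2| ^ p
        / ‖z.1 - z.2‖ ^ (N + s * p))) z
      + ENNReal.ofReal (2 ^ p) *
        ENNReal.ofReal (-nonlocalDensity p u (fun x => φ x * w x ^ p) s z)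
    ≤ ENNReal.ofReal (2 ^ p) * ENNReal.ofReal (nonlocalDensity p u (fun x => φ x * w x ^ p) s z)
      + (ENNReal.ofReal (caccioppoliConst p) * (B ×ˢ B).indicator (fun z =>
          ENNReal.ofReal (max (φ z.1) (φ z.2) ^ p * |w z.1 - w z.2| ^ p
            / ‖z.1 - z.2‖ ^ (N + s * p))) z
        + ENNReal.ofReal (2 ^ p) * ((B ×ˢ Bᶜ).indicator (fun z =>
            ENNReal.ofReal (φ z.2 ^ (p - 1) / ‖z.1 - z.2‖ ^ (N + s * p)) *
              ENNReal.ofReal (φ z.1 * w z.1 ^ p)) z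
          + (B ×ˢ Bᶜ).indicator (fun z =>
            ENNReal.ofReal (φ z.2 ^ (p - 1) / ‖z.1 - z.2‖ ^ (N + s * p)) *
              ENNReal.ofReal (φ z.1 * w z.1 ^ p)) z.swap)) := by
  have hp0 : 0 < p := by linarith
  have hφ0 : ∀ x, 0 ≤ φ x := fun x => by rw [hφ]; exact le_max_right _ _
  have hwp0 : ∀ x, x ∉ B → w x ^ p = 0 := fun x hx => by rw [hwB x hx, Real.zero_rpow hp0.ne']
  have h2 : (0 : ℝ) ≤ 2 ^ p := by positivity
  have hc := caccioppoliConst_pos hp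
  -- For a pair with exactly one point in `B`, the test function vanishes at the other point and
  -- only the interaction with the exterior survives.
  have ext : ∀ x y : EuclideanSpace ℝ (Fin N), x ∈ B → y ∉ B →
      ENNReal.ofReal (2 ^ p) *
        ENNReal.ofReal (-nonlocalDensity p u (fun x => φ x * w x ^ p) s (x, y))
      ≤ ENNReal.ofReal (2 ^ p) *
          ENNReal.ofReal (nonlocalDensity p u (fun x => φ x * w x ^ p) s (x, y))
        + ENNReal.ofReal (2 ^ p) * (ENNReal.ofReal (φ y ^ (p - 1) / ‖x - y‖ ^ (N + s * p)) *
              ENNReal.ofReal (φ x * w x ^ p)) := by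
    intro x y hx hy
    have hφy := hφ0 y
    have hφx := hφ0 x
    have hwx := hw0 x
    have e : ENNReal.ofReal (2 ^ p) * (ENNReal.ofReal (φ y ^ (p - 1) / ‖x - y‖ ^ (N + s * p)) *
        ENNReal.ofReal (φ x * w x ^ p))
        = ENNReal.ofReal (2 ^ p * (φ y ^ (p - 1) / ‖x - y‖ ^ (N + s * p) * (φ x * w x ^ p))) := by
      rw [← ENNReal.ofReal_mul (by positivity), ← ENNReal.ofReal_mul h2]
    rw [e]
    have := ofReal_add_ofReal_mul_ofReal_neg_le (X := 0) (A := 2 ^ p)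
      (d := nonlocalDensity p u (fun x => φ x * w x ^ p) s (x, y))
      (Y := 2 ^ p * (φ y ^ (p - 1) / ‖x - y‖ ^ (N + s * p) * (φ x * w x ^ p)))
      le_rfl h2 (by positivity) ?_
    · simpa using this
    · rw [← mul_add]
      refine mul_nonneg h2 ?_
      have h3 := neg_truncation_rpow_mul_le hp (u x) (u y) k
      rw [← hφ, ← hφ] at h3
      have h4 : 0 ≤ (|u x - u y| ^ (p - 2) * (u x - u y) * φ x + φ y ^ (p - 1) * φ x) * w x ^ p
          / ‖x - y‖ ^ (N + s * p) :=
        div_nonneg (mul_nonneg (by linarith) (by positivity)) (by positivity)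
      refine h4.trans_eq ?_
      simp only [nonlocalDensity, hwp0 y hy, mul_zero, sub_zero]
      ring
  obtain ⟨x, y⟩ := z
  by_cases hx : x ∈ B <;> by_cases hy : y ∈ B
  · rw [indicator_of_mem (show (x, y) ∈ B ×ˢ B from ⟨hx, hy⟩),
      indicator_of_mem (show (x, y) ∈ B ×ˢ B from ⟨hx, hy⟩)]
    refine le_trans ?_ (add_le_add le_rfl le_self_add)
    rw [← ENNReal.ofReal_mul hc.le]
    have hm : 0 ≤ max (φ x) (φ y) := le_max_of_le_left (hφ0 x)
    refine ofReal_add_ofReal_mul_ofReal_neg_le (by positivity) h2 (by positivity) ?_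
    have h3 := abs_truncation_mul_sub_rpow_le hp (u x) (u y) k (hw0 x) (hw0 y)
    rw [← hφ, ← hφ] at h3
    have h4 := div_le_div_of_nonneg_right h3
      (by positivity : 0 ≤ ‖x - y‖ ^ (N + s * p))
    refine h4.trans_eq ?_
    simp only [nonlocalDensity]
    ring
  · rw [indicator_of_notMem (fun h => hy h.2), indicator_of_notMem (fun h => hy h.2),
      indicator_of_mem (show (x, y) ∈ B ×ˢ Bᶜ from ⟨hx, hy⟩), zero_add, mul_zero, zero_add]
    refine (ext x y hx hy).trans ?_
    gcongr
    exact le_self_add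
  · rw [indicator_of_notMem (fun h => hx h.1), indicator_of_notMem (fun h => hx h.1),
      indicator_of_mem (show (x, y).swap ∈ B ×ˢ Bᶜ from ⟨hy, hx⟩), zero_add, mul_zero, zero_add,
      ← nonlocalDensity_swap]
    refine (ext y x hy hx).trans ?_
    gcongr
    exact le_add_self
  · rw [indicator_of_notMem (fun h => hx h.1)]
    simp [nonlocalDensity, hwp0 x hx, hwp0 y hy]

/-- The weight `w^p` vanishes off `tsupport w`. The exterior integral therefore matters only there,
where it is almost everywhere at most its essential supremum. -/
theorem setLIntegral_exterior_le (hφm : AEMeasurable φ)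
    (hp0 : 0 < p) (hwm : Measurable w) (hwB : tsupport w ⊆ B) (s : ℝ) :
    ∫⁻ z in B ×ˢ Bᶜ, ENNReal.ofReal (φ z.2 ^ (p - 1) / ‖z.1 - z.2‖ ^ (N + s * p)) *
        ENNReal.ofReal (φ z.1 * w z.1 ^ p)
      ≤ essSup (fun x => ∫⁻ y in Bᶜ,
            ENNReal.ofReal (φ y ^ (p - 1) / ‖x - y‖ ^ (N + s * p)))
          (volume.restrict (tsupport w))
        * ∫⁻ x in B, ENNReal.ofReal (φ x * w x ^ p) := by
  set T : EuclideanSpace ℝ (Fin N) → ℝ≥0∞ := fun x =>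
    ∫⁻ y in Bᶜ, ENNReal.ofReal (φ y ^ (p - 1) / ‖x - y‖ ^ (N + s * p)) with hT
  set f : EuclideanSpace ℝ (Fin N) → ℝ≥0∞ := fun x => ENNReal.ofReal (φ x * w x ^ p) with hf
  have hfm : AEMeasurable f := (hφm.mul (hwm.pow_const p).aemeasurable).ennreal_ofReal
  have hf0 : ∀ x, x ∉ tsupport w → f x = 0 := fun x hx => by
    rw [hf]
    simp only
    rw [image_eq_zero_of_notMem_tsupport hx, Real.zero_rpow hp0.ne']; simp
  calc ∫⁻ z in B ×ˢ Bᶜ, ENNReal.ofReal (φ z.2 ^ (p - 1) / ‖z.1 - z.2‖ ^ (N + s * p)) * f z.1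
      ≤ ∫⁻ x in B, ∫⁻ y in Bᶜ,
          ENNReal.ofReal (φ y ^ (p - 1) / ‖x - y‖ ^ (N + s * p)) * f x := by
        rw [Measure.volume_eq_prod, ← Measure.prod_restrict]
        exact lintegral_prod_le _
    _ = ∫⁻ x in B, T x * f x := by
        congr 1; ext x
        exact lintegral_mul_const' _ _ ENNReal.ofReal_ne_top
    _ ≤ ∫⁻ x, T x * f x := setLIntegral_le_lintegral _ _
    _ = ∫⁻ x in tsupport w, T x * f x := by
        rw [← lintegral_indicator (isClosed_tsupport w).measurableSet]
        congr 1; ext x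
        by_cases hx : x ∈ tsupport w
        · rw [indicator_of_mem hx]
        · rw [indicator_of_notMem hx, hf0 x hx, mul_zero]
    _ ≤ ∫⁻ x in tsupport w, essSup T (volume.restrict (tsupport w)) * f x := by
        refine lintegral_mono_ae ?_
        filter_upwards [ENNReal.ae_le_essSup T] with x hx
        gcongr
    _ = essSup T (volume.restrict (tsupport w)) * ∫⁻ x in tsupport w, f x :=
        lintegral_const_mul'' _ hfm.restrict
    _ ≤ _ := by
        gcongr

/-- The nonlocal energy estimate for a fixed order `s`. -/
theorem setLIntegral_add_lintegral_neg_nonlocalDensity_le (hp : 1 < p)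
    (hφ : ∀ x, φ x = max (u x - k) 0) (hu : AEMeasurable u) (hw : Continuous w)
    (hw0 : ∀ x, 0 ≤ w x) (hB : MeasurableSet B) (hwB : tsupport w ⊆ B) (s : ℝ) :
    (∫⁻ z in B ×ˢ B, ENNReal.ofReal (|φ z.1 * w z.1 - φ z.2 * w z.2| ^ p
        / ‖z.1 - z.2‖ ^ (N + s * p)))
      + ENNReal.ofReal (2 ^ p) *
        ∫⁻ z, ENNReal.ofReal (-nonlocalDensity p u (fun x => φ x * w x ^ p) s z)
    ≤ ENNReal.ofReal (2 ^ p) *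
        (∫⁻ z, ENNReal.ofReal (nonlocalDensity p u (fun x => φ x * w x ^ p) s z))
      + (ENNReal.ofReal (caccioppoliConst p) *
          (∫⁻ z in B ×ˢ B, ENNReal.ofReal (max (φ z.1) (φ z.2) ^ p * |w z.1 - w z.2| ^ p
            / ‖z.1 - z.2‖ ^ (N + s * p)))
        + ENNReal.ofReal (2 ^ p) * (2 * (essSup (fun x => ∫⁻ y in Bᶜ,
            ENNReal.ofReal (φ y ^ (p - 1) / ‖x - y‖ ^ (N + s * p)))
          (volume.restrict (tsupport w))
        * ∫⁻ x in B, ENNReal.ofReal (φ x * w x ^ p)))) := by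
  have hp0 : 0 < p := by linarith
  have hφm : AEMeasurable φ := by
    rw [show φ = fun x => max (u x - k) 0 from funext hφ]
    exact (hu.sub_const k).max aemeasurable_const
  have hBB : MeasurableSet (B ×ˢ B) := hB.prod hB
  have hBC : MeasurableSet (B ×ˢ Bᶜ) := hB.prod hB.compl
  have hk : AEMeasurable (fun z : EuclideanSpace ℝ (Fin N) × EuclideanSpace ℝ (Fin N) =>
      ‖z.1 - z.2‖ ^ (N + s * p)) volume := Measurable.aemeasurable (by fun_prop)
  have hu1 : AEMeasurable (fun z : EuclideanSpace ℝ (Fin N) × EuclideanSpace ℝ (Fin N) => u z.1)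
    volume := hu.comp_fst
  have hu2 : AEMeasurable (fun z : EuclideanSpace ℝ (Fin N) × EuclideanSpace ℝ (Fin N) => u z.2)
    volume := hu.comp_snd
  have hφ1 : AEMeasurable (fun z : EuclideanSpace ℝ (Fin N) × EuclideanSpace ℝ (Fin N) => φ z.1)
    volume := hφm.comp_fst
  have hφ2 : AEMeasurable (fun z : EuclideanSpace ℝ (Fin N) × EuclideanSpace ℝ (Fin N) => φ z.2)
    volume := hφm.comp_snd
  have hw1 : AEMeasurable (fun z : EuclideanSpace ℝ (Fin N) × EuclideanSpace ℝ (Fin N) => w z.1)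
    volume := hw.measurable.aemeasurable.comp_fst
  have hw2 : AEMeasurable (fun z : EuclideanSpace ℝ (Fin N) × EuclideanSpace ℝ (Fin N) => w z.2)
    volume := hw.measurable.aemeasurable.comp_snd
  have hd : AEMeasurable (nonlocalDensity p u (fun x => φ x * w x ^ p) s) volume :=
    ((((hu1.sub hu2).abs.pow_const (p - 2)).mul (hu1.sub hu2)).mul
      ((hφ1.mul (hw1.pow_const p)).sub (hφ2.mul (hw2.pow_const p)))).div hk
  have hdn : AEMeasurable (fun z => ENNReal.ofReal (2 ^ p) *
      ENNReal.ofReal (-nonlocalDensity p u (fun x => φ x * w x ^ p) s z)) volume :=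
    hd.neg.ennreal_ofReal.const_mul _
  have hg2 : AEMeasurable ((B ×ˢ B).indicator fun
      z : EuclideanSpace ℝ (Fin N) × EuclideanSpace ℝ (Fin N) =>
      ENNReal.ofReal (max (φ z.1) (φ z.2) ^ p * |w z.1 - w z.2| ^ p
            / ‖z.1 - z.2‖ ^ (N + s * p))) volume :=
    AEMeasurable.indicator (((((hφ1.max hφ2).pow_const p).mul
      ((hw1.sub hw2).abs.pow_const p)).div hk).ennreal_ofReal) hBB
  have hg3 : AEMeasurable ((B ×ˢ Bᶜ).indicator fun
      z : EuclideanSpace ℝ (Fin N) × EuclideanSpace ℝ (Fin N) =>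
        ENNReal.ofReal (φ z.2 ^ (p - 1) / ‖z.1 - z.2‖ ^ (N + s * p)) *
              ENNReal.ofReal (φ z.1 * w z.1 ^ p)) volume :=
    AEMeasurable.indicator (((hφ2.pow_const (p - 1)).div hk).ennreal_ofReal.mul
      (hφ1.mul (hw1.pow_const p)).ennreal_ofReal) hBC
  have h := lintegral_mono (μ := volume) (indicator_add_ofReal_neg_nonlocalDensity_le hp hφ hw0
    (fun x hx => image_eq_zero_of_notMem_tsupport fun h => hx (hwB h)) s)
  rw [lintegral_add_right' _ hdn,
    lintegral_add_left' (hd.ennreal_ofReal.const_mul _),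
    lintegral_add_left' (hg2.const_mul _),
    lintegral_const_mul' _ _ ENNReal.ofReal_ne_top, lintegral_const_mul' _ _ ENNReal.ofReal_ne_top,
    lintegral_const_mul' _ _ ENNReal.ofReal_ne_top, lintegral_const_mul' _ _ ENNReal.ofReal_ne_top,
    lintegral_add_left' hg3, lintegral_indicator hBB, lintegral_indicator hBB] at h
  -- The two exterior regions are swaps of each other, whence the factor `2` in the tail term.
  rw [Measure.volume_eq_prod, lintegral_prod_swap, ← two_mul, ← Measure.volume_eq_prod,
    lintegral_indicator hBC] at h
  refine h.trans ?_
  gcongr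
  exact setLIntegral_exterior_le hφm hp0 hw.measurable hwB s

end Truncation

/-- The local energy estimate. -/
theorem setLIntegral_add_lintegral_neg_local_le {N : ℕ} {p : ℝ} (hp : 1 < p)
    {u φ w : EuclideanSpace ℝ (Fin N) → ℝ} {k : ℝ}
    {U : EuclideanSpace ℝ (Fin N) → EuclideanSpace ℝ (Fin N)}
    {B : Set (EuclideanSpace ℝ (Fin N))} (hφ : ∀ x, φ x = max (u x - k) 0)
    (hw0 : ∀ x, 0 ≤ w x) (hB : MeasurableSet B) (hwB : tsupport w ⊆ B)
    (hint : Integrable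
      (fun x => ‖U x‖ ^ (p - 2) * inner ℝ (U x) (truncationMulGradient u U k p w x))) :
    (∫⁻ x in B, ENNReal.ofReal (w x ^ p * ‖truncationGradient u U k x‖ ^ p))
      + ENNReal.ofReal (2 ^ p) * ∫⁻ x, ENNReal.ofReal
          (-(‖U x‖ ^ (p - 2) * inner ℝ (U x) (truncationMulGradient u U k p w x)))
    ≤ ENNReal.ofReal (2 ^ p) * (∫⁻ x, ENNReal.ofReal
          (‖U x‖ ^ (p - 2) * inner ℝ (U x) (truncationMulGradient u U k p w x)))
      + ENNReal.ofReal (caccioppoliConst p) *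
        ∫⁻ x in B, ENNReal.ofReal (φ x ^ p * ‖gradient w x‖ ^ p) := by
  have hp0 : 0 < p := by linarith
  have h2 : (0 : ℝ) ≤ 2 ^ p := by positivity
  have hc := caccioppoliConst_pos hp
  set f : EuclideanSpace ℝ (Fin N) → ℝ :=
    fun x => ‖U x‖ ^ (p - 2) * inner ℝ (U x) (truncationMulGradient u U k p w x) with hf
  have hm : AEMeasurable (fun x => ENNReal.ofReal (2 ^ p) * ENNReal.ofReal (f x)) volume :=
    hint.1.aemeasurable.ennreal_ofReal.const_mul _
  have hmn : AEMeasurable (fun x => ENNReal.ofReal (2 ^ p) * ENNReal.ofReal (-f x)) volume :=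
    hint.1.aemeasurable.neg.ennreal_ofReal.const_mul _
  rw [← lintegral_indicator hB, ← lintegral_indicator hB,
    ← lintegral_const_mul' _ _ ENNReal.ofReal_ne_top,
    ← lintegral_const_mul' _ _ ENNReal.ofReal_ne_top,
    ← lintegral_const_mul' _ _ ENNReal.ofReal_ne_top,
    ← lintegral_add_right' _ hmn, ← lintegral_add_left' hm]
  refine lintegral_mono fun x => ?_
  have hφ0 : 0 ≤ φ x := by rw [hφ]; exact le_max_right _ _
  by_cases hx : x ∈ B
  · rw [indicator_of_mem hx, indicator_of_mem hx, ← ENNReal.ofReal_mul hc.le]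
    have hwx := hw0 x
    refine ofReal_add_ofReal_mul_ofReal_neg_le (by positivity) h2 (by positivity) ?_
    by_cases hk : k < u x
    · have h3 := rpow_mul_norm_rpow_le hp (U x) (gradient w x) hwx hφ0
      have hD : truncationGradient u U k x = U x :=
        indicator_of_mem (show x ∈ {x | k < u x} from hk) _
      rw [hf]
      simp only [truncationMulGradient]
      rw [hD, ← hφ]
      exact h3
    · have hD : truncationGradient u U k x = 0 :=
        indicator_of_notMem (show x ∉ {x | k < u x} from hk) _
      have hφz : φ x = 0 := by rw [hφ]; exact max_eq_right (by linarith)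
      rw [hf]
      simp only [truncationMulGradient]
      rw [hD, ← hφ, hφz]
      simp [Real.zero_rpow hp0.ne']
  · have hwx : w x = 0 := image_eq_zero_of_notMem_tsupport fun h => hx (hwB h)
    rw [indicator_of_notMem hx, indicator_of_notMem hx, hf]
    simp [truncationMulGradient_eq_zero hp hwx]

/-- The nonlocal energy estimate, integrated with respect to the order `s`. -/
theorem lintegral_add_lintegral_neg_nonlocal_le {N : ℕ} (hN : 1 ≤ N) {p : ℝ} (hp : 1 < p)
    {μ : Measure ℝ} [IsFiniteMeasure μ]
    {u φ w : EuclideanSpace ℝ (Fin N) → ℝ} {k : ℝ}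
    {B : Set (EuclideanSpace ℝ (Fin N))} (hφ : ∀ x, φ x = max (u x - k) 0)
    (hu : AEMeasurable u) (hw : Continuous w)
    (hw0 : ∀ x, 0 ≤ w x) (hB : MeasurableSet B) (hwB : tsupport w ⊆ B)
    (hint : Integrable (fun q : ℝ × (EuclideanSpace ℝ (Fin N) × EuclideanSpace ℝ (Fin N)) =>
      normConst N p q.1 * nonlocalDensity p u (fun x => φ x * w x ^ p) q.1 q.2)
      ((μ.restrict (Ioo 0 1)).prod volume)) :
    (∫⁻ s in Ioo (0 : ℝ) 1, ENNReal.ofReal (normConst N p s) *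
        (∫⁻ z in B ×ˢ B, ENNReal.ofReal (|φ z.1 * w z.1 - φ z.2 * w z.2| ^ p
          / ‖z.1 - z.2‖ ^ (N + s * p))) ∂μ)
      + ENNReal.ofReal (2 ^ p) * ∫⁻ q, ENNReal.ofReal
          (-(normConst N p q.1 * nonlocalDensity p u (fun x => φ x * w x ^ p) q.1 q.2))
          ∂((μ.restrict (Ioo 0 1)).prod volume)
    ≤ ENNReal.ofReal (2 ^ p) * (∫⁻ q, ENNReal.ofReal
          (normConst N p q.1 * nonlocalDensity p u (fun x => φ x * w x ^ p) q.1 q.2)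
          ∂((μ.restrict (Ioo 0 1)).prod volume))
      + (ENNReal.ofReal (caccioppoliConst p) *
          (∫⁻ s in Ioo (0 : ℝ) 1, ENNReal.ofReal (normConst N p s) *
            (∫⁻ z in B ×ˢ B, ENNReal.ofReal (max (φ z.1) (φ z.2) ^ p * |w z.1 - w z.2| ^ p
              / ‖z.1 - z.2‖ ^ (N + s * p))) ∂μ)
        + 2 * ENNReal.ofReal (2 ^ p) * ∫⁻ s in Ioo (0 : ℝ) 1, ENNReal.ofReal (normConst N p s) *
          (essSup (fun x => ∫⁻ y in Bᶜ,
            ENNReal.ofReal (φ y ^ (p - 1) / ‖x - y‖ ^ (N + s * p)))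
          (volume.restrict (tsupport w))
          * ∫⁻ x in B, ENNReal.ofReal (φ x * w x ^ p)) ∂μ) := by
  set J : ℝ × (EuclideanSpace ℝ (Fin N) × EuclideanSpace ℝ (Fin N)) → ℝ := fun q =>
    normConst N p q.1 * nonlocalDensity p u (fun x => φ x * w x ^ p) q.1 q.2 with hJ
  set a := ENNReal.ofReal (2 ^ p) with ha
  set b := ENNReal.ofReal (caccioppoliConst p) with hb
  have ha' : a ≠ ⊤ := ENNReal.ofReal_ne_top
  have hb' : b ≠ ⊤ := ENNReal.ofReal_ne_top
  have hφm : AEMeasurable φ := by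
    rw [show φ = fun x => max (u x - k) 0 from funext hφ]
    exact (hu.sub_const k).max aemeasurable_const
  have hJp : AEMeasurable (fun q => ENNReal.ofReal (J q)) ((μ.restrict (Ioo 0 1)).prod volume) :=
    hint.1.aemeasurable.ennreal_ofReal
  have hJn : AEMeasurable (fun q => ENNReal.ofReal (-J q)) ((μ.restrict (Ioo 0 1)).prod volume) :=
    hint.1.aemeasurable.neg.ennreal_ofReal
  have hmP : AEMeasurable (fun s => a * ∫⁻ z, ENNReal.ofReal (J (s, z))) (μ.restrict (Ioo 0 1)) :=
    hJp.lintegral_prod_right'.const_mul a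
  have hmR : AEMeasurable (fun s => b * (ENNReal.ofReal (normConst N p s) *
      (∫⁻ z in B ×ˢ B, ENNReal.ofReal (max (φ z.1) (φ z.2) ^ p * |w z.1 - w z.2| ^ p
              / ‖z.1 - z.2‖ ^ (N + s * p))))) (μ.restrict (Ioo 0 1)) := by
    refine ((aemeasurable_normConst hN hp μ).ennreal_ofReal.mul ?_).const_mul b
    have hφ1 : AEMeasurable (fun z : EuclideanSpace ℝ (Fin N) × EuclideanSpace ℝ (Fin N) => φ z.1)
      volume := hφm.comp_fst
    have hφ2 : AEMeasurable (fun z : EuclideanSpace ℝ (Fin N) × EuclideanSpace ℝ (Fin N) => φ z.2)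
      volume := hφm.comp_snd
    have hw' : Measurable (fun z : EuclideanSpace ℝ (Fin N) × EuclideanSpace ℝ (Fin N) =>
        |w z.1 - w z.2| ^ p) :=
      (Continuous.measurable (by fun_prop : Continuous fun
        z : EuclideanSpace ℝ (Fin N) × EuclideanSpace ℝ (Fin N) => |w z.1 - w z.2|)).pow_const p
    have hn : AEMeasurable (fun z : EuclideanSpace ℝ (Fin N) × EuclideanSpace ℝ (Fin N) =>
        max (φ z.1) (φ z.2) ^ p * |w z.1 - w z.2| ^ p) (volume.restrict (B ×ˢ B)) :=
      (((hφ1.max hφ2).pow_const p).mul hw'.aemeasurable).restrict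
    have hk : Measurable (fun q : ℝ × (EuclideanSpace ℝ (Fin N) × EuclideanSpace ℝ (Fin N)) =>
        ‖q.2.1 - q.2.2‖ ^ (N + q.1 * p)) := by fun_prop
    have hj : AEMeasurable (fun q : ℝ × (EuclideanSpace ℝ (Fin N) × EuclideanSpace ℝ (Fin N)) =>
        ENNReal.ofReal (max (φ q.2.1) (φ q.2.2) ^ p * |w q.2.1 - w q.2.2| ^ p
          / ‖q.2.1 - q.2.2‖ ^ (N + q.1 * p)))
        ((μ.restrict (Ioo 0 1)).prod (volume.restrict (B ×ˢ B))) :=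
      ((AEMeasurable.comp_snd hn).div hk.aemeasurable).ennreal_ofReal
    exact hj.lintegral_prod_right'
  have hpt : ∀ s ∈ Ioo (0 : ℝ) 1, _ := fun s _ =>
    setLIntegral_add_lintegral_neg_nonlocalDensity_le hp hφ hu hw hw0 hB hwB s
  have eP : ∀ s ∈ Ioo (0 : ℝ) 1, ∫⁻ z, ENNReal.ofReal (J (s, z)) = ENNReal.ofReal (normConst N p s) *
      ∫⁻ z, ENNReal.ofReal (nonlocalDensity p u (fun x => φ x * w x ^ p) s z) := fun s hs => by
    rw [← lintegral_const_mul' _ _ ENNReal.ofReal_ne_top]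
    congr 1; ext z
    rw [hJ, ← ENNReal.ofReal_mul (normConst_nonneg N hp hs)]
  have eN : ∀ s ∈ Ioo (0 : ℝ) 1, ∫⁻ z, ENNReal.ofReal (-J (s, z))
      = ENNReal.ofReal (normConst N p s) *
      ∫⁻ z, ENNReal.ofReal (-nonlocalDensity p u (fun x => φ x * w x ^ p) s z) := fun s hs => by
    rw [← lintegral_const_mul' _ _ ENNReal.ofReal_ne_top]
    congr 1; ext z
    rw [hJ, ← ENNReal.ofReal_mul (normConst_nonneg N hp hs), mul_neg]
  -- On the right, additivity is applied with only the first summand measurable, so measurability in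
  -- `s` of the essential supremum is not needed. On the left, superadditivity of the integral
  -- suffices.
  rw [lintegral_prod _ hJp, lintegral_prod _ hJn, ← lintegral_const_mul' _ _ ha',
    ← lintegral_const_mul' _ _ ha', ← lintegral_const_mul' _ _ hb',
    ← lintegral_const_mul' _ _ (ENNReal.mul_ne_top ENNReal.ofNat_ne_top ha'),
    ← lintegral_add_left' hmR, ← lintegral_add_left' hmP]
  refine (le_lintegral_add _ _).trans (setLIntegral_mono' measurableSet_Ioo fun s hs => ?_)
  rw [eP s hs, eN s hs]
  have h := mul_le_mul_right (hpt s hs) (ENNReal.ofReal (normConst N p s))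
  refine le_trans (le_of_eq ?_) (h.trans (le_of_eq ?_)) <;> ring

/-! ### The Caccioppoli inequality -/

/-- The Caccioppoli inequality for truncations of weak subsolutions. -/
theorem IsWeakSubsolution.caccioppoli {N : ℕ} (hN : 1 ≤ N) {p : ℝ} (hp : 1 < p)
    {μ : Measure ℝ} [IsFiniteMeasure μ] {Ω : Set (EuclideanSpace ℝ (Fin N))} (hΩ : IsOpen Ω)
    {u φ : EuclideanSpace ℝ (Fin N) → ℝ} {k : ℝ} (hu : IsWeakSubsolution μ p Ω u)
    (hφ : ∀ x, φ x = max (u x - k) 0) :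
    ∃ Dφ : EuclideanSpace ℝ (Fin N) → EuclideanSpace ℝ (Fin N),
      MemW1pLoc p Ω φ Dφ ∧
      ∀ B ⊆ Ω, MeasurableSet B →
      ∀ (w : EuclideanSpace ℝ (Fin N) → ℝ), IsTestFunction B w → (∀ x, 0 ≤ w x) →
        μ {1} * (∫⁻ x in B, ENNReal.ofReal (w x ^ p * ‖Dφ x‖ ^ p))
          + (∫⁻ s in Ioo (0 : ℝ) 1, ENNReal.ofReal (normConst N p s) *
              (∫⁻ z in B ×ˢ B, ENNReal.ofReal (|φ z.1 * w z.1 - φ z.2 * w z.2| ^ p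
                  / ‖z.1 - z.2‖ ^ (N + s * p))) ∂μ)
        ≤ ENNReal.ofReal (2 * caccioppoliConst p) *
          ((∫⁻ s in Ioo (0 : ℝ) 1, ENNReal.ofReal (normConst N p s) *
              (∫⁻ z in B ×ˢ B, ENNReal.ofReal (max (φ z.1) (φ z.2) ^ p * |w z.1 - w z.2| ^ p
                  / ‖z.1 - z.2‖ ^ (N + s * p))) ∂μ)
          + (∫⁻ s in Ioo (0 : ℝ) 1, ENNReal.ofReal (normConst N p s) *
              (essSup (fun x => ∫⁻ y in Bᶜ,
                  ENNReal.ofReal (φ y ^ (p - 1) / ‖x - y‖ ^ (N + s * p)))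
                (volume.restrict (tsupport w))
              * ∫⁻ x in B, ENNReal.ofReal (φ x * w x ^ p)) ∂μ)
          + μ {1} * ∫⁻ x in B, ENNReal.ofReal (φ x ^ p * ‖gradient w x‖ ^ p)) := by
  obtain ⟨hut, U, hU, hsub⟩ := hu
  have hφe : φ = fun x => max (u x - k) 0 := funext hφ
  refine ⟨truncationGradient u U k, hφe ▸ hU.truncation hΩ k, fun B hBΩ hB w hw hw0 => ?_⟩
  have hK : IsCompact (tsupport w) := hw.2.1
  have hKΩ : tsupport w ⊆ Ω := hw.2.2.trans hBΩ
  have hwΩ : IsTestFunction Ω w := ⟨hw.1, hw.2.1, hKΩ⟩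
  set v : EuclideanSpace ℝ (Fin N) → ℝ := fun x => φ x * w x ^ p with hv
  set V := truncationMulGradient u U k p w with hV
  have hve : v = fun x => max (u x - k) 0 * w x ^ p := by rw [hv, hφe]
  have hvK : MemW1pZero p (tsupport w) v V :=
    hve ▸ hU.truncation_mul hp hΩ k hwΩ Subset.rfl
  have hφ0 : ∀ x, 0 ≤ φ x := fun x => by rw [hφ]; exact le_max_right _ _
  -- The weak inequality requires an open set compactly contained in `Ω`, whereas the convergence
  -- estimates use the compact support of `w`. The test function is admissible for both.
  obtain ⟨Ω', hΩ', hKΩ', hΩ'Ω, hΩ'c⟩ := exists_open_between_and_isCompact_closure hK hΩ hKΩ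
  have hweak := hsub Ω' hΩ' hΩ'c hΩ'Ω v V (hve ▸ hU.truncation_mul hp hΩ k hwΩ hKΩ')
    (fun x => mul_nonneg (hφ0 x) (Real.rpow_nonneg (hw0 x) p))
  have hV0 : ∀ x, x ∉ tsupport w → V x = 0 := fun x hx =>
    truncationMulGradient_eq_zero hp (image_eq_zero_of_notMem_tsupport hx)
  have hJ := integrable_normConst_mul_nonlocalDensity hN hp hΩ hut hU hK hKΩ hvK
  have hl := integrable_norm_rpow_mul_inner hp (hU.2 _ hKΩ hK).2 hvK.2.2.1 hV0
  have hnl := lintegral_add_lintegral_neg_nonlocal_le hN hp hφ hut.aemeasurable hw.1.continuous hw0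
    hB hw.2.2 hJ
  have hloc := setLIntegral_add_lintegral_neg_local_le hp (U := U) hφ hw0 hB hw.2.2 hl
  have hP := hJ.lintegral_lt_top
  have hQ := hJ.neg.lintegral_lt_top
  have hP' := hl.lintegral_lt_top
  have hQ' := hl.neg.lintegral_lt_top
  have e1 := integral_eq_lintegral_pos_part_sub_lintegral_neg_part hJ
  have e2 := integral_eq_lintegral_pos_part_sub_lintegral_neg_part hl
  -- Absolute convergence allows the iterated integral in `s` and `(x, y)` to be read as one
  -- integral over the product. The local integral extends to the whole space because `V` vanishes
  -- outside `Ω`.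
  have e3 : weakForm μ p Ω u U v V = (∫ q, normConst N p q.1 * nonlocalDensity p u v q.1 q.2
        ∂((μ.restrict (Ioo 0 1)).prod volume))
      + μ.real {1} * ∫ x, ‖U x‖ ^ (p - 2) * inner ℝ (U x) (V x) := by
    rw [integral_prod _ hJ]
    simp_rw [integral_const_mul]
    rw [← setIntegral_eq_integral_of_forall_compl_eq_zero (s := Ω)
      (f := fun x => ‖U x‖ ^ (p - 2) * inner ℝ (U x) (V x))
      (fun x hx => by rw [hV0 x fun h => hx (hKΩ h)]; simp)]
    rfl
  rw [e3, e1, e2] at hweak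
  simp only [Pi.neg_apply] at hQ hQ'
  set P := ∫⁻ q, ENNReal.ofReal (normConst N p q.1 * nonlocalDensity p u v q.1 q.2)
        ∂((μ.restrict (Ioo 0 1)).prod volume)
  set Q := ∫⁻ q, ENNReal.ofReal (-(normConst N p q.1 * nonlocalDensity p u v q.1 q.2))
        ∂((μ.restrict (Ioo 0 1)).prod volume)
  set P' := ∫⁻ x, ENNReal.ofReal (‖U x‖ ^ (p - 2) * inner ℝ (U x) (V x))
  set Q' := ∫⁻ x, ENNReal.ofReal (-(‖U x‖ ^ (p - 2) * inner ℝ (U x) (V x)))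
  set m := μ {1} with hm
  have hmfin : m ≠ ⊤ := measure_ne_top μ _
  -- The sign of the weak form, restated as an inequality between its positive and negative parts in
  -- `[0, ∞]`, all of which are finite.
  have hPQ : P + m * P' ≤ Q + m * Q' := by
    have t1 : P + m * P' ≠ ⊤ := by finiteness
    have t2 : Q + m * Q' ≠ ⊤ := by finiteness
    rw [← ENNReal.toReal_le_toReal t1 t2, ENNReal.toReal_add hP.ne (by finiteness),
      ENNReal.toReal_add hQ.ne (by finiteness), ENNReal.toReal_mul, ENNReal.toReal_mul]
    have : μ.real {1} = m.toReal := rfl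
    rw [this] at hweak
    linarith
  have hab : ENNReal.ofReal (2 ^ p) ≤ ENNReal.ofReal (caccioppoliConst p) :=
    ENNReal.ofReal_le_ofReal (two_rpow_le_caccioppoliConst hp)
  have hC : ENNReal.ofReal (2 * caccioppoliConst p) = 2 * ENNReal.ofReal (caccioppoliConst p) := by
    rw [ENNReal.ofReal_mul (by norm_num)]; simp
  rw [hC]
  have ha' : ENNReal.ofReal (2 ^ p) ≠ ⊤ := ENNReal.ofReal_ne_top
  set a := ENNReal.ofReal (2 ^ p)
  set b := ENNReal.ofReal (caccioppoliConst p)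
  set A1 := ∫⁻ x in B, ENNReal.ofReal (w x ^ p * ‖truncationGradient u U k x‖ ^ p)
  set A2 := ∫⁻ s in Ioo (0 : ℝ) 1, ENNReal.ofReal (normConst N p s) *
              (∫⁻ z in B ×ˢ B, ENNReal.ofReal (|φ z.1 * w z.1 - φ z.2 * w z.2| ^ p
                  / ‖z.1 - z.2‖ ^ (N + s * p))) ∂μ
  set R1 := ∫⁻ s in Ioo (0 : ℝ) 1, ENNReal.ofReal (normConst N p s) *
              (∫⁻ z in B ×ˢ B, ENNReal.ofReal (max (φ z.1) (φ z.2) ^ p * |w z.1 - w z.2| ^ p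
                  / ‖z.1 - z.2‖ ^ (N + s * p))) ∂μ
  set R2 := ∫⁻ s in Ioo (0 : ℝ) 1, ENNReal.ofReal (normConst N p s) *
              (essSup (fun x => ∫⁻ y in Bᶜ,
                  ENNReal.ofReal (φ y ^ (p - 1) / ‖x - y‖ ^ (N + s * p)))
                (volume.restrict (tsupport w))
              * ∫⁻ x in B, ENNReal.ofReal (φ x * w x ^ p)) ∂μ
  set R3 := ∫⁻ x in B, ENNReal.ofReal (φ x ^ p * ‖gradient w x‖ ^ p)
  -- The negative parts are finite, so adding them to both sides loses nothing and they can be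
  -- cancelled at the end. The constant is twice `caccioppoliConst p` because the tail term was
  -- counted twice.
  have hfin : a * (Q + m * Q') ≠ ⊤ := by finiteness
  refine (ENNReal.add_le_add_iff_right hfin).1 ?_
  calc m * A1 + A2 + a * (Q + m * Q') = (A2 + a * Q) + m * (A1 + a * Q') := by ring
    _ ≤ (a * P + (b * R1 + 2 * a * R2)) + m * (a * P' + b * R3) := by gcongr
    _ = (1 * b * R1 + 2 * a * R2 + 1 * b * (m * R3)) + a * (P + m * P') := by ring
    _ ≤ (2 * b * R1 + 2 * b * R2 + 2 * b * (m * R3)) + a * (Q + m * Q') := by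
        gcongr <;> norm_num
    _ = _ := by ring

theorem weakForm_neg_left {N : ℕ} (μ : Measure ℝ) (p : ℝ) (Ω : Set (EuclideanSpace ℝ (Fin N)))
    (u : EuclideanSpace ℝ (Fin N) → ℝ)
    (U : EuclideanSpace ℝ (Fin N) → EuclideanSpace ℝ (Fin N))
    (v : EuclideanSpace ℝ (Fin N) → ℝ)
    (V : EuclideanSpace ℝ (Fin N) → EuclideanSpace ℝ (Fin N)) :
    weakForm μ p Ω (fun x => -u x) (fun x => -U x) v V = -weakForm μ p Ω u U v V := by
  have e : ∀ (s : ℝ) (z : EuclideanSpace ℝ (Fin N) × EuclideanSpace ℝ (Fin N)),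
      |-u z.1 - -u z.2| ^ (p - 2) * (-u z.1 - -u z.2) * (v z.1 - v z.2)
          / ‖z.1 - z.2‖ ^ (N + s * p)
        = -(|u z.1 - u z.2| ^ (p - 2) * (u z.1 - u z.2) * (v z.1 - v z.2)
          / ‖z.1 - z.2‖ ^ (N + s * p)) := fun s z => by
    rw [show -u z.1 - -u z.2 = -(u z.1 - u z.2) by ring, abs_neg]; ring
  unfold weakForm
  simp_rw [e, norm_neg, inner_neg_left, mul_neg, integral_neg, mul_neg, integral_neg]
  ring

theorem MemTailSpace.neg {N : ℕ} {μ : Measure ℝ} {p : ℝ} {u : EuclideanSpace ℝ (Fin N) → ℝ}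
    (h : MemTailSpace μ p u) : MemTailSpace μ p (fun x => -u x) := by
  refine ⟨fun K hK => (h.1 K hK).neg, fun x r hr => ?_⟩
  have := h.2 x r hr
  unfold superTail at this ⊢
  simpa only [abs_neg] using this

theorem MemW1pLoc.neg {N : ℕ} {p : ℝ} {Ω : Set (EuclideanSpace ℝ (Fin N))}
    {u : EuclideanSpace ℝ (Fin N) → ℝ}
    {U : EuclideanSpace ℝ (Fin N) → EuclideanSpace ℝ (Fin N)} (h : MemW1pLoc p Ω u U) :
    MemW1pLoc p Ω (fun x => -u x) (fun x => -U x) := by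
  refine ⟨⟨h.1.1.neg, h.1.2.1.neg, fun η hη => ?_⟩,
    fun K hK hKc => ⟨(h.2 K hK hKc).1.neg, (h.2 K hK hKc).2.neg⟩⟩
  simp only [neg_smul, smul_neg, integral_neg]
  rw [h.1.2.2 η hη]

/-- The weak form is odd in `u`, so negation reverses the sign of the tested inequality. -/
theorem IsWeakSupersolution.neg {N : ℕ} {μ : Measure ℝ} {p : ℝ}
    {Ω : Set (EuclideanSpace ℝ (Fin N))} {u : EuclideanSpace ℝ (Fin N) → ℝ}
    (h : IsWeakSupersolution μ p Ω u) : IsWeakSubsolution μ p Ω (fun x => -u x) := by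
  obtain ⟨h1, U, h2, h3⟩ := h
  refine ⟨h1.neg, fun x => -U x, h2.neg, fun Ω' ho hc hs v V hv hv0 => ?_⟩
  rw [weakForm_neg_left]
  exact neg_nonpos.2 (h3 Ω' ho hc hs v V hv hv0)

theorem theorem1p1 (p : ℝ) (hp : 1 < p) :
    ∃ C : ℝ, 0 < C ∧
      ∀ (N : ℕ), 1 ≤ N →
      ∀ (μ : Measure ℝ) [IsFiniteMeasure μ],
        μ (Icc (0 : ℝ) 1)ᶜ = 0 → μ {0} = 0 → 0 < μ (Ioo (0 : ℝ) 1) → 0 < μ {1} →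
      ∀ (Ω : Set (EuclideanSpace ℝ (Fin N))),
        IsOpen Ω → IsConnected Ω → Bornology.IsBounded Ω →
      ∀ (u φ : EuclideanSpace ℝ (Fin N) → ℝ) (k : ℝ),
        ((IsWeakSubsolution μ p Ω u ∧ φ = fun x => max (u x - k) 0) ∨
          (IsWeakSupersolution μ p Ω u ∧ φ = fun x => max (-(u x - k)) 0)) →
      ∃ Dφ : EuclideanSpace ℝ (Fin N) → EuclideanSpace ℝ (Fin N),
        MemW1pLoc p Ω φ Dφ ∧
        ∀ (x₀ : EuclideanSpace ℝ (Fin N)) (r : ℝ), 0 < r → ball x₀ r ⊆ Ω →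
        ∀ (w : EuclideanSpace ℝ (Fin N) → ℝ),
          IsTestFunction (ball x₀ r) w → (∀ x, 0 ≤ w x) →
          μ {1} * (∫⁻ x in ball x₀ r, ENNReal.ofReal (w x ^ p * ‖Dφ x‖ ^ p))
            + (∫⁻ s in Ioo (0 : ℝ) 1, ENNReal.ofReal (normConst N p s) *
                (∫⁻ z in ball x₀ r ×ˢ ball x₀ r,
                  ENNReal.ofReal (|φ z.1 * w z.1 - φ z.2 * w z.2| ^ p
                    / ‖z.1 - z.2‖ ^ (N + s * p))) ∂μ)
          ≤ ENNReal.ofReal C *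
            ((∫⁻ s in Ioo (0 : ℝ) 1, ENNReal.ofReal (normConst N p s) *
                (∫⁻ z in ball x₀ r ×ˢ ball x₀ r,
                  ENNReal.ofReal (max (φ z.1) (φ z.2) ^ p * |w z.1 - w z.2| ^ p
                    / ‖z.1 - z.2‖ ^ (N + s * p))) ∂μ)
            + (∫⁻ s in Ioo (0 : ℝ) 1, ENNReal.ofReal (normConst N p s) *
                (essSup (fun x => ∫⁻ y in (ball x₀ r)ᶜ,
                    ENNReal.ofReal (φ y ^ (p - 1) / ‖x - y‖ ^ (N + s * p)))
                  (volume.restrict (tsupport w))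
                * ∫⁻ x in ball x₀ r, ENNReal.ofReal (φ x * w x ^ p)) ∂μ)
            + μ {1} * ∫⁻ x in ball x₀ r,
                ENNReal.ofReal (φ x ^ p * ‖gradient w x‖ ^ p)) := by
  refine ⟨2 * caccioppoliConst p, mul_pos two_pos (caccioppoliConst_pos hp), ?_⟩
  intro N hN μ _ _ _ _ _ Ω hΩ _ _ u φ k h
  rcases h with ⟨hu, rfl⟩ | ⟨hu, rfl⟩
  · obtain ⟨Dφ, hD, H⟩ := hu.caccioppoli hN hp hΩ (k := k) fun x => rfl
    exact ⟨Dφ, hD, fun x₀ r _ hB w hw hw0 => H (ball x₀ r) hB measurableSet_ball w hw hw0⟩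
  -- The level becomes `-k` because `(u - k)_- = (-u - (-k))_+`.
  · obtain ⟨Dφ, hD, H⟩ := hu.neg.caccioppoli hN hp hΩ (k := -k)
      (φ := fun x => max (-(u x - k)) 0) fun x => by
        rw [neg_sub, sub_neg_eq_add, neg_add_eq_sub]
    exact ⟨Dφ, hD, fun x₀ r _ hB w hw hw0 => H (ball x₀ r) hB measurableSet_ball w hw hw0⟩
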